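/- **Setting.** Let $E$ be $\mathbb R^d$ with an arbitrary norm, $\mathcal Z\subseteq E$ measurable, $\hat{\mathbb P}$ a probability measure on $\mathcal Z$, $\rho,\eta>0$, and let $\nu_z$ be the uniform distribution on $\{z'\in\mathcal Z:\|z'-z\|\le\rho\}$ (of positive volume for $z\in\operatorname{supp}\hat{\mathbb P}$). Let $\phi:\mathbb R\to[0,\infty]$ be lower semicontinuous and strongly convex with modulus $\kappa>0$, with $\phi(1)=0$, $\phi=\infty$ on $(-\infty,0)$, and $\phi$ finite and differentiable on $(0,\infty)$. Let $\Theta\subseteq\mathbb R^n$ be closed and convex, and consider $$\min_{\theta\in\Theta}F(\theta)=\mathbb E_{z\sim\hat{\mathbb P}}[R(\theta;z)],\qquad R(\theta;z)=\sup_{\gamma\ll\nu_z}\Big\{\mathbb E_{\gamma}[f_\theta]-\eta\,\mathbb E_{\nu_z}\big[\phi(\tfrac{d\gamma}{d\nu_z})\big]\Big\},$$ where $f$ is measurable and $R(\theta;\cdot)$ is $\hat{\mathbb P}$-integrable for each $\theta\in\Theta$. A random $\theta\in\Theta$ is *$\delta$-optimal* if $\mathbb E[F(\theta)-F(\theta^*)]\le\delta$,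 where $\theta^*$ is a minimizer of $F$ on $\Theta$ (assumed to exist). **Assumptions.** (i) For every $z\in\mathcal Z$, $\theta\mapsto f_\theta(z)$ is convex and $L_f$-Lipschitz (Euclidean norm) on $\Theta$; $\nabla f_\theta(z)$ denotes a measurable choice of subgradients of norm at most $L_f$. (ii) For all $\theta\in\Theta$, $z\in\operatorname{supp}\hat{\mathbb P}$, $m\ge1$ and almost all i.i.d. samples $z_1',\dots,z_m'\sim\nu_z$, with $f_i=f_\theta(z_i')$, the maximizer $\gamma^*$ of $$\sum_{i}\gamma_if_i-\tfrac{\eta}{m}\sum_i\phi(m\gamma_i)\quad\text{over the probability simplex }\Delta^m\qquad(\ast)$$ satisfies $\chi^2(\gamma^*,\frac1m\mathbf 1)\le C$. (iii) For all $\theta\in\Theta$, $z\in\operatorname{supp}\hat{\mathbb P}$, the inverse cdf of $(f_\theta)_\#\nu_z$ is $G$-Lipschitz on $(0,1)$. (iv) The initial point $\theta_1\in\Theta$ satisfies $\|\theta_1-\theta^*\|_2\le D$ for some minimizer $\theta^*$. **Bisection search.** Let $K=\lim_{s\to0+}\phi'(s)\in[-\infty,\infty)$. Given $f_1,\dots,f_m$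 with minimum $\underline f$ and maximum $\overline f$, start from the interval $[\underline f,\overline\mu]$, where $\overline\mu=\overline f-\eta(\underline f-\overline f)$ if $K=-\infty$ and $\overline\mu=\overline f-\eta K$ otherwise. For $N$ iterations let $\mu$ be the midpoint, put $\gamma_i(\mu)=0$ if $f_i\le\mu+\eta K$ and $\gamma_i(\mu)=\frac1m(\phi')^{-1}(\frac{f_i-\mu}{\eta})$ otherwise, and replace the upper end by $\mu$ if $\sum_i\gamma_i(\mu)-1\le0$, the lower end otherwise. Output the last $\mu$, $\widetilde\gamma=\gamma(\mu)$, and the value of the Lagrangian $\sum_i\widetilde\gamma_if_i-\frac{\eta}{m}\sum_i\phi(m\widetilde\gamma_i)+\mu(1-\sum_i\widetilde\gamma_i)$ as estimated optimal value. For $w=(z_1',\dots,z_m')$ let $\nabla\widetilde R(\theta;w)=\sum_i\widetilde\gamma_i\nabla f_\theta(z_i')$ with $f_i=f_\theta(z'_i)$. **Estimators.** $\zeta^\ell$ consists of $z\sim\hat{\mathbb P}$ and, given $z$, $2^\ell$ i.i.d. points from $\nu_z$. The SG estimator (batch size 1, level $L$) is $V(\theta)=\nabla\widetilde R(\theta;z'_{1:2^L})$.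 The RT-MLMC estimator (batch size 1) draws $\hat L\in\{0,\dots,L\}$ with $p_\ell=\mathbb P(\hat L=\ell)=2^{-\ell}/(2-2^{-L})$ and then $\zeta^{\hat L}$, and is $V(\theta)=p_{\hat L}^{-1}G^{\hat L}(\theta,\zeta^{\hat L})$, where $G^0=\nabla\widetilde R(\theta;z'_1)$ and $G^\ell=\nabla\widetilde R(\theta;z'_{1:2^\ell})-\frac12[\nabla\widetilde R(\theta;z'_{1:2^{\ell-1}})+\nabla\widetilde R(\theta;z'_{2^{\ell-1}+1:2^\ell})]$ for $\ell\ge1$. Projected SGD iterates $\theta_{t+1}=\mathrm{Proj}_\Theta(\theta_t-\tau V(\theta_t))$, $t=1,\dots,T-1$, with fresh independent samples, and outputs $\widetilde\theta_{1:T}=\frac1T\sum_{t=1}^T\theta_t$. Its cost is the number of generated samples $z$, $z'$ plus the number of queries of the values $f_i$ made by the bisection searches (each pass through $m$ values costs $m$). **Theorem.** There are $c,\delta_0>0$, depending only on $\phi,\kappa,\eta,L_f,C,G,D$, such that for every $0<\delta<\delta_0$, with batch size $1$ and $L=\max\{0,\lceil\log_2(8G/\delta)\rceil\}$, the following holds for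 all problems as above. 1. (SG) There are $T\le c\,\delta^{-2}$, $0<\tau\le c\,\delta$ and $N\le c\log\frac1\delta$, depending only on $\delta$ and the constants above, such that in every search used the estimated optimal value of $(\ast)$ is almost surely within $\epsilon=\delta/8$ of the optimal value, $\widetilde\theta_{1:T}$ is $\delta$-optimal, and the cost is at most $c\,\delta^{-3}\log\frac1\delta$. 2. (RT-MLMC) There are $T\le c\,\delta^{-2}(\log\frac1\delta)^2$, $0<\tau\le c\,\delta(\log\frac1\delta)^{-2}$ and $N\le c\log\frac1\delta$, depending only on $\delta$ and the constants above, such that in every search used the estimated optimal value of $(\ast)$ is almost surely within $\epsilon=\delta/8$ of the optimal value, $\widetilde\theta_{1:T}$ is $\delta$-optimal, and the expected cost is at most $c\,\delta^{-2}(\log\frac1\delta)^4$. -/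

import Mathlib

open MeasureTheory ProbabilityTheory Filter Topology
open scoped ENNReal NNReal

noncomputable section

namespace AdvRobust

/-- The space of model parameters, with the Euclidean norm. -/
abbrev Param (n : ℕ) : Type := EuclideanSpace ℝ (Fin n)

/-! ### The divergence function -/

/-- `φ : ℝ → [0, ∞]` is a divergence function: lower semicontinuous, `φ 1 = 0`, `φ = ∞` on the
negative reals, convex, and strongly convex with modulus `κ > 0`; it is finite and differentiable
on `(0, ∞)`, so that `φ'` and `(φ')⁻¹` make sense in the bisection search. -/
structure IsDivergence (φ : ℝ → ℝ≥0∞) (κ : ℝ) : Prop where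
  lsc : LowerSemicontinuous φ
  map_one : φ 1 = 0
  map_neg : ∀ x < 0, φ x = ⊤
  finite : ∀ x, 0 < x → φ x ≠ ⊤
  differentiable : ∀ x, 0 < x → DifferentiableAt ℝ (fun s => (φ s).toReal) x
  modulus_pos : 0 < κ
  strongly_convex : ∀ x y a b : ℝ, 0 ≤ a → 0 ≤ b → a + b = 1 →
    φ (a * x + b * y) + ENNReal.ofReal (κ / 2 * a * b * (x - y) ^ 2)
      ≤ ENNReal.ofReal a * φ x + ENNReal.ofReal b * φ y

/-- The derivative `φ'` (used on `(0, ∞)` only). -/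
def dphi (φ : ℝ → ℝ≥0∞) (s : ℝ) : ℝ := deriv (fun t => (φ t).toReal) s

/-- The inverse function `(φ')⁻¹` of `φ'` on `(0, ∞)`. -/
def dphiInv (φ : ℝ → ℝ≥0∞) (y : ℝ) : ℝ := Function.invFunOn (dphi φ) (Set.Ioi 0) y

/-- `K = lim_{s → 0+} φ'(s)`, a real number or `-∞` (the limit exists because `φ'` is monotone). -/
def slopeZero (φ : ℝ → ℝ≥0∞) : EReal :=
  limUnder (𝓝[>] (0 : ℝ)) (fun s => ((dphi φ s : ℝ) : EReal))

/-! ### The penalized problem with finite support -/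

/-- The objective `∑ γ_i f_i - (η / m) ∑ φ (m γ_i)`, with value `-∞` if the penalty is infinite. -/
def discreteObj (φ : ℝ → ℝ≥0∞) (η : ℝ) {m : ℕ} (f γ : Fin m → ℝ) : EReal :=
  ((∑ i, γ i * f i : ℝ) : EReal)
    - ((ENNReal.ofReal (η / m) * ∑ i, φ (m * γ i) : ℝ≥0∞) : EReal)

/-- The optimal value over the probability simplex. -/
def discreteValue (φ : ℝ → ℝ≥0∞) (η : ℝ) {m : ℕ} (f : Fin m → ℝ) : EReal :=
  ⨆ γ ∈ stdSimplex ℝ (Fin m), discreteObj φ η f γ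

/-- `γ` is an optimal probability vector. -/
def IsDiscreteOptimal (φ : ℝ → ℝ≥0∞) (η : ℝ) {m : ℕ} (f γ : Fin m → ℝ) : Prop :=
  γ ∈ stdSimplex ℝ (Fin m) ∧ IsMaxOn (discreteObj φ η f) (stdSimplex ℝ (Fin m)) γ

/-- The `χ²`-divergence of `γ` from the uniform vector `(1/m, …, 1/m)`. -/
def chiSqUniform {m : ℕ} (γ : Fin m → ℝ) : ℝ :=
  ∑ i, (γ i - 1 / m) ^ 2 / (1 / m)

/-! ### The bisection search, with a count of the queries of `f_1, …, f_m` -/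

/-- The `i`-th weight for the multiplier `μ`: zero if `f_i ≤ μ + η K`,
and `(1/m) (φ')⁻¹ ((f_i - μ) / η)` otherwise. -/
def multiplierWeight (φ : ℝ → ℝ≥0∞) (η : ℝ) (m : ℕ) (μ fi : ℝ) : ℝ :=
  open Classical in
  if (((fi - μ) / η : ℝ) : EReal) ≤ slopeZero φ then 0 else 1 / m * dphiInv φ ((fi - μ) / η)

/-- The state of the search: the current interval `[lo, hi]`, the last midpoint `mu`, and the number
of queries made so far. -/
structure BisectState where
  lo : ℝ
  hi : ℝ
  mu : ℝ
  queries : ℕ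

/-- Initial interval: one pass through the data for its minimum and maximum. -/
def bisectInit (φ : ℝ → ℝ≥0∞) (η : ℝ) {m : ℕ} (f : Fin m → ℝ) : BisectState :=
  open Classical in
  { lo := ⨅ i, f i
    hi := if slopeZero φ = ⊥ then (⨆ i, f i) - η * ((⨅ i, f i) - ⨆ i, f i)
      else (⨆ i, f i) - η * (slopeZero φ).toReal
    mu := ⨅ i, f i
    queries := m }

/-- One iteration: one pass through the data to compute `h(mid) = ∑ γ_i - 1`. -/
def bisectStep (φ : ℝ → ℝ≥0∞) (η : ℝ) {m : ℕ} (f : Fin m → ℝ) (s : BisectState) : BisectState :=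
  open Classical in
  let mid := (s.lo + s.hi) / 2
  let h := ∑ i, multiplierWeight φ η m mid (f i) - 1
  if h ≤ 0 then { lo := s.lo, hi := mid, mu := mid, queries := s.queries + m }
  else { lo := mid, hi := s.hi, mu := mid, queries := s.queries + m }

/-- The state after `N` iterations. -/
def bisect (φ : ℝ → ℝ≥0∞) (η : ℝ) (N : ℕ) {m : ℕ} (f : Fin m → ℝ) : BisectState :=
  (bisectStep φ η f)^[N] (bisectInit φ η f)

/-- The estimated primal solution returned by the search. -/
def bisectWeights (φ : ℝ → ℝ≥0∞) (η : ℝ) (N : ℕ) {m : ℕ} (f : Fin m → ℝ) (i : Fin m) : ℝ :=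
  multiplierWeight φ η m (bisect φ η N f).mu (f i)

/-- The estimated optimal value returned by the search: the Lagrangian
`∑ γ_i f_i - (η / m) ∑ φ (m γ_i) + μ (1 - ∑ γ_i)` at the estimated primal-dual solution. -/
def bisectValue (φ : ℝ → ℝ≥0∞) (η : ℝ) (N : ℕ) {m : ℕ} (f : Fin m → ℝ) : ℝ :=
  ∑ i, bisectWeights φ η N f i * f i
    - η / m * ∑ i, (φ (m * bisectWeights φ η N f i)).toReal
    + (bisect φ η N f).mu * (1 - ∑ i, bisectWeights φ η N f i)

/-- The total number of queries; the last pass computes the output weights. -/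
def bisectQueries (φ : ℝ → ℝ≥0∞) (η : ℝ) (N : ℕ) {m : ℕ} (f : Fin m → ℝ) : ℕ :=
  (bisect φ η N f).queries + m

/-! ### The robust learning problem -/

/-- The data of the problem: the sample space `Z`, the radius `ρ`, the observed distribution `P`,
the constraint set `Θ`, the loss `f θ z`, and the (sub)gradient `grad θ z` of `f · z` at `θ`
that the algorithm uses. -/
structure Problem (E : Type*) [MeasurableSpace E] (n : ℕ) where
  Z : Set E
  ρ : ℝ
  P : Measure E
  Θ : Set (Param n)
  f : Param n → E → ℝ
  grad : Param n → E → Param n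

/-- The sampling parameter of level `ℓ`: a data point `z` and `2 ^ ℓ` perturbed points. -/
abbrev Sample (E : Type*) (ℓ : ℕ) : Type _ := E × (Fin (2 ^ ℓ) → E)

namespace Problem

variable {E : Type*} [NormedAddCommGroup E] [NormedSpace ℝ E] [MeasureSpace E] {n : ℕ}

/-- `ν_z`, the uniform distribution on `{z' ∈ Z : ‖z' - z‖ ≤ ρ}`. -/
def ν (p : Problem E n) (z : E) : Measure E :=
  ProbabilityTheory.cond volume (Metric.closedBall z p.ρ ∩ p.Z)

/-- `R(θ; z) = sup_γ E_γ f_θ - η E_{ν_z} φ(dγ/dν_z)`, over the probability measures `γ` that are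
absolutely continuous with respect to `ν_z` and have a finite objective. -/
def R (p : Problem E n) (φ : ℝ → ℝ≥0∞) (η : ℝ) (θ : Param n) (z : E) : ℝ :=
  sSup {v : ℝ | ∃ γ : Measure E, IsProbabilityMeasure γ ∧ γ ≪ p.ν z ∧ Integrable (p.f θ) γ ∧
    (∫⁻ x, φ ((γ.rnDeriv (p.ν z) x).toReal) ∂(p.ν z)) ≠ ⊤ ∧
    v = (∫ x, p.f θ x ∂γ) - η * (∫⁻ x, φ ((γ.rnDeriv (p.ν z) x).toReal) ∂(p.ν z)).toReal}

/-- The objective `F(θ) = E_{z ∼ P} R(θ; z)`. -/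
def F (p : Problem E n) (φ : ℝ → ℝ≥0∞) (η : ℝ) (θ : Param n) : ℝ :=
  ∫ z, p.R φ η θ z ∂p.P

/-- Standing conventions: measurability, `ν_z` well defined at the points of the support of `P`,
`Θ` closed and convex, and a finite objective on `Θ`. -/
structure WellPosed (p : Problem E n) (φ : ℝ → ℝ≥0∞) (η : ℝ) : Prop where
  measurable_Z : MeasurableSet p.Z
  radius_pos : 0 < p.ρ
  isProb : IsProbabilityMeasure p.P
  mem_Z : ∀ᵐ z ∂p.P, z ∈ p.Z
  volume_pos : ∀ z ∈ p.P.support, volume (Metric.closedBall z p.ρ ∩ p.Z) ≠ 0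
  closed_Θ : IsClosed p.Θ
  convex_Θ : Convex ℝ p.Θ
  measurable_f : Measurable (Function.uncurry p.f)
  measurable_grad : Measurable (Function.uncurry p.grad)
  integrable_R : ∀ θ ∈ p.Θ, Integrable (fun z => p.R φ η θ z) p.P

/-- The loss is convex and `Lf`-Lipschitz in `θ ∈ Θ`. -/
structure ConvexLipschitzLoss (p : Problem E n) (Lf : ℝ) : Prop where
  convex : ∀ z ∈ p.Z, ConvexOn ℝ p.Θ (fun θ => p.f θ z)
  lipschitz : ∀ z ∈ p.Z, ∀ θ₁ ∈ p.Θ, ∀ θ₂ ∈ p.Θ, |p.f θ₁ z - p.f θ₂ z| ≤ Lf * ‖θ₁ - θ₂‖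

/-- `grad θ z` is a subgradient at `θ` of the convex `Lf`-Lipschitz function `f · z` on `Θ`. The
norm bound is automatic at interior points of `Θ`, and it only excludes, at boundary points,
unbounded subgradients coming from the normal cone of `Θ`. -/
structure SubgradientOracle (p : Problem E n) (Lf : ℝ) : Prop where
  subgradient : ∀ z ∈ p.Z, ∀ θ ∈ p.Θ, ∀ θ' ∈ p.Θ,
    p.f θ z + inner ℝ (p.grad θ z) (θ' - θ) ≤ p.f θ' z
  norm_le : ∀ z ∈ p.Z, ∀ θ ∈ p.Θ, ‖p.grad θ z‖ ≤ Lf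

/-- For almost all data points `f_θ(z'_1), …, f_θ(z'_m)`, the optimal probability vector has
`χ²`-divergence at most `C` from the uniform one. -/
def ChiSqBound (p : Problem E n) (φ : ℝ → ℝ≥0∞) (η C : ℝ) : Prop :=
  ∀ θ ∈ p.Θ, ∀ z ∈ p.P.support, ∀ m : ℕ, 1 ≤ m →
    ∀ᵐ w ∂(Measure.pi fun _ : Fin m => p.ν z), ∀ γ : Fin m → ℝ,
      IsDiscreteOptimal φ η (fun i => p.f θ (w i)) γ → chiSqUniform γ ≤ C

/-- The inverse cdf `u ↦ inf {x | u ≤ μ (-∞, x]}` of a probability measure on the line. -/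
def _root_.AdvRobust.invCdf (μ : Measure ℝ) (u : ℝ) : ℝ :=
  sInf {x : ℝ | u ≤ μ.real (Set.Iic x)}

/-- The inverse cdf of `(f_θ)_# ν_z` is `G`-Lipschitz. -/
def LipschitzInvCdf (p : Problem E n) (G : ℝ≥0) : Prop :=
  ∀ θ ∈ p.Θ, ∀ z ∈ p.P.support,
    LipschitzOnWith G (invCdf ((p.ν z).map (p.f θ))) (Set.Ioo 0 1)

/-- All the assumptions on the problem together. -/
structure Assumptions (p : Problem E n) (φ : ℝ → ℝ≥0∞) (η Lf C : ℝ) (G : ℝ≥0) : Prop where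
  wellPosed : p.WellPosed φ η
  loss : p.ConvexLipschitzLoss Lf
  oracle : p.SubgradientOracle Lf
  chiSq : p.ChiSqBound φ η C
  invCdf : p.LipschitzInvCdf G

/-- `θs` is a minimizer of `F` over `Θ`. -/
def IsMinimizer (p : Problem E n) (φ : ℝ → ℝ≥0∞) (η : ℝ) (θs : Param n) : Prop :=
  θs ∈ p.Θ ∧ IsMinOn (p.F φ η) p.Θ θs

/-- The random vector `X` is a `δ`-optimal solution of `min_{θ ∈ Θ} F(θ)`. -/
def IsDeltaOptimal (p : Problem E n) (φ : ℝ → ℝ≥0∞) (η : ℝ) {Ω : Type*} [MeasurableSpace Ω]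
    (μ : Measure Ω) (X : Ω → Param n) (δ : ℝ) : Prop :=
  (∀ᵐ ω ∂μ, X ω ∈ p.Θ) ∧ ∃ θs, p.IsMinimizer φ η θs ∧
    Integrable (fun ω => p.F φ η (X ω) - p.F φ η θs) μ ∧
    ∫ ω, (p.F φ η (X ω) - p.F φ η θs) ∂μ ≤ δ

/-! ### Gradient estimators -/

/-- The law of the sampling parameter of level `ℓ`: `z ∼ P`, and given `z` the points
`z'_1, …, z'_{2 ^ ℓ}` are i.i.d. with law `ν_z`. -/
def sampleLaw (p : Problem E n) (ℓ : ℕ) : Measure (Sample E ℓ) :=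
  p.P.bind fun z => (Measure.pi fun _ : Fin (2 ^ ℓ) => p.ν z).map fun w => (z, w)

/-- `∑ γ_i ∇f_θ(z'_i)`, with the weights `γ` from the bisection search with `N` iterations. -/
def approxGrad (p : Problem E n) (φ : ℝ → ℝ≥0∞) (η : ℝ) (N : ℕ) (θ : Param n) {m : ℕ}
    (w : Fin m → E) : Param n :=
  ∑ i, bisectWeights φ η N (fun j => p.f θ (w j)) i • p.grad θ (w i)

/-- The number of queries of loss values when `approxGrad` is computed. -/
def approxGradQueries (p : Problem E n) (φ : ℝ → ℝ≥0∞) (η : ℝ) (N : ℕ) (θ : Param n) {m : ℕ}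
    (w : Fin m → E) : ℕ :=
  bisectQueries φ η N (fun j => p.f θ (w j))

/-- The first half of `2 ^ (ℓ + 1)` points. -/
def _root_.AdvRobust.firstHalf {E : Type*} {ℓ : ℕ} (w : Fin (2 ^ (ℓ + 1)) → E) :
    Fin (2 ^ ℓ) → E :=
  fun i => w ⟨i, by have := i.isLt; rw [pow_succ]; omega⟩

/-- The second half of `2 ^ (ℓ + 1)` points. -/
def _root_.AdvRobust.secondHalf {E : Type*} {ℓ : ℕ} (w : Fin (2 ^ (ℓ + 1)) → E) :
    Fin (2 ^ ℓ) → E :=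
  fun i => w ⟨2 ^ ℓ + i, by have := i.isLt; rw [pow_succ]; omega⟩

/-- The multilevel difference `G^ℓ(θ, ζ^ℓ)`; at level `0` there is nothing to subtract. -/
def levelDiff (p : Problem E n) (φ : ℝ → ℝ≥0∞) (η : ℝ) (N : ℕ) (θ : Param n) :
    (ℓ : ℕ) → Sample E ℓ → Param n
  | 0, ζ => p.approxGrad φ η N θ ζ.2
  | _ + 1, ζ => p.approxGrad φ η N θ ζ.2
      - (1 / 2 : ℝ) • (p.approxGrad φ η N θ (firstHalf ζ.2)
          + p.approxGrad φ η N θ (secondHalf ζ.2))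

/-- The number of queries of loss values when `levelDiff` is computed. -/
def levelDiffQueries (p : Problem E n) (φ : ℝ → ℝ≥0∞) (η : ℝ) (N : ℕ) (θ : Param n) :
    (ℓ : ℕ) → Sample E ℓ → ℕ
  | 0, ζ => p.approxGradQueries φ η N θ ζ.2
  | _ + 1, ζ => p.approxGradQueries φ η N θ ζ.2
      + (p.approxGradQueries φ η N θ (firstHalf ζ.2)
          + p.approxGradQueries φ η N θ (secondHalf ζ.2))

/-- The SG estimator with batch size `b` at level `L`. -/
def sgEstimator (p : Problem E n) (φ : ℝ → ℝ≥0∞) (η : ℝ) (N : ℕ) {b L : ℕ}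
    (ζ : Fin b → Sample E L) (θ : Param n) : Param n :=
  (1 / b : ℝ) • ∑ i, p.approxGrad φ η N θ (ζ i).2

/-- Cost of one SG estimator: generated samples `z` and `z'`, and queries in the search. -/
def sgCost (p : Problem E n) (φ : ℝ → ℝ≥0∞) (η : ℝ) (N : ℕ) {b L : ℕ}
    (ζ : Fin b → Sample E L) (θ : Param n) : ℕ :=
  ∑ i, (1 + 2 ^ L + p.approxGradQueries φ η N θ (ζ i).2)

/-- The truncated geometric probabilities `2^{-ℓ} / (2 - 2^{-L})`, `ℓ = 0, …, L`. -/
def _root_.AdvRobust.levelProb (L ℓ : ℕ) : ℝ := (2 : ℝ)⁻¹ ^ ℓ / (2 - (2 : ℝ)⁻¹ ^ L)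

/-- A random level together with a sampling parameter of that level. -/
abbrev _root_.AdvRobust.LevelSample (E : Type*) (L : ℕ) : Type _ :=
  Σ ℓ : Fin (L + 1), Sample E ℓ

/-- The law of the pair of a truncated geometric level `ℓ` and a sampling parameter `ζ^ℓ`. -/
def levelSampleLaw (p : Problem E n) (L : ℕ) : Measure (LevelSample E L) :=
  ∑ ℓ : Fin (L + 1), ENNReal.ofReal (levelProb L ℓ) •
    (p.sampleLaw ℓ).map (fun ζ => (⟨ℓ, ζ⟩ : LevelSample E L))

/-- The RT-MLMC estimator with batch size `b` and maximal level `L`. -/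
def mlmcEstimator (p : Problem E n) (φ : ℝ → ℝ≥0∞) (η : ℝ) (N : ℕ) {b L : ℕ}
    (ζ : Fin b → LevelSample E L) (θ : Param n) : Param n :=
  (1 / b : ℝ) • ∑ i, (levelProb L (ζ i).1)⁻¹ • p.levelDiff φ η N θ (ζ i).1 (ζ i).2

/-- Cost of one RT-MLMC estimator: generated samples `z` and `z'`, and queries in the search. -/
def mlmcCost (p : Problem E n) (φ : ℝ → ℝ≥0∞) (η : ℝ) (N : ℕ) {b L : ℕ}
    (ζ : Fin b → LevelSample E L) (θ : Param n) : ℕ :=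
  ∑ i, (1 + 2 ^ ((ζ i).1 : ℕ) + p.levelDiffQueries φ η N θ (ζ i).1 (ζ i).2)

/-- For every query made at a level at most `L`, almost surely, the optimal value estimated by the
bisection search with `N` iterations has error at most `ε`. -/
def SearchGapLE (p : Problem E n) (φ : ℝ → ℝ≥0∞) (η : ℝ) (N L : ℕ) (ε : ℝ) : Prop :=
  ∀ θ ∈ p.Θ, ∀ z ∈ p.P.support, ∀ ℓ ≤ L,
    ∀ᵐ w ∂(Measure.pi fun _ : Fin (2 ^ ℓ) => p.ν z),
      discreteValue φ η (fun i => p.f θ (w i))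
          ≤ ((bisectValue φ η N (fun i => p.f θ (w i)) + ε : ℝ) : EReal) ∧
        ((bisectValue φ η N (fun i => p.f θ (w i)) - ε : ℝ) : EReal)
          ≤ discreteValue φ η (fun i => p.f θ (w i))

end Problem

/-! ### Projected stochastic gradient descent -/

/-- The point of the closed convex set `Θ` nearest to `x`. -/
def projOnto {n : ℕ} (Θ : Set (Param n)) (x : Param n) : Param n :=
  Classical.epsilon fun y => y ∈ Θ ∧ ∀ w ∈ Θ, ‖x - y‖ ≤ ‖x - w‖

/-- The iterates of projected SGD with step size `τ`, where `V t θ` is the estimator used in step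
`t` at the point `θ`. The index starts at `0`, so `projSGD Θ τ θ₁ V t` is `θ_{t+1}`. -/
def projSGD {n : ℕ} (Θ : Set (Param n)) (τ : ℝ) (θ₁ : Param n) (V : ℕ → Param n → Param n) :
    ℕ → Param n
  | 0 => θ₁
  | t + 1 => projOnto Θ (projSGD Θ τ θ₁ V t - τ • V t (projSGD Θ τ θ₁ V t))

/-- The output `(1/T) ∑_{t=1}^T θ_t`. -/
def sgdOutput {n : ℕ} (Θ : Set (Param n)) (τ : ℝ) (θ₁ : Param n) (V : ℕ → Param n → Param n)
    (T : ℕ) : Param n :=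
  (1 / T : ℝ) • ∑ t ∈ Finset.range T, projSGD Θ τ θ₁ V t

/-- The total cost of the `T - 1` steps, where `cost t θ` is the cost of the estimator of step `t`
at the point `θ`. -/
def sgdCost {n : ℕ} (Θ : Set (Param n)) (τ : ℝ) (θ₁ : Param n) (V : ℕ → Param n → Param n)
    (cost : ℕ → Param n → ℕ) (T : ℕ) : ℕ :=
  ∑ t ∈ Finset.range (T - 1), cost t (projSGD Θ τ θ₁ V t)

/-- The batches `ζ 0, ζ 1, …` of size `b` consist of i.i.d. random variables with the given law. -/
structure IsIIDBatches {Ω S : Type*} [MeasurableSpace Ω] [MeasurableSpace S] (μ : Measure Ω)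
    (law : Measure S) {b : ℕ} (ζ : ℕ → Ω → Fin b → S) : Prop where
  hasLaw : ∀ t i, HasLaw (fun ω => ζ t ω i) law μ
  indep : iIndepFun (fun (k : ℕ × Fin b) (ω : Ω) => ζ k.1 ω k.2) μ

/-- The maximal level `L = ⌈log₂ (8 G / δ)⌉` (and `0` if `8 G ≤ δ`). -/
def maxLevel (G δ : ℝ) : ℕ := ⌈Real.logb 2 (8 * G / δ)⌉₊

end AdvRobust

end

-- The engine is Lagrangian duality in the one constraint of total mass one. For a multiplier `μ`
-- the Lagrangian is maximized by the weights (1/m) `optDensity φ ((f i - μ) / η)`; the resulting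
-- `dualObj` is convex in `μ`, with slope minus the mass violation `massGap`. Strong convexity of
-- `φ` makes `optDensity` monotone and (1/κ)-Lipschitz. Hence bisection locates a root of `massGap`
-- exponentially fast, the weights err in total by at most the distance to the root over ηκ
-- (`searchError`), and the value errs by the square of that distance over ηκ
-- (`IsDivergence.bisect_gap`). The weighted sum of subgradients is then an approximate subgradient
-- of the sampled optimal value (`IsDivergence.dualValue_sub_le_inner`).
--
-- Bias of sampling. The expected sampled value never exceeds the population value, by weak duality
-- at the population multiplier. It falls short by at most G/(m+1), not merely by the order m^(-1/2)
-- of the fluctuations (`IsDivergence.sub_le_integral_dualValue`). For this, the optimal population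
-- density is written in quantile coordinates as a monotone function on (0,1) with primitive `R`,
-- and the k-th smallest of the m samples receives the mass of `R` on the k-th of m equal cells.
-- Jensen's inequality shows that the penalty does not grow. The expected mean is computed by
-- layers: the number of samples below `t` is binomial, so the expectation of `R` at the empirical
-- cdf is the Bernstein polynomial of `R` at the cdf. Its excess over `R` integrates to at most
-- 1/(m+1) over (0,1), and the change of variables along the cdf costs the Lipschitz constant `G`.
--
-- Variance of the multilevel differences. When the multiplier moves, all weights move in the same
-- direction, so the total variation between two weight vectors is the difference of their masses. A
-- level difference is thereby controlled by the mass violations of the two halves at the population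
-- multiplier, which are centred means of 2^ℓ bounded independent variables. Its second moment is of
-- order 2^(-ℓ) up to search error (`Problem.Assumptions.integral_levelDiff_sq_le`), which cancels
-- the importance weight. The second moment of the randomized estimator is thus of order L, while
-- its mean telescopes to that of the SG estimator at level L.
--
-- Optimization. The objective is a supremum of averages of the loss, hence convex and
-- `Lf`-Lipschitz, and `projSGD_converges` is the usual analysis with a biased oracle. The bias
-- contains the search error times the distance to the minimizer. `Θ` may be unbounded, so this
-- distance is bounded only by the total length of the steps, a power of 1/δ; order log(1/δ)
-- bisections make the product negligible.

namespace AdvRobust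

/-! ### The divergence function and its conjugate -/

section Divergence

variable {φ : ℝ → ℝ≥0∞} {κ : ℝ}

/-- The optimal density `argmax_{s ≥ 0} (s y - φ s)` at slope `y`. -/
noncomputable def optDensity (φ : ℝ → ℝ≥0∞) (y : ℝ) : ℝ :=
  open Classical in if (y : EReal) ≤ slopeZero φ then 0 else dphiInv φ y

/-- The convex conjugate of `φ`. -/
noncomputable def conj (φ : ℝ → ℝ≥0∞) (y : ℝ) : ℝ :=
  y * optDensity φ y - (φ (optDensity φ y)).toReal

theorem multiplierWeight_eq (φ : ℝ → ℝ≥0∞) (η : ℝ) (m : ℕ) (μ x : ℝ) :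
    multiplierWeight φ η m μ x = 1 / m * optDensity φ ((x - μ) / η) := by
  unfold multiplierWeight optDensity
  split_ifs <;> simp

namespace IsDivergence

variable (hφ : IsDivergence φ κ)
include hφ

theorem convex_toReal {x y a b : ℝ} (hx : φ x ≠ ⊤) (hy : φ y ≠ ⊤) (ha : 0 ≤ a) (hb : 0 ≤ b)
    (hab : a + b = 1) :
    φ (a * x + b * y) ≠ ⊤ ∧ (φ (a * x + b * y)).toReal + κ / 2 * a * b * (x - y) ^ 2
      ≤ a * (φ x).toReal + b * (φ y).toReal := by
  have h := hφ.strongly_convex x y a b ha hb hab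
  have hk := hφ.modulus_pos
  have hr : ENNReal.ofReal a * φ x + ENNReal.ofReal b * φ y ≠ ⊤ :=
    ENNReal.add_ne_top.2 ⟨ENNReal.mul_ne_top ENNReal.ofReal_ne_top hx,
      ENNReal.mul_ne_top ENNReal.ofReal_ne_top hy⟩
  have hl : φ (a * x + b * y) ≠ ⊤ := ne_top_of_le_ne_top hr (le_self_add.trans h)
  refine ⟨hl, ?_⟩
  have h2 := ENNReal.toReal_mono hr h
  rw [ENNReal.toReal_add hl ENNReal.ofReal_ne_top, ENNReal.toReal_ofReal (by positivity),
    ENNReal.toReal_add (ENNReal.mul_ne_top ENNReal.ofReal_ne_top hx)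
      (ENNReal.mul_ne_top ENNReal.ofReal_ne_top hy), ENNReal.toReal_mul, ENNReal.toReal_mul,
    ENNReal.toReal_ofReal ha, ENNReal.toReal_ofReal hb] at h2
  exact h2

theorem convexOn_sub_sq :
    ConvexOn ℝ (Set.Ioi 0) (fun s => (φ s).toReal - κ / 2 * s ^ 2) := by
  refine ⟨convex_Ioi 0, fun x hx y hy a b ha hb hab => ?_⟩
  have h := (hφ.convex_toReal (hφ.finite x hx) (hφ.finite y hy) ha hb hab).2
  simp only [smul_eq_mul]
  have hb' : b = 1 - a := by linarith
  subst hb'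
  nlinarith

/-- Subtracting (κ/2)s² leaves a convex function, whose derivative is monotone. -/
theorem dphi_strong {s t : ℝ} (ht : 0 < t) (hts : t ≤ s) :
    κ * (s - t) ≤ dphi φ s - dphi φ t := by
  have hd : ∀ x ∈ Set.Ioi (0 : ℝ),
      HasDerivAt (fun s => (φ s).toReal - κ / 2 * s ^ 2) (dphi φ x - κ * x) x := by
    intro x hx
    have h1 := (hφ.differentiable x hx).hasDerivAt
    have h2 := ((hasDerivAt_pow 2 x).const_mul (κ / 2))
    refine (h1.sub h2).congr_deriv ?_
    unfold dphi; ring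
  have hm := hφ.convexOn_sub_sq.monotoneOn_deriv (fun x hx => (hd x hx).differentiableAt)
  have := hm ht (lt_of_lt_of_le ht hts) hts
  rw [(hd t ht).deriv, (hd s (lt_of_lt_of_le ht hts)).deriv] at this
  linarith

theorem dphi_mono {s t : ℝ} (ht : 0 < t) (hts : t ≤ s) : dphi φ t ≤ dphi φ s := by
  have := hφ.dphi_strong ht hts
  have := mul_nonneg hφ.modulus_pos.le (sub_nonneg.2 hts)
  linarith

theorem dphi_strictMono {s t : ℝ} (ht : 0 < t) (hts : t < s) : dphi φ t < dphi φ s := by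
  have := hφ.dphi_strong ht hts.le
  have := mul_pos hφ.modulus_pos (sub_pos.2 hts)
  linarith

theorem dphi_one : dphi φ 1 = 0 := by
  refine IsLocalMin.deriv_eq_zero (Filter.Eventually.of_forall fun x => ?_)
  simp [hφ.map_one]

/-- By monotonicity the limit at zero is the infimum of `φ'` over the positive reals. The inequality
on the right is strict because `φ'` is strictly increasing, so the infimum is not attained; this
form avoids limits and infinite values from here on. -/
theorem coe_le_slopeZero {y : ℝ} : (y : EReal) ≤ slopeZero φ ↔ ∀ s, 0 < s → y < dphi φ s := by
  have hm : MonotoneOn (fun s => ((dphi φ s : ℝ) : EReal)) (Set.Ioi (0 : ℝ)) :=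
    fun s hs t _ hst => EReal.coe_le_coe_iff.2 (hφ.dphi_mono hs hst)
  have hK : slopeZero φ = sInf ((fun s => ((dphi φ s : ℝ) : EReal)) '' Set.Ioi (0 : ℝ)) :=
    (hm.tendsto_nhdsGT (OrderBot.bddBelow _)).limUnder_eq
  rw [hK, le_sInf_iff]
  constructor
  · intro h s hs
    have h1 := h _ ⟨s / 2, by simpa using hs, rfl⟩
    exact (EReal.coe_le_coe_iff.1 h1).trans_lt (hφ.dphi_strictMono (by linarith) (by linarith))
  · rintro h _ ⟨s, hs, rfl⟩
    exact EReal.coe_le_coe_iff.2 (h s hs).le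

theorem exists_dphi_eq {y : ℝ} (hy : ¬ (y : EReal) ≤ slopeZero φ) :
    ∃ s, 0 < s ∧ dphi φ s = y := by
  rw [hφ.coe_le_slopeZero] at hy
  push Not at hy
  obtain ⟨t, ht, hty⟩ := hy
  have hk := hφ.modulus_pos
  -- Strong monotonicity gives slope at least `y` at this point. Since `φ'` is a derivative, it
  -- takes every value between two of its values, and no continuity of `φ'` is needed.
  set s := t + (y - dphi φ t) / κ with hs
  have hts : t ≤ s := by
    have : 0 ≤ (y - dphi φ t) / κ := div_nonneg (by linarith) hk.le
    linarith
  have h1 := hφ.dphi_strong ht hts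
  have h2 : κ * (s - t) = y - dphi φ t := by rw [hs]; field_simp; ring
  obtain ⟨x, hx, hxy⟩ := exists_hasDerivWithinAt_eq_of_ge_of_le (f := fun s => (φ s).toReal)
    (f' := dphi φ) (m := y) hts
    (fun x hx => (hφ.differentiable x (ht.trans_le hx.1)).hasDerivAt.hasDerivWithinAt)
    hty (by linarith)
  exact ⟨x, ht.trans_le hx.1, hxy⟩

/-- The first-order conditions for maximizing s y - φ(s) over s ≥ 0: a corner solution at zero or a
stationary point. Later arguments use this dichotomy and no longer the definitions by limit and
inverse function. -/
theorem optDensity_cases (y : ℝ) :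
    (optDensity φ y = 0 ∧ ∀ s, 0 < s → y < dphi φ s) ∨
      (0 < optDensity φ y ∧ dphi φ (optDensity φ y) = y) := by
  unfold optDensity
  split_ifs with h
  · exact Or.inl ⟨rfl, hφ.coe_le_slopeZero.1 h⟩
  · obtain ⟨s, hs, hsy⟩ := hφ.exists_dphi_eq h
    exact Or.inr ⟨Function.invFunOn_mem ⟨s, hs, hsy⟩, Function.invFunOn_eq ⟨s, hs, hsy⟩⟩

theorem optDensity_nonneg (y : ℝ) : 0 ≤ optDensity φ y := by
  rcases hφ.optDensity_cases y with h | h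
  · exact h.1.ge
  · exact h.1.le

theorem optDensity_strong {x y : ℝ} (hxy : x ≤ y) :
    optDensity φ x ≤ optDensity φ y ∧ κ * (optDensity φ y - optDensity φ x) ≤ y - x := by
  have hk := hφ.modulus_pos
  rcases hφ.optDensity_cases x with ⟨hx, hx'⟩ | ⟨hx, hx'⟩ <;>
    rcases hφ.optDensity_cases y with ⟨hy, hy'⟩ | ⟨hy, hy'⟩
  · rw [hx, hy]; simpa using hxy
  · rw [hx]
    refine ⟨hy.le, ?_⟩
    by_contra hcon
    push Not at hcon
    set s := optDensity φ y
    -- If the claimed bound failed, one could move left from `s` by (y - x)/κ and remain positive.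
    -- Strong monotonicity would then bring the slope down to at most `x`, although all slopes
    -- exceed `x`.
    have h0 : 0 < min s (s - (y - x) / κ) := by
      refine lt_min hy ?_
      rw [sub_pos, div_lt_iff₀ hk]; linarith
    have h1 := hφ.dphi_strong h0 (min_le_left _ _)
    have h2 : min s (s - (y - x) / κ) ≤ s - (y - x) / κ := min_le_right _ _
    have h3 := hx' _ h0
    rw [hy'] at h1
    have h4 : κ * ((y - x) / κ) ≤ κ * (s - min s (s - (y - x) / κ)) :=
      mul_le_mul_of_nonneg_left (by linarith) hk.le
    rw [mul_div_cancel₀ _ hk.ne'] at h4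
    linarith
  · have := hy' _ hx; linarith
  · have hle : optDensity φ x ≤ optDensity φ y := by
      by_contra hlt
      have := hφ.dphi_strictMono hy (not_le.1 hlt)
      linarith
    exact ⟨hle, by have := hφ.dphi_strong hx hle; rw [hx', hy'] at this; exact this⟩

theorem optDensity_mono : Monotone (optDensity φ) := fun _ _ h => (hφ.optDensity_strong h).1

theorem abs_optDensity_sub_le (x y : ℝ) :
    |optDensity φ x - optDensity φ y| ≤ |x - y| / κ := by
  have hk := hφ.modulus_pos
  rw [le_div_iff₀ hk]
  rcases le_total x y with h | h
  · have := hφ.optDensity_strong h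
    rw [abs_sub_comm, abs_of_nonneg (by linarith), abs_sub_comm, abs_of_nonneg (by linarith)]
    linarith
  · have := hφ.optDensity_strong h
    rw [abs_of_nonneg (by linarith), abs_of_nonneg (by linarith)]
    linarith

theorem continuous_optDensity : Continuous (optDensity φ) := by
  have hk := hφ.modulus_pos
  refine (LipschitzWith.of_dist_le_mul (K := (1 / κ).toNNReal) fun x y => ?_).continuous
  rw [Real.dist_eq, Real.dist_eq, Real.coe_toNNReal _ (by positivity)]
  refine (hφ.abs_optDensity_sub_le x y).trans (le_of_eq ?_)
  ring

theorem optDensity_zero : optDensity φ 0 = 1 := by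
  rcases hφ.optDensity_cases 0 with ⟨_, h⟩ | ⟨h, h'⟩
  · have := h 1 one_pos
    rw [hφ.dphi_one] at this
    exact absurd this (lt_irrefl _)
  · rcases lt_trichotomy (optDensity φ 0) 1 with h1 | h1 | h1
    · have := hφ.dphi_strictMono h h1
      rw [h', hφ.dphi_one] at this
      exact absurd this (lt_irrefl _)
    · exact h1
    · have := hφ.dphi_strictMono one_pos h1
      rw [h', hφ.dphi_one] at this
      exact absurd this (lt_irrefl _)

/-- Convexity on the segment from `t` to `s`, divided by its parameter, which then tends to zero.
Only finiteness is needed at `s`, so the endpoint zero is allowed. -/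
theorem tangent_le_of_pos {s t : ℝ} (ht : 0 < t) (hs : φ s ≠ ⊤) :
    (φ t).toReal + dphi φ t * (s - t) ≤ (φ s).toReal := by
  have hk := hφ.modulus_pos
  have hd : HasDerivAt (fun u : ℝ => (φ (t + u * (s - t))).toReal) (dphi φ t * (s - t)) 0 := by
    have h1 : HasDerivAt (fun u : ℝ => t + u * (s - t)) (s - t) 0 := by
      simpa using ((hasDerivAt_id (0 : ℝ)).mul_const (s - t)).const_add t
    have h2 : HasDerivAt (fun s => (φ s).toReal) (dphi φ t) (t + 0 * (s - t)) := by
      rw [zero_mul, add_zero]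
      exact (hφ.differentiable t ht).hasDerivAt
    exact h2.comp (0 : ℝ) h1
  have hlim := hd.tendsto_slope_zero_right
  have hle : ∀ᶠ u : ℝ in 𝓝[>] 0,
      u⁻¹ • ((φ (t + (0 + u) * (s - t))).toReal - (φ (t + 0 * (s - t))).toReal)
        ≤ (φ s).toReal - (φ t).toReal := by
    filter_upwards [Ioc_mem_nhdsGT (zero_lt_one (α := ℝ))] with u hu
    have h := (hφ.convex_toReal (hφ.finite t ht) hs (sub_nonneg.2 hu.2) hu.1.le
      (by ring)).2
    have h0 : 0 ≤ κ / 2 * (1 - u) * u * (t - s) ^ 2 :=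
      mul_nonneg (mul_nonneg (mul_nonneg (by positivity) (sub_nonneg.2 hu.2)) hu.1.le)
        (sq_nonneg _)
    have he : t + (0 + u) * (s - t) = (1 - u) * t + u * s := by ring
    rw [he, smul_eq_mul, zero_mul, add_zero, inv_mul_le_iff₀ hu.1]
    linarith
  have := le_of_tendsto hlim hle
  linarith

/-- The tangent at a small t > 0 has slope above `y`, so φ(t) ≤ φ(s) - y(s - t). Lower
semicontinuity carries this bound to t = 0 and, in particular, shows that φ(0) is finite. -/
theorem fenchel_zero {y : ℝ} (hy : ∀ s, 0 < s → y < dphi φ s) :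
    φ 0 ≠ ⊤ ∧ ∀ s, φ s ≠ ⊤ → (φ 0).toReal + y * s ≤ (φ s).toReal := by
  have key : ∀ s, 0 < s → φ 0 ≤ ENNReal.ofReal ((φ s).toReal - y * s) := by
    intro s hs
    refine le_of_forall_lt fun c hc => ?_
    have hct : c ≠ ⊤ := hc.ne_top
    by_contra hcon
    push Not at hcon
    obtain ⟨c', hc1, hc2⟩ := exists_between hc
    have hct' : c' ≠ ⊤ := hc2.ne_top
    have h1 := hφ.lsc 0 c' hc2
    have hlt : c.toReal < c'.toReal := (ENNReal.toReal_lt_toReal hct hct').2 hc1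
    have h3 : (φ s).toReal - y * s ≤ c.toReal := by
      have := (ENNReal.ofReal_le_iff_le_toReal hct).1 hcon
      exact this
    have h2 : ∀ᶠ t : ℝ in 𝓝 0, c.toReal + y * t < c'.toReal := by
      have : ContinuousAt (fun t : ℝ => c.toReal + y * t) 0 := by fun_prop
      exact this.eventually_lt continuousAt_const (by simpa using hlt)
    have h4 := (h1.and h2).filter_mono (nhdsWithin_le_nhds (s := Set.Ioi (0 : ℝ)))
    obtain ⟨t, ⟨ht1, ht2⟩, ht3⟩ := (h4.and (Ioc_mem_nhdsGT hs)).exists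
    have h5 := hφ.tangent_le_of_pos ht3.1 (hφ.finite s hs)
    have h6 : c'.toReal < (φ t).toReal :=
      (ENNReal.toReal_lt_toReal hct' (hφ.finite t ht3.1)).2 ht1
    have h7 : y * (s - t) ≤ dphi φ t * (s - t) :=
      mul_le_mul_of_nonneg_right (hy t ht3.1).le (by linarith [ht3.2])
    nlinarith
  have h0 : φ 0 ≠ ⊤ := ne_top_of_le_ne_top ENNReal.ofReal_ne_top (key 1 one_pos)
  refine ⟨h0, fun s hs => ?_⟩
  rcases lt_trichotomy s 0 with h | h | h
  · exact absurd (hφ.map_neg s h) hs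
  · simp [h]
  · have h1 := key s h
    have h2 := ENNReal.toReal_mono ENNReal.ofReal_ne_top h1
    have h3 : 0 ≤ (φ s).toReal - y * s := by
      have hy0 : y < 0 := by simpa [hφ.dphi_one] using hy 1 one_pos
      have : 0 ≤ (φ s).toReal := ENNReal.toReal_nonneg
      nlinarith
    rw [ENNReal.toReal_ofReal h3] at h2
    linarith

theorem finite_optDensity (y : ℝ) : φ (optDensity φ y) ≠ ⊤ := by
  rcases hφ.optDensity_cases y with ⟨h, h'⟩ | ⟨h, h'⟩
  · rw [h]; exact (hφ.fenchel_zero h').1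
  · exact hφ.finite _ h

theorem fenchel (y : ℝ) {s : ℝ} (hs : φ s ≠ ⊤) : y * s - (φ s).toReal ≤ conj φ y := by
  unfold conj
  rcases hφ.optDensity_cases y with ⟨h, h'⟩ | ⟨h, h'⟩
  · rw [h]; have := (hφ.fenchel_zero h').2 s hs; linarith
  · have := hφ.tangent_le_of_pos h hs
    rw [h'] at this; linarith

/-- Fenchel's inequality at slope `y`, tested with the density that is optimal at slope `x`. Thus
`optDensity` is a subgradient of the conjugate, the source of all tangent inequalities for the dual.
-/
theorem conj_tangent (x y : ℝ) : conj φ x + optDensity φ x * (y - x) ≤ conj φ y := by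
  have := hφ.fenchel y (hφ.finite_optDensity x)
  unfold conj at *
  linarith

theorem conj_mono : Monotone (conj φ) := by
  intro x y h
  have := hφ.conj_tangent x y
  have := mul_nonneg (hφ.optDensity_nonneg x) (sub_nonneg.2 h)
  linarith

theorem continuous_conj : Continuous (conj φ) := by
  -- A convex combination of the tangent inequalities at the intermediate point gives convexity, and
  -- a finite convex function on the line is continuous.
  have h : ConvexOn ℝ Set.univ (conj φ) := by
    refine ⟨convex_univ, fun x _ y _ a b ha hb hab => ?_⟩
    simp only [smul_eq_mul]
    set z := a * x + b * y
    have h1 := mul_le_mul_of_nonneg_left (hφ.conj_tangent z x) ha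
    have h2 := mul_le_mul_of_nonneg_left (hφ.conj_tangent z y) hb
    have h3 : a * (conj φ z + optDensity φ z * (x - z)) + b * (conj φ z + optDensity φ z * (y - z))
        = (a + b) * conj φ z + optDensity φ z * (a * x + b * y - (a + b) * z) := by ring
    rw [hab] at h3
    simp only [one_mul, z, sub_self, mul_zero, add_zero] at h3
    simp only [z] at h1 h2 ⊢
    linarith
  exact continuousOn_univ.1 (h.continuousOn isOpen_univ)

omit hφ in
theorem toReal_optDensity (y : ℝ) :
    (φ (optDensity φ y)).toReal = y * optDensity φ y - conj φ y := by
  unfold conj; ring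

theorem measurable : Measurable φ := hφ.lsc.measurable

end IsDivergence

end Divergence

end AdvRobust

namespace AdvRobust

/-! ### The discrete penalized problem and its dual -/

section Discrete

variable {φ : ℝ → ℝ≥0∞} {κ η : ℝ} {m : ℕ}

/-- The dual function of the discrete problem. -/
noncomputable def dualObj (φ : ℝ → ℝ≥0∞) (η : ℝ) (f : Fin m → ℝ) (μ : ℝ) : ℝ :=
  μ + η / m * ∑ i, conj φ ((f i - μ) / η)

/-- The violation of the constraint `∑ γ_i = 1` by the weights for the multiplier `μ`. -/
noncomputable def massGap (φ : ℝ → ℝ≥0∞) (η : ℝ) (f : Fin m → ℝ) (μ : ℝ) : ℝ :=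
  1 / m * ∑ i, optDensity φ ((f i - μ) / η) - 1

/-- The optimal value of the discrete problem as a real number. -/
noncomputable def dualValue (φ : ℝ → ℝ≥0∞) (η : ℝ) (f : Fin m → ℝ) : ℝ := ⨅ μ, dualObj φ η f μ

/-- An upper bound of the length of the initial interval for values with range at most `G`. -/
noncomputable def bisectWidth (φ : ℝ → ℝ≥0∞) (η G : ℝ) : ℝ :=
  (1 + η) * G + η * |(slopeZero φ).toReal|

theorem sum_multiplierWeight (f : Fin m → ℝ) (μ : ℝ) :
    ∑ i, multiplierWeight φ η m μ (f i) - 1 = massGap φ η f μ := by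
  simp only [multiplierWeight_eq, massGap, Finset.mul_sum]

theorem exists_zero_of_continuous {h : ℝ → ℝ} (hc : Continuous h) {a b : ℝ} (hab : a ≤ b)
    (ha : 0 ≤ h a) (hb : h b ≤ 0) : ∃ μ ∈ Set.Icc a b, h μ = 0 :=
  intermediate_value_Icc' hab hc.continuousOn ⟨hb, ha⟩

theorem discreteObj_eq (hη : 0 < η) (f γ : Fin m → ℝ) (hm : 0 < m)
    (hfin : ∀ i, φ (m * γ i) ≠ ⊤) :
    discreteObj φ η f γ
      = ((∑ i, γ i * f i - η / m * ∑ i, (φ (m * γ i)).toReal : ℝ) : EReal) := by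
  have hm' : (0 : ℝ) < m := by exact_mod_cast hm
  have hne : ENNReal.ofReal (η / m) * ∑ i, φ (m * γ i) ≠ ⊤ :=
    ENNReal.mul_ne_top ENNReal.ofReal_ne_top (ENNReal.sum_ne_top.2 fun i _ => hfin i)
  unfold discreteObj
  rw [← EReal.coe_toReal (x := ((ENNReal.ofReal (η / m) * ∑ i, φ (m * γ i) : ℝ≥0∞) : EReal))
      (by rwa [Ne, EReal.coe_ennreal_eq_top_iff]) (EReal.coe_ennreal_ne_bot _),
      EReal.toReal_coe_ennreal, ENNReal.toReal_mul,
      ENNReal.toReal_ofReal (by positivity), ENNReal.toReal_sum fun i _ => hfin i,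
      ← EReal.coe_sub]

namespace IsDivergence

variable (hφ : IsDivergence φ κ) (hη : 0 < η)
include hφ hη

theorem antitone_optDensity_sub (x : ℝ) : Antitone fun μ => optDensity φ ((x - μ) / η) :=
  fun _ _ h => hφ.optDensity_mono (div_le_div_of_nonneg_right (by linarith) hη.le)

theorem abs_optDensity_shift_le (x μ μ' : ℝ) :
    |optDensity φ ((x - μ) / η) - optDensity φ ((x - μ') / η)| ≤ |μ - μ'| / (η * κ) := by
  refine (hφ.abs_optDensity_sub_le _ _).trans (le_of_eq ?_)
  rw [← sub_div, abs_div, abs_of_pos hη, div_div]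
  congr 1
  rw [abs_sub_comm]; ring_nf

theorem massGap_antitone (f : Fin m → ℝ) : Antitone (massGap φ η f) := by
  intro μ μ' h
  unfold massGap
  gcongr with i
  exact hφ.antitone_optDensity_sub hη (f i) h

omit hη in
theorem massGap_continuous (f : Fin m → ℝ) : Continuous (massGap φ η f) := by
  unfold massGap
  have := hφ.continuous_optDensity
  fun_prop

theorem sum_abs_optDensity_shift_le (f : Fin m → ℝ) (hm : 0 < m) (μ μ' : ℝ) :
    1 / m * ∑ i, |optDensity φ ((f i - μ) / η) - optDensity φ ((f i - μ') / η)|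
      ≤ |μ - μ'| / (η * κ) := by
  have hm' : (0 : ℝ) < m := by exact_mod_cast hm
  calc 1 / (m : ℝ) * ∑ i, |optDensity φ ((f i - μ) / η) - optDensity φ ((f i - μ') / η)|
      ≤ 1 / m * ∑ _i : Fin m, |μ - μ'| / (η * κ) := by
        gcongr with i
        exact hφ.abs_optDensity_shift_le hη _ _ _
    _ = |μ - μ'| / (η * κ) := by
        rw [Finset.sum_const, Finset.card_univ, Fintype.card_fin, nsmul_eq_mul]; field_simp

theorem abs_massGap_sub_le (f : Fin m → ℝ) (hm : 0 < m) (μ μ' : ℝ) :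
    |massGap φ η f μ - massGap φ η f μ'| ≤ |μ - μ'| / (η * κ) := by
  refine le_trans ?_ (hφ.sum_abs_optDensity_shift_le hη f hm μ μ')
  unfold massGap
  rw [sub_sub_sub_cancel_right, ← mul_sub, ← Finset.sum_sub_distrib, abs_mul,
    abs_of_nonneg (by positivity)]
  gcongr
  exact Finset.abs_sum_le_sum_abs _ _

/-- The dual function is jointly convex in `(f, μ)`; this is its tangent inequality. -/
theorem dualObj_tangent (f f' : Fin m → ℝ) (hm : 0 < m) (μ μ' : ℝ) :
    dualObj φ η f μ + 1 / m * ∑ i, optDensity φ ((f i - μ) / η) * (f' i - f i)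
        - massGap φ η f μ * (μ' - μ) ≤ dualObj φ η f' μ' := by
  have hm' : (0 : ℝ) < m := by exact_mod_cast hm
  have h : ∑ i, (conj φ ((f i - μ) / η) + optDensity φ ((f i - μ) / η)
      * ((f' i - μ') / η - (f i - μ) / η)) ≤ ∑ i, conj φ ((f' i - μ') / η) :=
    Finset.sum_le_sum fun i _ => hφ.conj_tangent _ _
  have h2 := mul_le_mul_of_nonneg_left h (show (0 : ℝ) ≤ η / m by positivity)
  refine le_trans (le_of_eq ?_) (add_le_add_right h2 μ')
  unfold dualObj massGap
  have e : ∀ i, optDensity φ ((f i - μ) / η) * ((f' i - μ') / η - (f i - μ) / η)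
      = (1 / η) * (optDensity φ ((f i - μ) / η) * (f' i - f i))
        - (1 / η) * (μ' - μ) * optDensity φ ((f i - μ) / η) := by
    intro i; field_simp; ring
  simp only [e, Finset.sum_add_distrib, Finset.sum_sub_distrib, ← Finset.mul_sum]
  field_simp
  ring

/-- Fenchel's inequality with density 1, where the penalty vanishes: the uniform weights are
feasible at no penalty. This makes the infimum defining `dualValue` meaningful. -/
theorem le_dualObj (f : Fin m → ℝ) (hm : 0 < m) (μ : ℝ) : 1 / m * ∑ i, f i ≤ dualObj φ η f μ := by
  have hm' : (0 : ℝ) < m := by exact_mod_cast hm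
  have h : ∑ i, ((f i - μ) / η) ≤ ∑ i, conj φ ((f i - μ) / η) :=
    Finset.sum_le_sum fun i _ => by
      have := hφ.fenchel ((f i - μ) / η) (s := 1) (by simp [hφ.map_one])
      simpa [hφ.map_one] using this
  have h2 := mul_le_mul_of_nonneg_left h (show (0 : ℝ) ≤ η / m by positivity)
  refine le_trans (le_of_eq ?_) (add_le_add_right h2 μ)
  rw [← Finset.sum_div, Finset.sum_sub_distrib, Finset.sum_const, Finset.card_univ,
    Fintype.card_fin, nsmul_eq_mul]
  field_simp
  ring

theorem bddBelow_dualObj (f : Fin m → ℝ) (hm : 0 < m) : BddBelow (Set.range (dualObj φ η f)) :=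
  ⟨_, by rintro _ ⟨μ, rfl⟩; exact hφ.le_dualObj hη f hm μ⟩

theorem dualValue_le (f : Fin m → ℝ) (hm : 0 < m) (μ : ℝ) : dualValue φ η f ≤ dualObj φ η f μ :=
  ciInf_le (hφ.bddBelow_dualObj hη f hm) μ

/-- At a root the linear term of the tangent inequality vanishes, so the root minimizes the dual. -/
theorem dualValue_eq (f : Fin m → ℝ) (hm : 0 < m) {μ : ℝ} (hμ : massGap φ η f μ = 0) :
    dualValue φ η f = dualObj φ η f μ := by
  refine le_antisymm (hφ.dualValue_le hη f hm μ) (le_ciInf fun μ' => ?_)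
  simpa [hμ] using hφ.dualObj_tangent hη f f hm μ μ'

/-- At a multiplier below all values every slope is nonnegative, and `optDensity` is monotone with
value 1 at slope 0. The upper end is treated symmetrically. -/
theorem massGap_nonneg (f : Fin m → ℝ) (hm : 0 < m) {a : ℝ} (h : ∀ i, a ≤ f i) :
    0 ≤ massGap φ η f a := by
  have hm' : (0 : ℝ) < m := by exact_mod_cast hm
  unfold massGap
  have : ∑ _i : Fin m, (1 : ℝ) ≤ ∑ i, optDensity φ ((f i - a) / η) :=
    Finset.sum_le_sum fun i _ => by
      rw [← hφ.optDensity_zero]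
      exact hφ.optDensity_mono (div_nonneg (sub_nonneg.2 (h i)) hη.le)
  have h2 := mul_le_mul_of_nonneg_left this (show (0 : ℝ) ≤ 1 / m by positivity)
  rw [Finset.sum_const, Finset.card_univ, Fintype.card_fin, nsmul_eq_mul, mul_one,
    one_div_mul_cancel hm'.ne'] at h2
  linarith

theorem massGap_nonpos (f : Fin m → ℝ) (hm : 0 < m) {b : ℝ} (h : ∀ i, f i ≤ b) :
    massGap φ η f b ≤ 0 := by
  have hm' : (0 : ℝ) < m := by exact_mod_cast hm
  unfold massGap
  have : ∑ i, optDensity φ ((f i - b) / η) ≤ ∑ _i : Fin m, (1 : ℝ) :=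
    Finset.sum_le_sum fun i _ => by
      rw [← hφ.optDensity_zero]
      exact hφ.optDensity_mono (div_nonpos_of_nonpos_of_nonneg (sub_nonpos.2 (h i)) hη.le)
  have h2 := mul_le_mul_of_nonneg_left this (show (0 : ℝ) ≤ 1 / m by positivity)
  rw [Finset.sum_const, Finset.card_univ, Fintype.card_fin, nsmul_eq_mul, mul_one,
    one_div_mul_cancel hm'.ne'] at h2
  linarith

theorem exists_massGap_eq_zero (f : Fin m → ℝ) (hm : 0 < m) : ∃ μ, massGap φ η f μ = 0 := by
  have : Nonempty (Fin m) := ⟨⟨0, hm⟩⟩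
  obtain ⟨i, hi⟩ := Finite.exists_min f
  obtain ⟨j, hj⟩ := Finite.exists_max f
  obtain ⟨μ, -, h⟩ := exists_zero_of_continuous (hφ.massGap_continuous f) (hi j)
    (hφ.massGap_nonneg hη f hm hi) (hφ.massGap_nonpos hη f hm hj)
  exact ⟨μ, h⟩

theorem le_dualValue (f : Fin m → ℝ) (hm : 0 < m) {a : ℝ} (h : ∀ i, a ≤ f i) :
    a ≤ dualValue φ η f := by
  have hm' : (0 : ℝ) < m := by exact_mod_cast hm
  refine le_trans ?_ (le_ciInf fun μ => hφ.le_dualObj hη f hm μ)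
  have : ∑ _i : Fin m, a ≤ ∑ i, f i := Finset.sum_le_sum fun i _ => h i
  rw [Finset.sum_const, Finset.card_univ, Fintype.card_fin, nsmul_eq_mul] at this
  rw [one_div, le_inv_mul_iff₀ hm']
  exact this

theorem dualValue_le_of_le (f : Fin m → ℝ) (hm : 0 < m) {b : ℝ} (h : ∀ i, f i ≤ b) :
    dualValue φ η f ≤ b := by
  refine (hφ.dualValue_le hη f hm b).trans ?_
  unfold dualObj
  have h0 : conj φ 0 = 0 := by simp [conj, hφ.optDensity_zero, hφ.map_one]
  have : ∑ i, conj φ ((f i - b) / η) ≤ 0 := Finset.sum_nonpos fun i _ => by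
    rw [← h0]
    exact hφ.conj_mono (div_nonpos_of_nonpos_of_nonneg (sub_nonpos.2 (h i)) hη.le)
  have := mul_nonpos_of_nonneg_of_nonpos (show (0 : ℝ) ≤ η / m by positivity) this
  linarith

/-- Raising the multiplier by `ε` compensates for raising all values by `ε`. Hence the value is
1-Lipschitz in the sup norm, which provides its measurability. -/
theorem dualValue_le_add (f f' : Fin m → ℝ) (hm : 0 < m) {ε : ℝ} (h : ∀ i, f i ≤ f' i + ε) :
    dualValue φ η f ≤ dualValue φ η f' + ε := by
  rw [← sub_le_iff_le_add]
  refine le_ciInf fun μ => ?_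
  rw [sub_le_iff_le_add]
  refine (hφ.dualValue_le hη f hm (μ + ε)).trans ?_
  unfold dualObj
  have : ∑ i, conj φ ((f i - (μ + ε)) / η) ≤ ∑ i, conj φ ((f' i - μ) / η) :=
    Finset.sum_le_sum fun i _ =>
      hφ.conj_mono (div_le_div_of_nonneg_right (by linarith [h i]) hη.le)
  have := mul_le_mul_of_nonneg_left this (show (0 : ℝ) ≤ η / m by positivity)
  linarith

theorem continuous_dualValue (hm : 0 < m) :
    Continuous (dualValue φ η : (Fin m → ℝ) → ℝ) := by
  refine (LipschitzWith.of_le_add fun f f' => ?_).continuous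
  refine hφ.dualValue_le_add hη f f' hm fun i => ?_
  have := (le_abs_self _).trans (norm_le_pi_norm (f - f') i)
  rw [← dist_eq_norm] at this
  simp only [Pi.sub_apply] at this
  linarith

theorem primal_le_dualObj (f γ : Fin m → ℝ) (hm : 0 < m) (hγ : ∑ i, γ i = 1)
    (hfin : ∀ i, φ (m * γ i) ≠ ⊤) (μ : ℝ) :
    ∑ i, γ i * f i - η / m * ∑ i, (φ (m * γ i)).toReal ≤ dualObj φ η f μ := by
  have hm' : (0 : ℝ) < m := by exact_mod_cast hm
  have h : ∑ i, ((f i - μ) / η * (m * γ i) - (φ (m * γ i)).toReal)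
      ≤ ∑ i, conj φ ((f i - μ) / η) :=
    Finset.sum_le_sum fun i _ => hφ.fenchel _ (hfin i)
  have h2 := mul_le_mul_of_nonneg_left h (show (0 : ℝ) ≤ η / m by positivity)
  refine le_trans (le_of_eq ?_) (add_le_add_right h2 μ)
  have e : ∀ i, (f i - μ) / η * (m * γ i) = (m / η) * (γ i * f i) - (m / η * μ) * γ i := by
    intro i; field_simp
  simp only [e, Finset.sum_sub_distrib, ← Finset.mul_sum, hγ]
  field_simp
  ring

theorem primal_le_dualValue (f γ : Fin m → ℝ) (hm : 0 < m) (hγ : ∑ i, γ i = 1)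
    (hfin : ∀ i, φ (m * γ i) ≠ ⊤) :
    ∑ i, γ i * f i - η / m * ∑ i, (φ (m * γ i)).toReal ≤ dualValue φ η f :=
  le_ciInf fun μ => hφ.primal_le_dualObj hη f γ hm hγ hfin μ

omit hφ in
/-- The Lagrangian at the weights for the multiplier `μ` is the dual function. -/
theorem lagrangian_eq_dualObj (f : Fin m → ℝ) (hm : 0 < m) (μ : ℝ) :
    ∑ i, multiplierWeight φ η m μ (f i) * f i
      - η / m * ∑ i, (φ (m * multiplierWeight φ η m μ (f i))).toReal
      + μ * (1 - ∑ i, multiplierWeight φ η m μ (f i)) = dualObj φ η f μ := by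
  have hm' : (0 : ℝ) < m := by exact_mod_cast hm
  have e : ∀ i, (φ (m * multiplierWeight φ η m μ (f i))).toReal
      = (f i - μ) / η * optDensity φ ((f i - μ) / η) - conj φ ((f i - μ) / η) := by
    intro i
    rw [multiplierWeight_eq, ← toReal_optDensity, ← mul_assoc, mul_one_div_cancel hm'.ne', one_mul]
  have e2 : ∀ i, (f i - μ) / η * optDensity φ ((f i - μ) / η)
      = (m / η) * (1 / m * optDensity φ ((f i - μ) / η) * f i)
        - (m / η * μ) * (1 / m * optDensity φ ((f i - μ) / η)) := by
    intro i; field_simp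
  simp only [e]
  simp only [multiplierWeight_eq, e2, Finset.sum_sub_distrib, ← Finset.mul_sum, dualObj]
  field_simp
  ring

omit hφ in
theorem bisectValue_eq (N : ℕ) (f : Fin m → ℝ) (hm : 0 < m) :
    bisectValue φ η N f = dualObj φ η f (bisect φ η N f).mu :=
  lagrangian_eq_dualObj hη f hm _

theorem discreteObj_le (f γ : Fin m → ℝ) (hm : 0 < m) (hγ : ∑ i, γ i = 1) :
    discreteObj φ η f γ ≤ (dualValue φ η f : EReal) := by
  have hm' : (0 : ℝ) < m := by exact_mod_cast hm
  unfold discreteObj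
  by_cases hfin : ∀ i, φ (m * γ i) ≠ ⊤
  · rw [← discreteObj, discreteObj_eq hη f γ hm hfin, EReal.coe_le_coe_iff]
    exact hφ.primal_le_dualValue hη f γ hm hγ hfin
  · push Not at hfin
    obtain ⟨i, hi⟩ := hfin
    have hs : ∑ i, φ (m * γ i) = ⊤ := ENNReal.sum_eq_top.2 ⟨i, Finset.mem_univ _, hi⟩
    -- In `ℝ≥0∞` zero times infinity is zero, so positivity of the factor is what makes the infinite
    -- penalty survive.
    have : ENNReal.ofReal (η / m) ≠ 0 := by
      rw [Ne, ENNReal.ofReal_eq_zero, not_le]; positivity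
    rw [hs, ENNReal.mul_top this, EReal.coe_ennreal_top, EReal.sub_top]
    exact bot_le

/-- Strong duality: the weights at a root of `massGap` are feasible, and their Lagrangian, which is
the dual value, has no multiplier term left. -/
theorem discreteValue_eq (f : Fin m → ℝ) (hm : 0 < m) :
    discreteValue φ η f = (dualValue φ η f : EReal) := by
  have hm' : (0 : ℝ) < m := by exact_mod_cast hm
  refine le_antisymm (iSup₂_le fun γ hγ => hφ.discreteObj_le hη f γ hm hγ.2) ?_
  obtain ⟨μ, hμ⟩ := hφ.exists_massGap_eq_zero hη f hm
  set γ : Fin m → ℝ := fun i => multiplierWeight φ η m μ (f i) with hγ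
  have hsum : ∑ i, γ i = 1 := by
    have := sum_multiplierWeight (φ := φ) (η := η) f μ
    rw [hμ] at this; linarith
  have hfin : ∀ i, φ (m * γ i) ≠ ⊤ := by
    intro i
    rw [hγ]
    simp only [multiplierWeight_eq]
    rw [← mul_assoc, mul_one_div_cancel hm'.ne', one_mul]
    exact hφ.finite_optDensity _
  have hmem : γ ∈ stdSimplex ℝ (Fin m) := by
    refine ⟨fun i => ?_, hsum⟩
    rw [hγ]
    simp only [multiplierWeight_eq]
    exact mul_nonneg (by positivity) (hφ.optDensity_nonneg _)
  refine le_trans (le_of_eq ?_) (le_iSup₂ (f := fun γ _ => discreteObj φ η f γ) γ hmem)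
  rw [discreteObj_eq hη f γ hm hfin, EReal.coe_eq_coe_iff, hφ.dualValue_eq hη f hm hμ,
      ← lagrangian_eq_dualObj hη f hm μ]
  simp only [hγ] at hsum ⊢
  rw [hsum]; ring

/-! ### The bisection search -/

/-- The initial interval brackets a root. At the minimum all densities are at least 1. For K = -∞
the upper end lies above the maximum, so all densities are at most 1; otherwise it is the maximum
minus ηK, where every density is zero. -/
theorem bisectInit_spec (f : Fin m → ℝ) (hm : 0 < m) {G : ℝ} (hG : ∀ i j, f i - f j ≤ G) :
    0 ≤ massGap φ η f (bisectInit φ η f).lo ∧ massGap φ η f (bisectInit φ η f).hi ≤ 0 ∧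
      (bisectInit φ η f).lo ≤ (bisectInit φ η f).hi ∧
      (bisectInit φ η f).hi - (bisectInit φ η f).lo ≤ bisectWidth φ η G := by
  have hm' : (0 : ℝ) < m := by exact_mod_cast hm
  have : Nonempty (Fin m) := ⟨⟨0, hm⟩⟩
  obtain ⟨i₀, hi⟩ := Finite.exists_min f
  obtain ⟨j₀, hj⟩ := Finite.exists_max f
  have elo : ⨅ i, f i = f i₀ :=
    le_antisymm (ciInf_le (Set.finite_range f).bddBelow i₀) (le_ciInf hi)
  have ehi : ⨆ i, f i = f j₀ :=
    le_antisymm (ciSup_le hj) (le_ciSup (Set.finite_range f).bddAbove j₀)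
  have hd : 0 ≤ f j₀ - f i₀ := sub_nonneg.2 (hi j₀)
  have hdG := hG j₀ i₀
  have hG0 : 0 ≤ G := hd.trans hdG
  unfold bisectInit bisectWidth
  simp only [elo, ehi]
  refine ⟨hφ.massGap_nonneg hη f hm hi, ?_⟩
  split_ifs with hK
  · rw [hK, EReal.toReal_bot]
    have : 0 ≤ η * (f j₀ - f i₀) := mul_nonneg hη.le hd
    have : η * (f j₀ - f i₀) ≤ η * G := mul_le_mul_of_nonneg_left hdG hη.le
    refine ⟨hφ.massGap_nonpos hη f hm fun i => ?_, ?_, ?_⟩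
    · linarith [hj i]
    · linarith
    · simp only [abs_zero, mul_zero]; linarith
  -- The slope at 1 is zero because φ has its minimum there, so the limit at zero is strictly
  -- negative and, not being -∞, real.
  · have hlt : slopeZero φ < 0 := by
      by_contra hcon
      have := (hφ.coe_le_slopeZero (y := 0)).1 (by simpa using hcon) 1 one_pos
      rw [hφ.dphi_one] at this
      exact lt_irrefl _ this
    have htop : slopeZero φ ≠ ⊤ := (hlt.trans_le le_top).ne
    set K := (slopeZero φ).toReal with hKdef
    have hKK : ((K : ℝ) : EReal) = slopeZero φ := EReal.coe_toReal htop hK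
    have hK0 : K < 0 := by rw [← hKK] at hlt; exact_mod_cast hlt
    have hneg := mul_neg_of_pos_of_neg hη hK0
    refine ⟨?_, by linarith, ?_⟩
    · unfold massGap
      rw [Finset.sum_eq_zero]
      · simp
      · intro i _
        unfold optDensity
        rw [if_pos]
        rw [← hKK, EReal.coe_le_coe_iff, div_le_iff₀ hη]
        linarith [hj i]
    · rw [abs_of_neg hK0]
      nlinarith

theorem bisect_spec (N : ℕ) (f : Fin m → ℝ) (hm : 0 < m) {G : ℝ} (hG : ∀ i j, f i - f j ≤ G) :
    0 ≤ massGap φ η f (bisect φ η N f).lo ∧ massGap φ η f (bisect φ η N f).hi ≤ 0 ∧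
      (bisect φ η N f).lo ≤ (bisect φ η N f).mu ∧ (bisect φ η N f).mu ≤ (bisect φ η N f).hi ∧
      (bisect φ η N f).hi - (bisect φ η N f).lo ≤ bisectWidth φ η G / 2 ^ N := by
  induction N with
  | zero =>
    obtain ⟨h1, h2, h3, h4⟩ := hφ.bisectInit_spec hη f hm hG
    -- Before any iteration `mu` is set to the lower end, so `mu` belongs to the bracket for every
    -- `N`, zero included.
    exact ⟨h1, h2, le_rfl, h3, by rw [pow_zero, div_one]; exact h4⟩
  | succ N ih =>
    obtain ⟨h1, h2, h3, h4, h5⟩ := ih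
    have e : bisect φ η (N + 1) f = bisectStep φ η f (bisect φ η N f) := by
      unfold bisect; rw [Function.iterate_succ_apply']
    rw [e]
    unfold bisectStep
    simp only [sum_multiplierWeight]
    set s := bisect φ η N f
    have h6 : bisectWidth φ η G / 2 ^ (N + 1) = bisectWidth φ η G / 2 ^ N / 2 := by
      rw [pow_succ, div_div]
    rw [h6]
    split_ifs with h
    · refine ⟨h1, h, ?_, le_rfl, ?_⟩ <;> dsimp only <;> linarith
    · refine ⟨(not_le.1 h).le, h2, le_rfl, ?_, ?_⟩ <;> dsimp only <;> linarith

/-- The bisection search returns a multiplier close to an optimal one. -/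
theorem exists_root_near_bisect (N : ℕ) (f : Fin m → ℝ) (hm : 0 < m) {G : ℝ}
    (hG : ∀ i j, f i - f j ≤ G) :
    ∃ μ, massGap φ η f μ = 0 ∧ |(bisect φ η N f).mu - μ| ≤ bisectWidth φ η G / 2 ^ N := by
  obtain ⟨h1, h2, h3, h4, h5⟩ := hφ.bisect_spec hη N f hm hG
  obtain ⟨μ, hμ, h⟩ := exists_zero_of_continuous (hφ.massGap_continuous f) (h3.trans h4) h1 h2
  exact ⟨μ, h, abs_le.2 ⟨by linarith [hμ.1, hμ.2], by linarith [hμ.1, hμ.2]⟩⟩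

/-- The estimate is a dual value, so it is never too small. The slope of the dual vanishes at the
root and is Lipschitz with constant 1/(ηκ), so the excess is quadratic in the distance to the root.
-/
theorem bisect_gap (N : ℕ) (f : Fin m → ℝ) (hm : 0 < m) {G ε : ℝ} (hG : ∀ i j, f i - f j ≤ G)
    (hε : (bisectWidth φ η G / 2 ^ N) ^ 2 / (η * κ) ≤ ε) :
    discreteValue φ η f ≤ ((bisectValue φ η N f + ε : ℝ) : EReal) ∧
      ((bisectValue φ η N f - ε : ℝ) : EReal) ≤ discreteValue φ η f := by
  have hk := hφ.modulus_pos
  have hε0 : 0 ≤ ε := le_trans (by positivity) hε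
  rw [hφ.discreteValue_eq hη f hm, bisectValue_eq hη N f hm, EReal.coe_le_coe_iff,
    EReal.coe_le_coe_iff]
  refine ⟨(hφ.dualValue_le hη f hm _).trans (by linarith), ?_⟩
  obtain ⟨μ, hμ, hd⟩ := hφ.exists_root_near_bisect hη N f hm hG
  set ν := (bisect φ η N f).mu
  rw [hφ.dualValue_eq hη f hm hμ]
  have h1 := hφ.dualObj_tangent hη f f hm ν μ
  simp only [sub_self, mul_zero, Finset.sum_const_zero, add_zero] at h1
  have h2 := hφ.abs_massGap_sub_le hη f hm ν μ
  rw [hμ, sub_zero] at h2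
  have h3 : massGap φ η f ν * (μ - ν) ≤ |ν - μ| / (η * κ) * |ν - μ| := by
    refine (le_abs_self _).trans ?_
    rw [abs_mul, abs_sub_comm μ ν]
    gcongr
  have h4 : |ν - μ| / (η * κ) * |ν - μ| ≤ (bisectWidth φ η G / 2 ^ N) ^ 2 / (η * κ) := by
    rw [div_mul_eq_mul_div, ← sq]
    gcongr
  linarith

end IsDivergence

theorem bisect_queries (N : ℕ) (f : Fin m → ℝ) : (bisect φ η N f).queries = (N + 1) * m := by
  induction N with
  | zero => simp [bisect, bisectInit]
  | succ N ih =>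
    have e : bisect φ η (N + 1) f = bisectStep φ η f (bisect φ η N f) := by
      unfold bisect; rw [Function.iterate_succ_apply']
    rw [e]
    unfold bisectStep
    dsimp only
    split_ifs <;> simp only [ih] <;> ring

theorem bisectQueries_eq (N : ℕ) (f : Fin m → ℝ) : bisectQueries φ η N f = (N + 2) * m := by
  unfold bisectQueries; rw [bisect_queries]; ring

end Discrete

end AdvRobust

namespace AdvRobust

/-! ### Bernstein operators on primitives of monotone functions -/

section Bernstein

/-- The derivative of the basis polynomial of degree n+1 and index k+1 is n+1 times the difference
of those of degree n and indices k, k+1. Integration shows that consecutive integrals agree for k <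
n, and the last one is computed directly; hence the backward induction. -/
theorem integral_bernstein {n j : ℕ} (hj : j ≤ n) :
    ∫ t in (0 : ℝ)..1, (bernsteinPolynomial ℝ n j).eval t = 1 / (n + 1) := by
  have hint : ∀ k, IntervalIntegrable (fun t => (bernsteinPolynomial ℝ n k).eval t) volume 0 1 :=
    fun k => (Polynomial.continuous _).intervalIntegrable _ _
  have key : ∀ k, (n + 1 : ℝ) * ((∫ t in (0 : ℝ)..1, (bernsteinPolynomial ℝ n k).eval t)
      - ∫ t in (0 : ℝ)..1, (bernsteinPolynomial ℝ n (k + 1)).eval t) = if k = n then 1 else 0 := by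
    intro k
    have h := intervalIntegral.integral_eq_sub_of_hasDerivAt
      (f := fun t => (bernsteinPolynomial ℝ (n + 1) (k + 1)).eval t)
      (f' := fun t => (n + 1 : ℝ) * ((bernsteinPolynomial ℝ n k).eval t
        - (bernsteinPolynomial ℝ n (k + 1)).eval t)) (a := 0) (b := 1)
      (fun t _ => by
        have := (bernsteinPolynomial ℝ (n + 1) (k + 1)).hasDerivAt t
        rw [bernsteinPolynomial.derivative_succ] at this
        simpa using this)
      (((hint k).sub (hint (k + 1))).const_mul _)
    rw [intervalIntegral.integral_const_mul, intervalIntegral.integral_sub (hint k) (hint (k + 1)),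
      bernsteinPolynomial.eval_at_1, bernsteinPolynomial.eval_at_0] at h
    simpa using h
  have hn : (0 : ℝ) < n + 1 := by positivity
  induction hj using Nat.decreasingInduction with
  | self =>
    have := key n
    rw [bernsteinPolynomial.eq_zero_of_lt ℝ (Nat.lt_succ_self n)] at this
    simp only [Polynomial.eval_zero, intervalIntegral.integral_zero, sub_zero, if_true] at this
    rw [eq_div_iff hn.ne']; linarith
  | of_succ k hk ih =>
    have := key k
    rw [if_neg hk.ne, mul_eq_zero, or_iff_right hn.ne', sub_eq_zero] at this
    rw [this, ih]

/-- The primitive of `s`. -/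
noncomputable def primitive (s : ℝ → ℝ) (p : ℝ) : ℝ := ∫ u in (0 : ℝ)..p, s u

/-- The `n`-th Bernstein polynomial of the function `R`. -/
noncomputable def bernsteinOf (R : ℝ → ℝ) (n : ℕ) (p : ℝ) : ℝ :=
  ∑ j ∈ Finset.range (n + 1), R (j / n) * (bernsteinPolynomial ℝ n j).eval p

variable {s : ℝ → ℝ} (hs : Monotone s)
include hs

theorem primitive_sub (p t : ℝ) : primitive s p - primitive s t = ∫ u in t..p, s u :=
  intervalIntegral.integral_interval_sub_left (hs.intervalIntegrable) (hs.intervalIntegrable)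

/-- A monotone integrand is a subgradient of its primitive, also at its jumps; this is how convexity
of the primitive is used. -/
theorem primitive_tangent (p t : ℝ) : primitive s t + s t * (p - t) ≤ primitive s p := by
  have h := primitive_sub hs p t
  have : s t * (p - t) ≤ ∫ u in t..p, s u := by
    rcases le_total t p with htp | htp
    · have := intervalIntegral.integral_mono_on htp (intervalIntegrable_const (c := s t))
        (hs.intervalIntegrable (μ := volume)) fun x hx => hs hx.1
      simp only [intervalIntegral.integral_const, smul_eq_mul] at this
      linarith
    · have := intervalIntegral.integral_mono_on htp (hs.intervalIntegrable (μ := volume))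
        (intervalIntegrable_const (c := s t)) fun x hx => hs hx.2
      simp only [intervalIntegral.integral_const, smul_eq_mul] at this
      rw [intervalIntegral.integral_symm]
      linarith
  linarith

theorem primitive_mono (h0 : ∀ u, 0 ≤ s u) : Monotone (primitive s) := by
  intro t p htp
  have h := primitive_tangent hs p t
  have := mul_nonneg (h0 t) (sub_nonneg.2 htp)
  linarith

theorem continuous_primitive : Continuous (primitive s) :=
  intervalIntegral.continuous_primitive (fun _ _ => hs.intervalIntegrable) 0

omit hs in
theorem bernstein_eval_nonneg (n j : ℕ) {p : ℝ} (hp : p ∈ Set.Icc (0 : ℝ) 1) :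
    0 ≤ (bernsteinPolynomial ℝ n j).eval p := by
  unfold bernsteinPolynomial
  have h1 := hp.1
  have h2 : 0 ≤ 1 - p := sub_nonneg.2 hp.2
  simp only [Polynomial.eval_mul, Polynomial.eval_natCast, Polynomial.eval_pow, Polynomial.eval_X,
    Polynomial.eval_sub, Polynomial.eval_one]
  positivity

omit hs in
theorem sum_bernstein_eval (n : ℕ) (p : ℝ) :
    ∑ j ∈ Finset.range (n + 1), (bernsteinPolynomial ℝ n j).eval p = 1 := by
  have := congrArg (Polynomial.eval p) (bernsteinPolynomial.sum ℝ n)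
  simpa [Polynomial.eval_finsetSum] using this

omit hs in
theorem sum_mul_bernstein_eval {n : ℕ} (hn : 0 < n) (p : ℝ) :
    ∑ j ∈ Finset.range (n + 1), (j / n : ℝ) * (bernsteinPolynomial ℝ n j).eval p = p := by
  have hn' : (n : ℝ) ≠ 0 := by positivity
  have := congrArg (Polynomial.eval p) (bernsteinPolynomial.sum_smul ℝ n)
  simp only [Polynomial.eval_finsetSum, nsmul_eq_mul, Polynomial.eval_mul,
    Polynomial.eval_natCast, Polynomial.eval_X] at this
  simp only [div_mul_eq_mul_div, ← Finset.sum_div, this]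
  field_simp

/-- Jensen's inequality: the basis polynomials at `p` are probability weights on the grid with mean
`p`, and the primitive lies above its tangent at `p`. -/
theorem primitive_le_bernsteinOf {n : ℕ} (hn : 0 < n) {p : ℝ} (hp : p ∈ Set.Icc (0 : ℝ) 1) :
    primitive s p ≤ bernsteinOf (primitive s) n p := by
  have h : ∑ j ∈ Finset.range (n + 1), (primitive s p + s p * ((j / n : ℝ) - p))
      * (bernsteinPolynomial ℝ n j).eval p ≤ bernsteinOf (primitive s) n p :=
    Finset.sum_le_sum fun j _ => mul_le_mul_of_nonneg_right (primitive_tangent hs _ _)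
      (bernstein_eval_nonneg n j hp)
  refine le_trans (le_of_eq ?_) h
  have e : ∀ j : ℕ, (primitive s p + s p * ((j / n : ℝ) - p)) * (bernsteinPolynomial ℝ n j).eval p
      = (primitive s p - s p * p) * (bernsteinPolynomial ℝ n j).eval p
        + s p * ((j / n : ℝ) * (bernsteinPolynomial ℝ n j).eval p) := by
    intro j; ring
  simp only [e, Finset.sum_add_distrib, ← Finset.mul_sum, sum_bernstein_eval,
    sum_mul_bernstein_eval hn]
  ring

omit hs in
theorem continuous_bernsteinOf (R : ℝ → ℝ) (n : ℕ) : Continuous (bernsteinOf R n) := by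
  unfold bernsteinOf
  exact continuous_finsetSum _ fun j _ => continuous_const.mul (Polynomial.continuous _)

omit hs in
theorem bernsteinOf_zero (R : ℝ → ℝ) (n : ℕ) : bernsteinOf R n 0 = R 0 := by
  unfold bernsteinOf
  rw [Finset.sum_eq_single 0]
  · simp [bernsteinPolynomial.eval_at_0]
  · intro j _ hj; simp [bernsteinPolynomial.eval_at_0, hj]
  · simp

omit hs in
theorem bernsteinOf_one (R : ℝ → ℝ) {n : ℕ} (hn : 0 < n) : bernsteinOf R n 1 = R 1 := by
  have hn' : (n : ℝ) ≠ 0 := by positivity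
  unfold bernsteinOf
  rw [Finset.sum_eq_single n]
  · simp [bernsteinPolynomial.eval_at_1, hn']
  · intro j _ hj; simp [bernsteinPolynomial.eval_at_1, hj]
  · simp

/-- All basis polynomials have integral 1/(n+1). The grid point 1 contributes exactly 1/(n+1), and
the remaining terms are below the left Riemann sum of an increasing function, hence below its
integral. -/
theorem integral_bernsteinOf_sub_le {n : ℕ} (hn : 0 < n) (h0 : ∀ u, 0 ≤ s u)
    (h1 : primitive s 1 = 1) :
    ∫ p in (0 : ℝ)..1, (bernsteinOf (primitive s) n p - primitive s p) ≤ 1 / (n + 1) := by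
  have hn' : (0 : ℝ) < n := by exact_mod_cast hn
  set R := primitive s with hR
  have hRm : Monotone R := primitive_mono hs h0
  have hR0 : R 0 = 0 := by simp [hR, primitive]
  rw [intervalIntegral.integral_sub ((continuous_bernsteinOf R n).intervalIntegrable _ _)
    (hRm.intervalIntegrable)]
  have e1 : ∫ p in (0 : ℝ)..1, bernsteinOf R n p
      = 1 / (n + 1) * ((∑ j ∈ Finset.range n, R (j / n)) + 1) := by
    unfold bernsteinOf
    rw [intervalIntegral.integral_finsetSum fun j _ =>
      Continuous.intervalIntegrable (by fun_prop) _ _]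
    have : ∀ j ∈ Finset.range (n + 1),
        ∫ p in (0 : ℝ)..1, R (j / n) * (bernsteinPolynomial ℝ n j).eval p
          = 1 / (n + 1) * R (j / n) := by
      intro j hj
      rw [intervalIntegral.integral_const_mul,
        integral_bernstein (Nat.lt_succ_iff.1 (Finset.mem_range.1 hj))]
      ring
    rw [Finset.sum_congr rfl this, ← Finset.mul_sum, Finset.sum_range_succ, div_self hn'.ne', h1]
  have e2 : 1 / n * ∑ j ∈ Finset.range n, R (j / n) ≤ ∫ p in (0 : ℝ)..1, R p := by
    have hsum := intervalIntegral.sum_integral_adjacent_intervals (f := R) (μ := volume)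
      (a := fun j : ℕ => (j / n : ℝ)) (n := n) fun k _ => hRm.intervalIntegrable
    simp only [Nat.cast_zero, zero_div, div_self hn'.ne'] at hsum
    rw [← hsum, Finset.mul_sum]
    refine Finset.sum_le_sum fun j _ => ?_
    have hle : (j / n : ℝ) ≤ ((j + 1 : ℕ) / n : ℝ) := by
      gcongr; simp
    have := intervalIntegral.integral_mono_on hle (intervalIntegrable_const (c := R (j / n)))
      (hRm.intervalIntegrable (μ := volume)) fun x hx => hRm hx.1
    refine le_trans (le_of_eq ?_) this
    rw [intervalIntegral.integral_const, smul_eq_mul]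
    push_cast
    field_simp
    ring
  have hS : 0 ≤ ∑ j ∈ Finset.range n, R (j / n) := Finset.sum_nonneg fun j _ => by
    rw [← hR0]; exact hRm (by positivity)
  rw [e1]
  have : 1 / ((n : ℝ) + 1) * ∑ j ∈ Finset.range n, R (j / n)
      ≤ 1 / n * ∑ j ∈ Finset.range n, R (j / n) := by
    gcongr; linarith
  linarith

end Bernstein

/-! ### Quantile functions -/

section Quantile

variable (P : Measure ℝ) [IsProbabilityMeasure P]

/-- The Galois connection between quantile function and cdf; right continuity of the cdf makes the
infimum a minimum. -/
theorem invCdf_le_iff {u : ℝ} (hu : u ∈ Set.Ioo (0 : ℝ) 1) (x : ℝ) :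
    invCdf P u ≤ x ↔ u ≤ P.real (Set.Iic x) := by
  have hne : ∃ x, u ≤ P.real (Set.Iic x) := by
    have h := (tendsto_cdf_atTop P).eventually (lt_mem_nhds hu.2)
    obtain ⟨x, hx⟩ := h.exists
    exact ⟨x, by rw [← cdf_eq_real]; exact hx.le⟩
  have hbdd : BddBelow {x : ℝ | u ≤ P.real (Set.Iic x)} := by
    have h := (tendsto_cdf_atBot P).eventually (gt_mem_nhds hu.1)
    obtain ⟨y, hy⟩ := h.exists
    refine ⟨y, fun x hx => ?_⟩
    by_contra hcon
    have h1 := monotone_cdf P (not_le.1 hcon).le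
    have h2 : u ≤ P.real (Set.Iic x) := hx
    rw [← cdf_eq_real] at h2
    linarith
  refine ⟨fun h => ?_, fun h => csInf_le hbdd h⟩
  have hright : ∀ y, x < y → u ≤ cdf P y := by
    intro y hy
    obtain ⟨z, hz, hzy⟩ := exists_lt_of_csInf_lt hne (lt_of_le_of_lt h hy)
    have hz' : u ≤ P.real (Set.Iic z) := hz
    rw [← cdf_eq_real] at hz'
    exact hz'.trans (monotone_cdf P hzy.le)
  rw [← cdf_eq_real]
  have hc := ((cdf P).right_continuous x).tendsto.mono_left
    (nhdsWithin_mono x Set.Ioi_subset_Ici_self)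
  exact ge_of_tendsto hc (eventually_nhdsWithin_of_forall fun y hy => hright y hy)

theorem monotoneOn_invCdf : MonotoneOn (invCdf P) (Set.Ioo 0 1) := by
  intro u hu v hv huv
  rw [invCdf_le_iff P hu]
  exact huv.trans ((invCdf_le_iff P hv _).1 le_rfl)

/-- Inverse transform sampling: the preimage of a half-line is, up to a null set, an interval whose
length is the cdf. -/
theorem map_invCdf : (volume.restrict (Set.Ioo (0 : ℝ) 1)).map (invCdf P) = P := by
  have hm : AEMeasurable (invCdf P) (volume.restrict (Set.Ioo (0 : ℝ) 1)) :=
    aemeasurable_restrict_of_monotoneOn measurableSet_Ioo (monotoneOn_invCdf P)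
  have hfin : IsFiniteMeasure ((volume.restrict (Set.Ioo (0 : ℝ) 1)).map (invCdf P)) := by
    infer_instance
  refine Measure.ext_of_Iic _ _ fun x => ?_
  rw [Measure.map_apply_of_aemeasurable hm measurableSet_Iic]
  have h1 : P.real (Set.Iic x) ≤ 1 := measureReal_le_one
  have h0 : 0 ≤ P.real (Set.Iic x) := measureReal_nonneg
  have hset : (invCdf P ⁻¹' Set.Iic x) ∩ Set.Ioo 0 1
      = Set.Iic (P.real (Set.Iic x)) ∩ Set.Ioo 0 1 := by
    ext u
    simp only [Set.mem_inter_iff, Set.mem_preimage, Set.mem_Iic, and_congr_left_iff]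
    exact fun hu => invCdf_le_iff P hu x
  rw [Measure.restrict_apply' measurableSet_Ioo, hset]
  have hae : (Set.Iic (P.real (Set.Iic x)) ∩ Set.Ioo 0 1 : Set ℝ)
      =ᵐ[volume] Set.Ioc 0 (P.real (Set.Iic x)) := by
    have hone : ∀ᵐ u : ℝ ∂volume, u ≠ 1 := by
      simp [ae_iff]
    filter_upwards [hone] with u hu
    apply propext
    change (u ∈ Set.Iic (P.real (Set.Iic x)) ∩ Set.Ioo 0 1) ↔ u ∈ Set.Ioc 0 (P.real (Set.Iic x))
    simp only [Set.mem_inter_iff, Set.mem_Iic, Set.mem_Ioo, Set.mem_Ioc]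
    constructor
    · rintro ⟨h1, h2, -⟩; exact ⟨h2, h1⟩
    · rintro ⟨h2, h3⟩; exact ⟨h3, h2, lt_of_le_of_ne (h3.trans h1) hu⟩
  rw [measure_congr hae, Real.volume_Ioc, sub_zero, ofReal_measureReal]

variable {P} {G : ℝ≥0} (hG : LipschitzOnWith G (invCdf P) (Set.Ioo 0 1))
include hG

-- Since (0,1) has length 1, a `G`-Lipschitz quantile function has range of length at most `G`. This
-- is the only source of boundedness for the loss values.
omit [IsProbabilityMeasure P] in
theorem exists_quantile_bounds :
    ∃ a b : ℝ, a ≤ b ∧ b - a ≤ G ∧ ∀ u ∈ Set.Ioo (0 : ℝ) 1, invCdf P u ∈ Set.Icc a b := by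
  have hd : ∀ u ∈ Set.Ioo (0 : ℝ) 1, ∀ v ∈ Set.Ioo (0 : ℝ) 1, invCdf P u - invCdf P v ≤ G := by
    intro u hu v hv
    have h := hG.dist_le_mul u hu v hv
    rw [Real.dist_eq, Real.dist_eq] at h
    have h2 : |u - v| ≤ 1 := abs_le.2 ⟨by linarith [hu.1, hv.2], by linarith [hu.2, hv.1]⟩
    have h3 : (G : ℝ) * |u - v| ≤ G * 1 := mul_le_mul_of_nonneg_left h2 G.2
    linarith [le_abs_self (invCdf P u - invCdf P v)]
  set S := invCdf P '' Set.Ioo (0 : ℝ) 1 with hS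
  have hhalf : (1 / 2 : ℝ) ∈ Set.Ioo (0 : ℝ) 1 := by constructor <;> norm_num
  have hne : S.Nonempty := ⟨_, _, hhalf, rfl⟩
  have hba : BddAbove S := ⟨invCdf P (1 / 2) + G, by
    rintro _ ⟨u, hu, rfl⟩; linarith [hd u hu _ hhalf]⟩
  have hbb : BddBelow S := ⟨invCdf P (1 / 2) - G, by
    rintro _ ⟨u, hu, rfl⟩; linarith [hd _ hhalf u hu]⟩
  refine ⟨sInf S, sSup S, csInf_le_csSup hne hbb hba, ?_, fun u hu =>
    ⟨csInf_le hbb ⟨u, hu, rfl⟩, le_csSup hba ⟨u, hu, rfl⟩⟩⟩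
  rw [sub_le_iff_le_add]
  refine csSup_le hne ?_
  rintro _ ⟨u, hu, rfl⟩
  rw [← sub_le_iff_le_add']
  refine le_csInf hne ?_
  rintro _ ⟨v, hv, rfl⟩
  linarith [hd u hu v hv]

omit hG in
theorem ae_mem_Icc_of_invCdf {a b : ℝ}
    (hab : ∀ u ∈ Set.Ioo (0 : ℝ) 1, invCdf P u ∈ Set.Icc a b) : ∀ᵐ x ∂P, x ∈ Set.Icc a b := by
  rw [← map_invCdf P]
  refine (ae_map_iff (aemeasurable_restrict_of_monotoneOn measurableSet_Ioo
    (monotoneOn_invCdf P)) measurableSet_Icc).2 ?_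
  exact (ae_restrict_iff' measurableSet_Ioo).2 (Filter.Eventually.of_forall hab)

/-- Continuity of the quantile function excludes flat pieces of the cdf at levels strictly between 0
and 1. If the quantile at the level of `x` were below `x`, so would be that at a slightly higher
level, contradicting the Galois connection. -/
theorem invCdf_cdf {x : ℝ} (hx : P.real (Set.Iic x) ∈ Set.Ioo (0 : ℝ) 1) :
    invCdf P (P.real (Set.Iic x)) = x := by
  set t := P.real (Set.Iic x) with ht
  refine le_antisymm ((invCdf_le_iff P hx x).2 le_rfl) ?_
  by_contra hcon
  push Not at hcon
  have hlim : Tendsto (invCdf P) (𝓝[>] t) (𝓝 (invCdf P t)) := by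
    have h := (hG.continuousOn t hx).tendsto
    refine h.mono_left ?_
    rw [← nhdsWithin_Ioo_eq_nhdsGT hx.2]
    exact nhdsWithin_mono _ fun u hu => ⟨hx.1.trans hu.1, hu.2⟩
  have hev := (hlim.eventually (gt_mem_nhds hcon)).and (Ioo_mem_nhdsGT hx.2)
  obtain ⟨u, hu1, hu2⟩ := hev.exists
  have := (invCdf_le_iff P ⟨hx.1.trans hu2.1, hu2.2⟩ x).1 hu1.le
  exact absurd (lt_of_lt_of_le hu2.1 this) (lt_irrefl _)

/-- Change of variables along the cdf: its inverse is `G`-Lipschitz. -/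
theorem lintegral_cdf_le (B : Set ℝ) {h : ℝ → ℝ≥0∞} (hm : Measurable h) (h0 : h 0 = 0)
    (h1 : h 1 = 0) :
    ∫⁻ x in B, h (P.real (Set.Iic x)) ≤ G * ∫⁻ p in Set.Ioo (0 : ℝ) 1, h p := by
  have hF : Measurable fun x => P.real (Set.Iic x) :=
    Monotone.measurable fun x y hxy => measureReal_mono (Set.Iic_subset_Iic.2 hxy)
  set S := {x : ℝ | P.real (Set.Iic x) ∈ Set.Ioo (0 : ℝ) 1} with hS
  have hSm : MeasurableSet S := hF measurableSet_Ioo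
  have hle : (volume.restrict S).map (fun x => P.real (Set.Iic x))
      ≤ (G : ℝ≥0∞) • volume.restrict (Set.Ioo (0 : ℝ) 1) := by
    refine Measure.le_iff.2 fun A hA => ?_
    rw [Measure.map_apply hF hA, Measure.restrict_apply (hF hA), Measure.smul_apply,
      Measure.restrict_apply hA, smul_eq_mul]
    have hsub : (fun x => P.real (Set.Iic x)) ⁻¹' A ∩ S
        ⊆ invCdf P '' (A ∩ Set.Ioo 0 1) := by
      rintro x ⟨hxA, hxS⟩
      exact ⟨_, ⟨hxA, hxS⟩, invCdf_cdf hG hxS⟩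
    refine (measure_mono hsub).trans ?_
    -- On the line, Lebesgue measure is one-dimensional Hausdorff measure, which a `G`-Lipschitz map
    -- enlarges at most by the factor `G`. The law itself may have atoms.
    have := (hG.mono (Set.inter_subset_right (s := A))).hausdorffMeasure_image_le
      (d := 1) zero_le_one
    rw [hausdorffMeasure_real] at this
    simpa using this
  calc ∫⁻ x in B, h (P.real (Set.Iic x))
      ≤ ∫⁻ x, h (P.real (Set.Iic x)) := setLIntegral_le_lintegral _ _
    _ = ∫⁻ x in S, h (P.real (Set.Iic x)) := by
        rw [← lintegral_indicator hSm]
        refine lintegral_congr fun x => ?_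
        by_cases hx : x ∈ S
        · rw [Set.indicator_of_mem hx]
        · rw [Set.indicator_of_notMem hx]
          -- Outside `S` the cdf is 0 or 1, where `h` vanishes, so an unbounded region contributes
          -- nothing.
          have : P.real (Set.Iic x) = 0 ∨ P.real (Set.Iic x) = 1 := by
            have h2 : 0 ≤ P.real (Set.Iic x) := measureReal_nonneg
            have h3 : P.real (Set.Iic x) ≤ 1 := measureReal_le_one
            by_contra hcon
            push Not at hcon
            exact hx ⟨lt_of_le_of_ne h2 hcon.1.symm, lt_of_le_of_ne h3 hcon.2⟩
          rcases this with h2 | h2 <;> rw [h2] <;> assumption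
    _ = ∫⁻ p, h p ∂((volume.restrict S).map (fun x => P.real (Set.Iic x))) :=
        (lintegral_map hm hF).symm
    _ ≤ ∫⁻ p, h p ∂((G : ℝ≥0∞) • volume.restrict (Set.Ioo (0 : ℝ) 1)) := lintegral_mono' hle le_rfl
    _ = G * ∫⁻ p in Set.Ioo (0 : ℝ) 1, h p := by rw [lintegral_smul_measure, smul_eq_mul]

end Quantile

end AdvRobust

namespace AdvRobust

/-! ### Rank weights -/

section Rank

variable {n : ℕ}

/-- The number of entries of `x` that are at most `t`. -/
noncomputable def countLE (x : Fin n → ℝ) (t : ℝ) : ℕ :=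
  open Classical in (Finset.univ.filter fun i => x i ≤ t).card

theorem countLE_le (x : Fin n → ℝ) (t : ℝ) : countLE x t ≤ n := by
  classical
  unfold countLE
  exact (Finset.card_le_univ _).trans (Fintype.card_fin n).le

theorem measurable_countLE : Measurable fun q : (Fin n → ℝ) × ℝ => countLE q.1 q.2 := by
  classical
  have : (fun q : (Fin n → ℝ) × ℝ => countLE q.1 q.2)
      = fun q => ∑ i, if q.1 i ≤ q.2 then 1 else 0 := by
    ext q; unfold countLE; rw [Finset.card_filter]
  rw [this]
  refine Finset.measurable_sum _ fun i _ => Measurable.ite ?_ measurable_const measurable_const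
  exact measurableSet_le (by fun_prop) (by fun_prop)

theorem setIntegral_Icc_indicator_Ici {a b x : ℝ} (hx : x ∈ Set.Icc a b) :
    ∫ t in Set.Icc a b, (Set.Ici x).indicator (fun _ => (1 : ℝ)) t = b - x := by
  rw [integral_indicator measurableSet_Ici, Measure.restrict_restrict measurableSet_Ici]
  have : Set.Ici x ∩ Set.Icc a b = Set.Icc x b := by
    ext t
    simp only [Set.mem_inter_iff, Set.mem_Ici, Set.mem_Icc]
    exact ⟨fun h => ⟨h.1, h.2.2⟩, fun h => ⟨h.1, hx.1.trans h.1, h.2⟩⟩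
  rw [this, integral_const, smul_eq_mul, mul_one, measureReal_restrict_apply_univ,
    Real.volume_real_Icc_of_le hx.2]

theorem integrableOn_indicator_Ici (a b x : ℝ) :
    IntegrableOn (fun t => (Set.Ici x).indicator (fun _ => (1 : ℝ)) t) (Set.Icc a b) :=
  (integrable_const 1).indicator measurableSet_Ici

/-- Layer-cake formula for a rank-weighted mean: b - x is the measure of the levels `t` above `x`,
the sample of rank `k` is below `t` exactly when k is less than `countLE x t`, and the weights of
those ranks telescope to `R` at the empirical cdf. -/
theorem sum_sort_eq {a b : ℝ} (hn : 0 < n) (R : ℝ → ℝ) (hR0 : R 0 = 0) (hR1 : R 1 = 1)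
    (x : Fin n → ℝ) (hx : ∀ i, x i ∈ Set.Icc a b) :
    ∑ k : Fin n, (R ((k + 1 : ℕ) / n) - R ((k : ℕ) / n)) * x (Tuple.sort x k)
      = b - ∫ t in Set.Icc a b, R (countLE x t / n) := by
  classical
  have hn' : (n : ℝ) ≠ 0 := by positivity
  set c : Fin n → ℝ := fun k => R ((k + 1 : ℕ) / n) - R ((k : ℕ) / n) with hc
  have hcsum : ∀ j ≤ n, ∑ k : Fin n, c k * (if (k : ℕ) < j then 1 else 0) = R (j / n) := by
    intro j hj
    rw [Fin.sum_univ_eq_sum_range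
      (fun k => (R ((k + 1 : ℕ) / n) - R ((k : ℕ) / n)) * (if k < j then 1 else 0)) n]
    simp only [mul_ite, mul_one, mul_zero]
    rw [← Finset.sum_filter]
    have : (Finset.range n).filter (fun k => k < j) = Finset.range j := by
      ext k; simp only [Finset.mem_filter, Finset.mem_range]; omega
    rw [this, Finset.sum_range_sub (fun k : ℕ => R ((k : ℕ) / n))]
    simp [hR0]
  have hc1 : ∑ k, c k = 1 := by
    have := hcsum n le_rfl
    rw [div_self hn', hR1] at this
    rw [← this]
    exact Finset.sum_congr rfl fun k _ => by simp [k.isLt]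
  have hmono : Monotone (x ∘ Tuple.sort x) := Tuple.monotone_sort x
  have hcount : ∀ t, (Finset.univ.filter fun k => (x ∘ Tuple.sort x) k ≤ t).card
      = countLE x t := by
    intro t
    unfold countLE
    refine Finset.card_equiv (Tuple.sort x) fun k => ?_
    simp
  have hpt : ∀ t, R (countLE x t / n)
      = ∑ k, c k * (Set.Ici (x (Tuple.sort x k))).indicator (fun _ => (1 : ℝ)) t := by
    intro t
    rw [← hcsum _ (countLE_le x t)]
    refine Finset.sum_congr rfl fun k _ => ?_
    rw [Set.indicator_apply]
    have h := Tuple.lt_card_le_iff_apply_le_of_monotone (j := k) (a := t) hmono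
    have h' : (k : ℕ) < countLE x t ↔ x (Tuple.sort x k) ≤ t := by
      rw [← hcount t]; exact h
    simp only [h', Set.mem_Ici]
  simp_rw [hpt]
  rw [integral_finsetSum _ fun k _ => (integrableOn_indicator_Ici a b _).const_mul _]
  simp_rw [integral_const_mul]
  have : ∀ k, c k * ∫ t in Set.Icc a b,
      (Set.Ici (x (Tuple.sort x k))).indicator (fun _ => (1 : ℝ)) t
        = c k * b - c k * x (Tuple.sort x k) := by
    intro k
    rw [setIntegral_Icc_indicator_Ici (hx _)]; ring
  simp only [this, Finset.sum_sub_distrib, ← Finset.sum_mul, hc1]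
  ring

/-- Only the set of indices with value at most `t` contributes. The product form lets the integral
over independent samples factorize. -/
theorem eq_sum_powerset_countLE (R : ℕ → ℝ) (t : ℝ) (w : Fin n → ℝ) :
    R (countLE w t) = ∑ S ∈ (Finset.univ : Finset (Fin n)).powerset, R S.card *
      ∏ i, (if i ∈ S then (Set.Iic t).indicator (fun _ => (1 : ℝ)) (w i)
        else (Set.Iic t)ᶜ.indicator (fun _ => (1 : ℝ)) (w i)) := by
  classical
  rw [Finset.sum_eq_single (Finset.univ.filter fun i => w i ≤ t)]
  · rw [Finset.prod_eq_one]
    · unfold countLE; rw [mul_one]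
    · intro i _
      by_cases h : w i ≤ t <;> simp [h]
  · intro S _ hS
    have : ∃ i, ¬ (i ∈ S ↔ w i ≤ t) := by
      by_contra hcon
      push Not at hcon
      exact hS (by ext i; simp [hcon i])
    obtain ⟨i, hi⟩ := this
    rw [Finset.prod_eq_zero (Finset.mem_univ i), mul_zero]
    by_cases h1 : i ∈ S <;> by_cases h2 : w i ≤ t <;> simp_all
  · simp

/-- The number of samples below `t` is binomial, and the expectation of a function of a binomial
variable is a Bernstein polynomial in the success probability. -/
theorem integral_countLE (P : Measure ℝ) [IsProbabilityMeasure P] (R : ℝ → ℝ) (t : ℝ) :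
    ∫ w, R (countLE w t / n) ∂(Measure.pi fun _ : Fin n => P)
      = bernsteinOf R n (P.real (Set.Iic t)) := by
  classical
  set p := P.real (Set.Iic t) with hp
  have h1 : ∫ x, (Set.Iic t).indicator (fun _ => (1 : ℝ)) x ∂P = p := by
    rw [integral_indicator measurableSet_Iic, integral_const]; simp [hp]
  have h2 : ∫ x, (Set.Iic t)ᶜ.indicator (fun _ => (1 : ℝ)) x ∂P = 1 - p := by
    rw [integral_indicator measurableSet_Iic.compl, integral_const, hp]
    simp [measureReal_restrict_apply, -Set.compl_Iic, probReal_compl_eq_one_sub measurableSet_Iic]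
  have hint : ∀ (S : Finset (Fin n)) (i : Fin n), Integrable (fun x : ℝ =>
      if i ∈ S then (Set.Iic t).indicator (fun _ => (1 : ℝ)) x
        else (Set.Iic t)ᶜ.indicator (fun _ => (1 : ℝ)) x) P := by
    intro S i
    split_ifs
    · exact (integrable_const 1).indicator measurableSet_Iic
    · exact (integrable_const 1).indicator measurableSet_Iic.compl
  calc ∫ w, R (countLE w t / n) ∂(Measure.pi fun _ : Fin n => P)
      = ∫ w, ∑ S ∈ (Finset.univ : Finset (Fin n)).powerset, R (S.card / n) *
      ∏ i, (if i ∈ S then (Set.Iic t).indicator (fun _ => (1 : ℝ)) (w i)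
        else (Set.Iic t)ᶜ.indicator (fun _ => (1 : ℝ)) (w i)) ∂(Measure.pi fun _ : Fin n => P) :=
        integral_congr_ae (Filter.Eventually.of_forall fun w =>
          eq_sum_powerset_countLE (fun j => R (j / n)) t w)
    _ = ∑ S ∈ (Finset.univ : Finset (Fin n)).powerset, R (S.card / n) *
          (p ^ S.card * (1 - p) ^ (n - S.card)) := by
        rw [integral_finsetSum _ fun S _ => (Integrable.fintype_prod (hint S)).const_mul _]
        refine Finset.sum_congr rfl fun S _ => ?_
        rw [integral_const_mul, integral_fintype_prod_eq_prod (f := fun i x =>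
          if i ∈ S then (Set.Iic t).indicator (fun _ => (1 : ℝ)) x
            else (Set.Iic t)ᶜ.indicator (fun _ => (1 : ℝ)) x)]
        congr 1
        have : ∀ i, ∫ x, (if i ∈ S then (Set.Iic t).indicator (fun _ => (1 : ℝ)) x
            else (Set.Iic t)ᶜ.indicator (fun _ => (1 : ℝ)) x) ∂P
              = if i ∈ S then p else 1 - p := by
          intro i
          split_ifs
          · exact h1
          · exact h2
        simp_rw [this]
        rw [Finset.prod_ite, Finset.prod_const, Finset.prod_const]
        congr 2
        · congr 1; ext i; simp
        · rw [Finset.filter_not, Finset.card_sdiff_of_subset (Finset.filter_subset _ _)]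
          simp
    _ = bernsteinOf R n p := by
        rw [Finset.sum_powerset_apply_card
          (fun j => R (j / n) * (p ^ j * (1 - p) ^ (n - j)))]
        simp only [Finset.card_univ, Fintype.card_fin]
        unfold bernsteinOf bernsteinPolynomial
        refine Finset.sum_congr rfl fun j _ => ?_
        simp only [Polynomial.eval_mul, Polynomial.eval_natCast, Polynomial.eval_pow,
          Polynomial.eval_X, Polynomial.eval_sub, Polynomial.eval_one, nsmul_eq_mul]
        ring

end Rank

theorem integrable_comp_of_mem_Icc {α : Type*} [MeasurableSpace α] {μ : Measure α}
    [IsFiniteMeasure μ] {X : α → ℝ} (hX : AEMeasurable X μ) {a b : ℝ}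
    (hab : ∀ᵐ x ∂μ, X x ∈ Set.Icc a b) {h : ℝ → ℝ} (hh : Continuous h) :
    Integrable (fun x => h (X x)) μ := by
  obtain ⟨C, hC⟩ := isCompact_Icc.exists_bound_of_continuousOn (hh.continuousOn (s := Set.Icc a b))
  refine Integrable.of_bound (hh.measurable.comp_aemeasurable hX).aestronglyMeasurable C ?_
  filter_upwards [hab] with x hx using hC _ hx

end AdvRobust

namespace AdvRobust

/-! ### The bias of the sample average of the discrete problem -/

section Bias

/-- The quantile function, extended by the bounds `a` and `b` to a monotone function on the line. -/
noncomputable def quantileExt (P : Measure ℝ) (a b u : ℝ) : ℝ :=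
  open Classical in if u ≤ 0 then a else if 1 ≤ u then b else invCdf P u

variable {P : Measure ℝ} [IsProbabilityMeasure P] {a b : ℝ}

omit [IsProbabilityMeasure P] in
theorem quantileExt_of_mem {u : ℝ} (hu : u ∈ Set.Ioo (0 : ℝ) 1) :
    quantileExt P a b u = invCdf P u := by
  unfold quantileExt
  rw [if_neg hu.1.not_ge, if_neg hu.2.not_ge]

omit [IsProbabilityMeasure P] in
theorem quantileExt_mem (hle : a ≤ b)
    (hab : ∀ u ∈ Set.Ioo (0 : ℝ) 1, invCdf P u ∈ Set.Icc a b) (u : ℝ) :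
    quantileExt P a b u ∈ Set.Icc a b := by
  unfold quantileExt
  split_ifs with h1 h2
  · exact ⟨le_rfl, hle⟩
  · exact ⟨hle, le_rfl⟩
  · exact hab u ⟨not_le.1 h1, not_le.1 h2⟩

theorem quantileExt_mono (hle : a ≤ b)
    (hab : ∀ u ∈ Set.Ioo (0 : ℝ) 1, invCdf P u ∈ Set.Icc a b) :
    Monotone (quantileExt P a b) := by
  intro u v huv
  have hu := quantileExt_mem hle hab u
  have hv := quantileExt_mem hle hab v
  by_cases h1 : u ≤ 0
  · have : quantileExt P a b u = a := by unfold quantileExt; rw [if_pos h1]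
    rw [this]; exact hv.1
  by_cases h2 : 1 ≤ v
  · have : quantileExt P a b v = b := by
      unfold quantileExt; rw [if_neg (by linarith), if_pos h2]
    rw [this]; exact hu.2
  push Not at h1 h2
  have hu' : u ∈ Set.Ioo (0 : ℝ) 1 := ⟨h1, huv.trans_lt h2⟩
  have hv' : v ∈ Set.Ioo (0 : ℝ) 1 := ⟨h1.trans_le huv, h2⟩
  rw [quantileExt_of_mem hu', quantileExt_of_mem hv']
  exact monotoneOn_invCdf P hu' hv' huv

theorem integral_quantileExt {h : ℝ → ℝ} (hh : Measurable h) :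
    ∫ u in (0 : ℝ)..1, h (quantileExt P a b u) = ∫ x, h x ∂P := by
  rw [intervalIntegral.integral_of_le zero_le_one, integral_Ioc_eq_integral_Ioo,
    setIntegral_congr_fun measurableSet_Ioo
      (fun u hu => by rw [quantileExt_of_mem hu] : Set.EqOn _ (fun u => h (invCdf P u)) _)]
  conv_rhs => rw [← map_invCdf P]
  rw [integral_map (aemeasurable_restrict_of_monotoneOn measurableSet_Ioo (monotoneOn_invCdf P))
    hh.aestronglyMeasurable]

/-- By the Galois connection, the quantile of `u` is at most `t` exactly for `u` up to the cdf at
`t`. -/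
theorem integral_mul_indicator_quantileExt {s : ℝ → ℝ} (t : ℝ) :
    ∫ u in (0 : ℝ)..1, s u * (Set.Ici (quantileExt P a b u)).indicator (fun _ => (1 : ℝ)) t
      = primitive s (P.real (Set.Iic t)) := by
  have h1 : P.real (Set.Iic t) ≤ 1 := measureReal_le_one
  have h0 : 0 ≤ P.real (Set.Iic t) := measureReal_nonneg
  unfold primitive
  rw [intervalIntegral.integral_of_le zero_le_one, intervalIntegral.integral_of_le h0,
    integral_Ioc_eq_integral_Ioo, integral_Ioc_eq_integral_Ioo]
  have e : Set.EqOn (fun u => s u * (Set.Ici (quantileExt P a b u)).indicator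
      (fun _ => (1 : ℝ)) t) ((Set.Iic (P.real (Set.Iic t))).indicator s) (Set.Ioo 0 1) := by
    intro u hu
    dsimp only
    rw [quantileExt_of_mem hu]
    by_cases h : u ≤ P.real (Set.Iic t)
    · rw [Set.indicator_of_mem (s := Set.Iic _) h,
        Set.indicator_of_mem (s := Set.Ici _) ((invCdf_le_iff P hu t).2 h), mul_one]
    · rw [Set.indicator_of_notMem (s := Set.Iic _) h,
        Set.indicator_of_notMem (s := Set.Ici _) fun h' => h ((invCdf_le_iff P hu t).1 h'),
        mul_zero]
  rw [setIntegral_congr_fun measurableSet_Ioo e, setIntegral_indicator measurableSet_Iic]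
  refine setIntegral_congr_set ?_
  have hone : ∀ᵐ u : ℝ ∂volume, u ≠ P.real (Set.Iic t) := by simp [ae_iff]
  filter_upwards [hone] with u hu
  apply propext
  change (u ∈ Set.Ioo (0 : ℝ) 1 ∩ Set.Iic (P.real (Set.Iic t))) ↔
    u ∈ Set.Ioo 0 (P.real (Set.Iic t))
  simp only [Set.mem_inter_iff, Set.mem_Iic, Set.mem_Ioo]
  constructor
  · rintro ⟨⟨h3, -⟩, h5⟩; exact ⟨h3, lt_of_le_of_ne h5 hu⟩
  · rintro ⟨h3, h4⟩; exact ⟨⟨h3, h4.trans_le h1⟩, h4.le⟩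

/-- Layer-cake formula for the mean of the law with density `s` in quantile coordinates. -/
theorem integral_mul_quantileExt (hle : a ≤ b)
    (hab : ∀ u ∈ Set.Ioo (0 : ℝ) 1, invCdf P u ∈ Set.Icc a b) {s : ℝ → ℝ} (hs : Monotone s) :
    ∫ u in (0 : ℝ)..1, s u * quantileExt P a b u
      = b * primitive s 1 - ∫ t in Set.Icc a b, primitive s (P.real (Set.Iic t)) := by
  have hq := quantileExt_mono hle hab
  have hbound : ∀ u ∈ Set.Ioc (0 : ℝ) 1, |s u| ≤ |s 0| + |s 1| := by
    intro u hu
    have h1 := hs hu.1.le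
    have h2 := hs hu.2
    rw [abs_le]
    constructor
    · linarith [neg_abs_le (s 0), abs_nonneg (s 1)]
    · linarith [le_abs_self (s 1), abs_nonneg (s 0)]
  have hpt : ∀ u, s u * quantileExt P a b u = b * s u - ∫ t in Set.Icc a b,
      s u * (Set.Ici (quantileExt P a b u)).indicator (fun _ => (1 : ℝ)) t := by
    intro u
    rw [integral_const_mul, setIntegral_Icc_indicator_Ici (quantileExt_mem hle hab u)]
    ring
  have hjoint : Integrable (Function.uncurry fun u t =>
      s u * (Set.Ici (quantileExt P a b u)).indicator (fun _ => (1 : ℝ)) t)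
      ((volume.restrict (Set.Ioc (0 : ℝ) 1)).prod (volume.restrict (Set.Icc a b))) := by
    have hmeas : Measurable (Function.uncurry fun u t =>
        s u * (Set.Ici (quantileExt P a b u)).indicator (fun _ => (1 : ℝ)) t) := by
      have hset : MeasurableSet {q : ℝ × ℝ | quantileExt P a b q.1 ≤ q.2} :=
        measurableSet_le (hq.measurable.comp measurable_fst) measurable_snd
      have := (hs.measurable.comp measurable_fst).mul
        ((measurable_const (a := (1 : ℝ))).indicator hset)
      convert this using 1
      ext q
      simp [Function.uncurry, Set.indicator_apply]
    refine Integrable.of_bound hmeas.aestronglyMeasurable (|s 0| + |s 1|) ?_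
    have hae : ∀ᵐ q ∂((volume.restrict (Set.Ioc (0 : ℝ) 1)).prod
        (volume.restrict (Set.Icc a b))), q.1 ∈ Set.Ioc (0 : ℝ) 1 :=
      Measure.quasiMeasurePreserving_fst.ae (ae_restrict_mem measurableSet_Ioc)
    filter_upwards [hae] with q hq'
    simp only [Function.uncurry, Set.indicator_apply, mul_ite, mul_one, mul_zero]
    split_ifs
    · exact hbound _ hq'
    · simp; positivity
  simp_rw [hpt]
  rw [intervalIntegral.integral_sub (hs.intervalIntegrable.const_mul b) ?_,
    intervalIntegral.integral_const_mul]
  · congr 1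
    rw [intervalIntegral.integral_of_le zero_le_one, integral_integral_swap hjoint]
    refine setIntegral_congr_fun measurableSet_Icc fun t _ => ?_
    rw [← intervalIntegral.integral_of_le zero_le_one]
    exact integral_mul_indicator_quantileExt t
  · rw [intervalIntegrable_iff_integrableOn_Ioc_of_le zero_le_one]
    exact hjoint.integral_prod_left

theorem integral_cdf_gap_le {G : ℝ≥0} (hG : LipschitzOnWith G (invCdf P) (Set.Ioo 0 1))
    {s : ℝ → ℝ} (hs : Monotone s) (h0 : ∀ u, 0 ≤ s u) (h1 : primitive s 1 = 1)
    {n : ℕ} (hn : 0 < n) :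
    ∫ t in Set.Icc a b, (bernsteinOf (primitive s) n (P.real (Set.Iic t))
      - primitive s (P.real (Set.Iic t))) ≤ G / (n + 1) := by
  set d : ℝ → ℝ := fun p => bernsteinOf (primitive s) n p - primitive s p with hd
  have hdc : Continuous d := (continuous_bernsteinOf _ n).sub (continuous_primitive hs)
  have hd0 : ∀ p ∈ Set.Icc (0 : ℝ) 1, 0 ≤ d p := fun p hp =>
    sub_nonneg.2 (primitive_le_bernsteinOf hs hn hp)
  have hF : Measurable fun x => P.real (Set.Iic x) :=
    Monotone.measurable fun x y hxy => measureReal_mono (Set.Iic_subset_Iic.2 hxy)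
  have hdint : IntegrableOn d (Set.Ioo 0 1) := (hdc.integrableOn_Icc).mono_set Set.Ioo_subset_Icc_self
  have hk := lintegral_cdf_le hG (Set.Icc a b) (h := fun p => ENNReal.ofReal (d p))
    (hdc.measurable.ennreal_ofReal)
    -- Bernstein polynomials interpolate at 0 and 1, so the gap vanishes where the change of
    -- variables needs it.
    (by simp [hd, bernsteinOf_zero]) (by simp [hd, bernsteinOf_one _ hn])
  have hd1 : ∫ p in Set.Ioo (0 : ℝ) 1, d p ≤ 1 / (n + 1) := by
    rw [← integral_Ioc_eq_integral_Ioo, ← intervalIntegral.integral_of_le zero_le_one]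
    exact integral_bernsteinOf_sub_le hs hn h0 h1
  have hfin : ∫⁻ p in Set.Ioo (0 : ℝ) 1, ENNReal.ofReal (d p)
      = ENNReal.ofReal (∫ p in Set.Ioo (0 : ℝ) 1, d p) :=
    (ofReal_integral_eq_lintegral_ofReal hdint ((ae_restrict_iff' measurableSet_Ioo).2
      (Filter.Eventually.of_forall fun p hp => hd0 p (Set.Ioo_subset_Icc_self hp)))).symm
  have hmem : ∀ t, P.real (Set.Iic t) ∈ Set.Icc (0 : ℝ) 1 := fun t =>
    ⟨measureReal_nonneg, measureReal_le_one⟩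
  rw [integral_eq_lintegral_of_nonneg_ae (Filter.Eventually.of_forall fun t => hd0 _ (hmem t))
    (hdc.measurable.comp hF).aestronglyMeasurable]
  have hdi : 0 ≤ ∫ p in Set.Ioo (0 : ℝ) 1, d p :=
    setIntegral_nonneg measurableSet_Ioo fun p hp => hd0 p (Set.Ioo_subset_Icc_self hp)
  rw [hfin] at hk
  refine (ENNReal.toReal_mono (ENNReal.mul_ne_top ENNReal.coe_ne_top ENNReal.ofReal_ne_top)
    hk).trans ?_
  rw [ENNReal.toReal_mul, ENNReal.toReal_ofReal hdi, ENNReal.coe_toReal]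
  calc (G : ℝ) * ∫ p in Set.Ioo (0 : ℝ) 1, d p ≤ G * (1 / (n + 1)) :=
        mul_le_mul_of_nonneg_left hd1 G.2
    _ = G / (n + 1) := by ring

end Bias

/-! ### Lower bound for the expected sampled value -/

section BiasBound

variable {φ : ℝ → ℝ≥0∞} {κ η : ℝ} (hφ : IsDivergence φ κ)
include hφ

theorem IsDivergence.continuous_penalty : Continuous fun y => (φ (optDensity φ y)).toReal := by
  simp only [toReal_optDensity]
  exact (continuous_id.mul hφ.continuous_optDensity).sub hφ.continuous_conj

/-- Jensen's inequality for the penalty of an average of optimal densities. -/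
theorem IsDivergence.penalty_average_le {y : ℝ → ℝ} (hy : Monotone y) {u v : ℝ} (huv : u < v)
    {A : ℝ} (hA : A = (v - u)⁻¹ * ∫ t in u..v, optDensity φ (y t)) :
    φ A ≠ ⊤ ∧ (v - u) * (φ A).toReal ≤ ∫ t in u..v, (φ (optDensity φ (y t))).toReal := by
  have hvu : 0 < v - u := sub_pos.2 huv
  have hmono : Monotone fun t => optDensity φ (y t) := hφ.optDensity_mono.comp hy
  have hint : IntervalIntegrable (fun t => optDensity φ (y t)) volume u v :=
    hmono.intervalIntegrable
  have hlo : optDensity φ (y u) ≤ A := by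
    have := intervalIntegral.integral_mono_on huv.le
      (intervalIntegrable_const (c := optDensity φ (y u))) hint fun x hx => hmono hx.1
    rw [intervalIntegral.integral_const, smul_eq_mul] at this
    rw [hA, le_inv_mul_iff₀ hvu]; exact this
  have hhi : A ≤ optDensity φ (y v) := by
    have := intervalIntegral.integral_mono_on huv.le hint
      (intervalIntegrable_const (c := optDensity φ (y v))) fun x hx => hmono hx.2
    rw [intervalIntegral.integral_const, smul_eq_mul] at this
    rw [hA, inv_mul_le_iff₀ hvu]; exact this
  -- The average lies between two values of the continuous `optDensity`, hence is itself an optimal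
  -- density. Its slope `y₀` is a subgradient of the penalty at `A`, also when A = 0.
  obtain ⟨y₀, -, hy₀⟩ := intermediate_value_Icc (hy huv.le)
    hφ.continuous_optDensity.continuousOn ⟨hlo, hhi⟩
  refine ⟨hy₀ ▸ hφ.finite_optDensity y₀, ?_⟩
  have hpen : IntervalIntegrable (fun t => (φ (optDensity φ (y t))).toReal) volume u v := by
    rw [intervalIntegrable_iff_integrableOn_Ioc_of_le huv.le]
    refine integrable_comp_of_mem_Icc (X := y) (a := y u) (b := y v)
      hy.measurable.aemeasurable ?_ hφ.continuous_penalty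
    filter_upwards [ae_restrict_mem measurableSet_Ioc] with t ht
    exact ⟨hy ht.1.le, hy ht.2⟩
  have hle := intervalIntegral.integral_mono_on huv.le
    (f := fun t => (φ A).toReal + y₀ * (optDensity φ (y t) - A))
    (g := fun t => (φ (optDensity φ (y t))).toReal)
    (intervalIntegrable_const.add ((hint.sub intervalIntegrable_const).const_mul y₀)) hpen
    fun t _ => by
      have h1 := hφ.fenchel y₀ (hφ.finite_optDensity (y t))
      have h2 := toReal_optDensity (φ := φ) y₀
      rw [hy₀] at h2
      linarith
  refine le_trans (le_of_eq ?_) hle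
  have hcancel : ∫ t in u..v, optDensity φ (y t) = (v - u) * A := by
    rw [hA, mul_inv_cancel_left₀ hvu.ne']
  rw [intervalIntegral.integral_add intervalIntegrable_const
      ((hint.sub intervalIntegrable_const).const_mul y₀), intervalIntegral.integral_const_mul,
    intervalIntegral.integral_sub hint intervalIntegrable_const, hcancel]
  simp only [intervalIntegral.integral_const, smul_eq_mul]
  ring

variable (hη : 0 < η) {P : Measure ℝ} [IsProbabilityMeasure P]
include hη

/-- The optimal value of the discrete problem on `n` i.i.d. samples underestimates the optimal
value of the population problem by at most `G / (n + 1)`. -/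
theorem IsDivergence.sub_le_integral_dualValue {G : ℝ≥0}
    (hG : LipschitzOnWith G (invCdf P) (Set.Ioo 0 1)) {μ : ℝ}
    (hμ : ∫ x, optDensity φ ((x - μ) / η) ∂P = 1) {n : ℕ} (hn : 0 < n) :
    μ + η * ∫ x, conj φ ((x - μ) / η) ∂P - G / (n + 1)
      ≤ ∫ w, dualValue φ η w ∂(Measure.pi fun _ : Fin n => P) := by
  have hn' : (0 : ℝ) < n := by exact_mod_cast hn
  obtain ⟨a, b, hle, -, hab⟩ := exists_quantile_bounds hG
  have hae := ae_mem_Icc_of_invCdf hab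
  have hq := quantileExt_mono hle hab
  set y : ℝ → ℝ := fun u => (quantileExt P a b u - μ) / η with hy
  have hym : Monotone y := fun u v huv =>
    div_le_div_of_nonneg_right (by linarith [hq huv]) hη.le
  set s : ℝ → ℝ := fun u => optDensity φ (y u) with hs
  have hsm : Monotone s := hφ.optDensity_mono.comp hym
  have hs0 : ∀ u, 0 ≤ s u := fun u => hφ.optDensity_nonneg _
  set R := primitive s with hR
  have hR0 : R 0 = 0 := by simp [hR, primitive]
  have hco := hφ.continuous_optDensity
  have hcc := hφ.continuous_conj
  have hcp' : Continuous fun x => (φ (optDensity φ ((x - μ) / η))).toReal :=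
    hφ.continuous_penalty.comp (by fun_prop : Continuous fun x : ℝ => (x - μ) / η)
  have hR1 : R 1 = 1 := by
    have := integral_quantileExt (P := P) (a := a) (b := b)
      (h := fun x => optDensity φ ((x - μ) / η)) (by fun_prop)
    rw [hμ] at this
    exact this
  have hRm : Monotone R := primitive_mono hsm hs0
  have hRc : Continuous R := continuous_primitive hsm
  -- the value of the population problem in primal form
  have hpop : μ + η * ∫ x, conj φ ((x - μ) / η) ∂P
      = (∫ u in (0 : ℝ)..1, s u * quantileExt P a b u)
        - η * ∫ u in (0 : ℝ)..1, (φ (s u)).toReal := by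
    have e1 := integral_quantileExt (P := P) (a := a) (b := b)
      (h := fun x => optDensity φ ((x - μ) / η) * x) (by fun_prop)
    have e2 := integral_quantileExt (P := P) (a := a) (b := b)
      (h := fun x => (φ (optDensity φ ((x - μ) / η))).toReal) hcp'.measurable
    simp only [hs, hy]
    rw [e1, e2]
    have hi : ∀ h : ℝ → ℝ, Continuous h → Integrable h P := fun h hh =>
      integrable_comp_of_mem_Icc (X := id) aemeasurable_id hae hh
    have : ∀ x, conj φ ((x - μ) / η) = (1 / η) * (optDensity φ ((x - μ) / η) * x)
        - (μ / η) * optDensity φ ((x - μ) / η) - (φ (optDensity φ ((x - μ) / η))).toReal := by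
      intro x
      rw [toReal_optDensity]
      field_simp
      ring
    simp_rw [this]
    have i1 : Integrable (fun x => (1 / η) * (optDensity φ ((x - μ) / η) * x)) P :=
      (hi _ (by fun_prop)).const_mul _
    have i2 : Integrable (fun x => (μ / η) * optDensity φ ((x - μ) / η)) P :=
      (hi _ (by fun_prop)).const_mul _
    have i12 : Integrable (fun x => (1 / η) * (optDensity φ ((x - μ) / η) * x)
        - (μ / η) * optDensity φ ((x - μ) / η)) P := i1.sub i2
    rw [integral_sub i12 (hi _ hcp'), integral_sub i1 i2, integral_const_mul,
      integral_const_mul, hμ]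
    field_simp
    ring
  -- the rank weights
  set c : Fin n → ℝ := fun k => R ((k + 1 : ℕ) / n) - R ((k : ℕ) / n) with hc
  have hstep : ∀ k : ℕ, ((k : ℕ) / n : ℝ) < ((k + 1 : ℕ) / n : ℝ) := fun k => by
    gcongr; exact_mod_cast Nat.lt_succ_self k
  have hdiff : ∀ k : ℕ, ((k + 1 : ℕ) / n : ℝ) - ((k : ℕ) / n : ℝ) = 1 / n := fun k => by
    push_cast; field_simp; ring
  -- The rescaled rank weight n c_k is the average of the optimal density over the k-th quantile
  -- cell, so Jensen's inequality applies cell by cell.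
  have hJ : ∀ k : ℕ, φ (n * (R ((k + 1 : ℕ) / n) - R ((k : ℕ) / n))) ≠ ⊤ ∧
      1 / n * (φ (n * (R ((k + 1 : ℕ) / n) - R ((k : ℕ) / n)))).toReal
        ≤ ∫ u in ((k : ℕ) / n : ℝ)..((k + 1 : ℕ) / n : ℝ), (φ (s u)).toReal := by
    intro k
    have := hφ.penalty_average_le hym (hstep k)
      (A := n * (R ((k + 1 : ℕ) / n) - R ((k : ℕ) / n))) (by
        rw [hdiff, hR, primitive_sub hsm]; simp [hs])
    rwa [hdiff] at this
  have hpen : 1 / n * ∑ k : Fin n, (φ (n * c k)).toReal ≤ ∫ u in (0 : ℝ)..1, (φ (s u)).toReal := by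
    have hint : ∀ u v : ℝ, IntervalIntegrable (fun t => (φ (s t)).toReal) volume u v := by
      intro u v
      rw [intervalIntegrable_iff, Set.uIoc]
      refine integrable_comp_of_mem_Icc (X := y) (a := y (min u v)) (b := y (max u v))
        hym.measurable.aemeasurable ?_ hφ.continuous_penalty
      filter_upwards [ae_restrict_mem measurableSet_Ioc] with t ht
      exact ⟨hym ht.1.le, hym ht.2⟩
    have hsum := intervalIntegral.sum_integral_adjacent_intervals
      (f := fun t => (φ (s t)).toReal) (μ := volume)
      (a := fun j : ℕ => (j / n : ℝ)) (n := n) fun k _ => hint _ _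
    simp only [Nat.cast_zero, zero_div, div_self hn'.ne'] at hsum
    rw [← hsum, Finset.mul_sum, ← Fin.sum_univ_eq_sum_range (fun k : ℕ =>
      ∫ u in ((k : ℕ) / n : ℝ)..((k + 1 : ℕ) / n : ℝ), (φ (s u)).toReal)]
    exact Finset.sum_le_sum fun k _ => (hJ k).2
  have hcsum : ∑ k, c k = 1 := by
    rw [hc, Fin.sum_univ_eq_sum_range (fun k : ℕ => R ((k + 1 : ℕ) / n) - R ((k : ℕ) / n)),
      Finset.sum_range_sub (fun k : ℕ => R ((k : ℕ) / n)), div_self hn'.ne', hR1]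
    simp [hR0]
  -- the pointwise lower bound
  have hpt : ∀ w : Fin n → ℝ, (∀ i, w i ∈ Set.Icc a b) →
      b - (∫ t in Set.Icc a b, R (countLE w t / n)) - η * (∫ u in (0 : ℝ)..1, (φ (s u)).toReal)
        ≤ dualValue φ η w := by
    intro w hw
    rw [← sum_sort_eq hn R hR0 hR1 w hw]
    set σ := Tuple.sort w
    -- The rank weights, carried back to the original order of the samples, form a feasible
    -- competitor.
    have h1 := hφ.primal_le_dualValue hη w (fun i => c (σ.symm i)) hn
      (by rw [Equiv.sum_comp σ.symm c]; exact hcsum) (fun i => (hJ _).1)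
    rw [Equiv.sum_comp σ.symm (fun k => (φ (n * c k)).toReal),
      ← Equiv.sum_comp σ (fun i => c (σ.symm i) * w i)] at h1
    simp only [Equiv.symm_apply_apply] at h1
    have h2 := mul_le_mul_of_nonneg_left hpen hη.le
    have h3 : η * (1 / n * ∑ k, (φ (n * c k)).toReal) = η / n * ∑ k, (φ (n * c k)).toReal := by
      ring
    linarith
  -- integration
  have hwae : ∀ᵐ w ∂(Measure.pi fun _ : Fin n => P), ∀ i, w i ∈ Set.Icc a b :=
    ae_all_iff.2 fun i => (Measure.quasiMeasurePreserving_eval (fun _ : Fin n => P) i).ae hae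
  have hjoint : Integrable (Function.uncurry fun (w : Fin n → ℝ) t => R (countLE w t / n))
      ((Measure.pi fun _ : Fin n => P).prod (volume.restrict (Set.Icc a b))) := by
    have hm : Measurable (Function.uncurry fun (w : Fin n → ℝ) t => R (countLE w t / n)) := by
      have h2 : Measurable fun q : (Fin n → ℝ) × ℝ => (countLE q.1 q.2 : ℝ) :=
        measurable_from_top.comp measurable_countLE
      exact hRc.measurable.comp (h2.div_const _)
    refine Integrable.of_bound hm.aestronglyMeasurable 1 (Filter.Eventually.of_forall fun q => ?_)
    have h0 : 0 ≤ R (countLE q.1 q.2 / n) := by rw [← hR0]; exact hRm (by positivity)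
    have h1 : R (countLE q.1 q.2 / n) ≤ 1 := by
      rw [← hR1]
      refine hRm ((div_le_one hn').2 ?_)
      exact_mod_cast countLE_le q.1 q.2
    simpa [Function.uncurry, abs_of_nonneg h0] using h1
  have hinner : Integrable (fun w : Fin n → ℝ => ∫ t in Set.Icc a b, R (countLE w t / n))
      (Measure.pi fun _ : Fin n => P) := hjoint.integral_prod_left
  have hbern : ∫ w, (∫ t in Set.Icc a b, R (countLE w t / n)) ∂(Measure.pi fun _ : Fin n => P)
      = ∫ t in Set.Icc a b, bernsteinOf R n (P.real (Set.Iic t)) := by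
    rw [integral_integral_swap hjoint]
    exact integral_congr_ae (Filter.Eventually.of_forall fun t => integral_countLE P R t)
  have hval : Integrable (fun w => dualValue φ η w) (Measure.pi fun _ : Fin n => P) := by
    refine Integrable.of_bound (hφ.continuous_dualValue hη hn).aestronglyMeasurable
      (max |a| |b|) ?_
    filter_upwards [hwae] with w hw
    exact abs_le_max_abs_abs (hφ.le_dualValue hη w hn fun i => (hw i).1)
      (hφ.dualValue_le_of_le hη w hn fun i => (hw i).2)
  have hinner' : Integrable (fun w : Fin n → ℝ => b - ∫ t in Set.Icc a b, R (countLE w t / n))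
      (Measure.pi fun _ : Fin n => P) := (integrable_const b).sub hinner
  have hmono := integral_mono_ae (hinner'.sub
    (integrable_const (η * ∫ u in (0 : ℝ)..1, (φ (s u)).toReal))) hval
    (hwae.mono fun w hw => hpt w hw)
  simp only [Pi.sub_apply] at hmono
  rw [integral_sub hinner' (integrable_const _),
    integral_sub (integrable_const b) hinner] at hmono
  simp only [hbern, integral_const, probReal_univ, one_smul] at hmono
  have hgap := integral_cdf_gap_le (a := a) (b := b) hG hsm hs0 hR1 hn
  have hF : Measurable fun x => P.real (Set.Iic x) :=
    Monotone.measurable fun x y hxy => measureReal_mono (Set.Iic_subset_Iic.2 hxy)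
  have hbd : ∀ h : ℝ → ℝ, Continuous h →
      Integrable (fun t => h (P.real (Set.Iic t))) (volume.restrict (Set.Icc a b)) := fun h hh =>
    integrable_comp_of_mem_Icc hF.aemeasurable (a := 0) (b := 1)
      (Filter.Eventually.of_forall fun t => ⟨measureReal_nonneg, measureReal_le_one⟩) hh
  rw [integral_sub (hbd _ (continuous_bernsteinOf _ n)) (hbd _ hRc)] at hgap
  have hlay := integral_mul_quantileExt hle hab hsm
  rw [← hR, hR1, mul_one] at hlay
  rw [hpop, hlay]
  linarith

end BiasBound

end AdvRobust

namespace AdvRobust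

/-! ### The population problem -/

section Population

variable {φ : ℝ → ℝ≥0∞} {κ η : ℝ} {E : Type*} [MeasurableSpace E]

/-- The attainable values of the penalized problem over `γ ≪ ν`. -/
def robustSet (φ : ℝ → ℝ≥0∞) (η : ℝ) (ν : Measure E) (f : E → ℝ) : Set ℝ :=
  {v : ℝ | ∃ γ : Measure E, IsProbabilityMeasure γ ∧ γ ≪ ν ∧ Integrable f γ ∧
    (∫⁻ x, φ ((γ.rnDeriv ν x).toReal) ∂ν) ≠ ⊤ ∧
    v = (∫ x, f x ∂γ) - η * (∫⁻ x, φ ((γ.rnDeriv ν x).toReal) ∂ν).toReal}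

/-- The optimal value of the penalized problem over `γ ≪ ν`. -/
noncomputable def robustValue (φ : ℝ → ℝ≥0∞) (η : ℝ) (ν : Measure E) (f : E → ℝ) : ℝ :=
  sSup (robustSet φ η ν f)

/-- The dual function of the population problem. -/
noncomputable def popDual (φ : ℝ → ℝ≥0∞) (η : ℝ) (ν : Measure E) (f : E → ℝ) (μ : ℝ) : ℝ :=
  μ + η * ∫ x, conj φ ((f x - μ) / η) ∂ν

variable (hφ : IsDivergence φ κ) (hη : 0 < η) {ν : Measure E} [IsProbabilityMeasure ν]
  {f : E → ℝ} (hf : Measurable f) {a b : ℝ} (hab : ∀ᵐ x ∂ν, f x ∈ Set.Icc a b)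

namespace IsDivergence

include hφ hη hf hab

/-- The total mass is Lipschitz in the multiplier, at least 1 at `a` and at most 1 at `b`. -/
theorem exists_popRoot (hle : a ≤ b) :
    ∃ μ ∈ Set.Icc a b, ∫ x, optDensity φ ((f x - μ) / η) ∂ν = 1 := by
  have hco := hφ.continuous_optDensity
  have hint : ∀ μ, Integrable (fun x => optDensity φ ((f x - μ) / η)) ν := fun μ =>
    integrable_comp_of_mem_Icc hf.aemeasurable hab (h := fun y => optDensity φ ((y - μ) / η))
      (by fun_prop)
  have hk := hφ.modulus_pos
  have hc : Continuous fun μ => (∫ x, optDensity φ ((f x - μ) / η) ∂ν) - 1 := by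
    refine (LipschitzWith.of_dist_le_mul (K := (1 / (η * κ)).toNNReal) fun μ μ' => ?_).continuous
    rw [Real.dist_eq, Real.dist_eq, Real.coe_toNNReal _ (by positivity), sub_sub_sub_cancel_right,
      ← integral_sub (hint μ) (hint μ')]
    have := norm_integral_le_of_norm_le_const (μ := ν)
      (f := fun x => optDensity φ ((f x - μ) / η) - optDensity φ ((f x - μ') / η))
      (Filter.Eventually.of_forall fun x => hφ.abs_optDensity_shift_le hη (f x) μ μ')
    rw [probReal_univ, mul_one, Real.norm_eq_abs] at this
    refine this.trans (le_of_eq ?_)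
    ring
  have h1 : ∀ c : ℝ, ∫ _x : E, c ∂ν = c := fun c => by simp
  obtain ⟨μ, hμ, h⟩ := exists_zero_of_continuous hc hle
    (by
      rw [sub_nonneg, ← h1 1]
      refine integral_mono_ae (integrable_const _) (hint a) ?_
      filter_upwards [hab] with x hx
      rw [← hφ.optDensity_zero]
      exact hφ.optDensity_mono (div_nonneg (sub_nonneg.2 hx.1) hη.le))
    (by
      rw [sub_nonpos, ← h1 1]
      refine integral_mono_ae (hint b) (integrable_const _) ?_
      filter_upwards [hab] with x hx
      rw [← hφ.optDensity_zero]
      exact hφ.optDensity_mono (div_nonpos_of_nonpos_of_nonneg (sub_nonpos.2 hx.2) hη.le))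
  exact ⟨μ, hμ, by linarith⟩

/-- Weak duality: Fenchel's inequality for the density at each point, integrated; the density has
integral 1. -/
theorem le_popDual {v : ℝ} (hv : v ∈ robustSet φ η ν f) (μ : ℝ) : v ≤ popDual φ η ν f μ := by
  obtain ⟨γ, hγ, hac, hint, hfin, rfl⟩ := hv
  set ρ : E → ℝ := fun x => (γ.rnDeriv ν x).toReal with hρ
  have hρm : Measurable ρ := (Measure.measurable_rnDeriv γ ν).ennreal_toReal
  have hφm : Measurable fun x => φ (ρ x) := hφ.measurable.comp hρm
  have hlt : ∀ᵐ x ∂ν, φ (ρ x) < ⊤ := ae_lt_top hφm hfin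
  have e1 : ∫ x, ρ x ∂ν = 1 := by
    rw [hρ, Measure.integral_toReal_rnDeriv hac, probReal_univ]
  have i1 : Integrable ρ ν := Measure.integrable_toReal_rnDeriv
  have e2 : ∫ x, f x ∂γ = ∫ x, ρ x * f x ∂ν := (integral_rnDeriv_smul hac).symm
  have i2 : Integrable (fun x => ρ x * f x) ν := (integrable_rnDeriv_smul_iff hac).2 hint
  have e3 : (∫⁻ x, φ (ρ x) ∂ν).toReal = ∫ x, (φ (ρ x)).toReal ∂ν :=
    (integral_toReal hφm.aemeasurable hlt).symm
  have i3 : Integrable (fun x => (φ (ρ x)).toReal) ν :=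
    integrable_toReal_of_lintegral_ne_top hφm.aemeasurable hfin
  have hcc := hφ.continuous_conj
  have i4 : Integrable (fun x => conj φ ((f x - μ) / η)) ν :=
    integrable_comp_of_mem_Icc hf.aemeasurable hab (h := fun y => conj φ ((y - μ) / η))
      (by fun_prop)
  have i5 : Integrable (fun x => ρ x * f x - μ * ρ x) ν := i2.sub (i1.const_mul μ)
  have i6 : Integrable (fun x => ρ x * f x - μ * ρ x - η * (φ (ρ x)).toReal) ν :=
    i5.sub (i3.const_mul η)
  have hmono := integral_mono_ae i6 (i4.const_mul η) (by
    filter_upwards [hlt] with x hx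
    have := mul_le_mul_of_nonneg_left (hφ.fenchel ((f x - μ) / η) hx.ne) hη.le
    refine le_trans (le_of_eq ?_) this
    field_simp)
  rw [integral_sub i5 (i3.const_mul η), integral_sub i2 (i1.const_mul μ), integral_const_mul,
    integral_const_mul, integral_const_mul, e1] at hmono
  unfold popDual
  rw [e2, e3]
  linarith

theorem bddAbove_robustSet : BddAbove (robustSet φ η ν f) :=
  ⟨_, fun _ hv => hφ.le_popDual hη hf hab hv 0⟩

/-- The population problem has a maximizer, given by the optimal densities at the dual root. -/
theorem exists_robust_maximizer {μ : ℝ} (hμ : ∫ x, optDensity φ ((f x - μ) / η) ∂ν = 1) :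
    robustValue φ η ν f = popDual φ η ν f μ ∧
    ∃ γ : Measure E, IsProbabilityMeasure γ ∧ γ ≪ ν ∧ ∃ c : ℝ,
      robustValue φ η ν f = ∫ x, f x ∂γ - c ∧
      ∀ f' : E → ℝ, Measurable f' → ∀ a' b' : ℝ, (∀ᵐ x ∂ν, f' x ∈ Set.Icc a' b') →
        ∫ x, f' x ∂γ - c ≤ robustValue φ η ν f' := by
  have hco := hφ.continuous_optDensity
  have hcc := hφ.continuous_conj
  set r : E → ℝ := fun x => optDensity φ ((f x - μ) / η) with hr
  have hrm : Measurable r := (hco.measurable.comp ((hf.sub_const μ).div_const η))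
  have hr0 : ∀ x, 0 ≤ r x := fun x => hφ.optDensity_nonneg _
  have hbd : ∀ h : ℝ → ℝ, Continuous h → Integrable (fun x => h (f x)) ν := fun h hh =>
    integrable_comp_of_mem_Icc hf.aemeasurable hab hh
  have hri : Integrable r ν := hbd (fun y => optDensity φ ((y - μ) / η)) (by fun_prop)
  set γ := ν.withDensity (fun x => ENNReal.ofReal (r x)) with hγ
  have hprob : IsProbabilityMeasure γ := by
    refine ⟨?_⟩
    rw [hγ, withDensity_apply _ MeasurableSet.univ, Measure.restrict_univ,
      ← ofReal_integral_eq_lintegral_ofReal hri (Filter.Eventually.of_forall hr0), hμ,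
      ENNReal.ofReal_one]
  have hac : γ ≪ ν := withDensity_absolutelyContinuous _ _
  have hrn : ∀ᵐ x ∂ν, (γ.rnDeriv ν x).toReal = r x := by
    filter_upwards [Measure.rnDeriv_withDensity ν hrm.ennreal_ofReal] with x hx
    rw [hx, ENNReal.toReal_ofReal (hr0 x)]
  have hcp' : Continuous fun x => (φ (optDensity φ ((x - μ) / η))).toReal :=
    hφ.continuous_penalty.comp (by fun_prop : Continuous fun x : ℝ => (x - μ) / η)
  have hpi : Integrable (fun x => (φ (r x)).toReal) ν := hbd _ hcp'
  have hlint : ∫⁻ x, φ ((γ.rnDeriv ν x).toReal) ∂ν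
      = ENNReal.ofReal (∫ x, (φ (r x)).toReal ∂ν) := by
    rw [ofReal_integral_eq_lintegral_ofReal hpi
      (Filter.Eventually.of_forall fun _ => ENNReal.toReal_nonneg)]
    refine lintegral_congr_ae ?_
    filter_upwards [hrn] with x hx
    rw [hx, ENNReal.ofReal_toReal (hφ.finite_optDensity _)]
  -- The maximizer for `f` stays admissible, with the same penalty, for every other essentially
  -- bounded loss. This yields an affine minorant of the value that is exact at `f`.
  have hmem : ∀ f' : E → ℝ, Measurable f' → ∀ a' b' : ℝ, (∀ᵐ x ∂ν, f' x ∈ Set.Icc a' b') →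
      ∫ x, f' x ∂γ - η * ∫ x, (φ (r x)).toReal ∂ν ∈ robustSet φ η ν f' := by
    intro f' hf' a' b' hab'
    refine ⟨γ, hprob, hac, ?_, ?_, ?_⟩
    · exact integrable_comp_of_mem_Icc (X := f') hf'.aemeasurable (hac.ae_le hab') continuous_id
    · rw [hlint]; exact ENNReal.ofReal_ne_top
    · rw [hlint, ENNReal.toReal_ofReal (integral_nonneg fun _ => ENNReal.toReal_nonneg)]
  have hval : ∫ x, f x ∂γ - η * ∫ x, (φ (r x)).toReal ∂ν = popDual φ η ν f μ := by
    have i2 : Integrable (fun x => r x * f x) ν :=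
      hbd (fun y => optDensity φ ((y - μ) / η) * y) (by fun_prop)
    have i4 : Integrable (fun x => conj φ ((f x - μ) / η)) ν :=
      hbd (fun y => conj φ ((y - μ) / η)) (by fun_prop)
    have e2 : ∫ x, f x ∂γ = ∫ x, r x * f x ∂ν := by
      rw [hγ, integral_withDensity_eq_integral_toReal_smul hrm.ennreal_ofReal
        (Filter.Eventually.of_forall fun _ => ENNReal.ofReal_lt_top)]
      refine integral_congr_ae (Filter.Eventually.of_forall fun x => ?_)
      simp only [smul_eq_mul]
      rw [ENNReal.toReal_ofReal (hr0 x)]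
    have : ∀ x, (φ (r x)).toReal = (1 / η) * (r x * f x) - (μ / η) * r x
        - conj φ ((f x - μ) / η) := by
      intro x
      rw [hr, toReal_optDensity]
      field_simp
    have i5 : Integrable (fun x => (1 / η) * (r x * f x) - (μ / η) * r x) ν :=
      (i2.const_mul _).sub (hri.const_mul _)
    rw [e2]
    simp_rw [this]
    rw [integral_sub i5 i4, integral_sub (i2.const_mul _) (hri.const_mul _), integral_const_mul,
      integral_const_mul, hμ]
    unfold popDual
    field_simp
    ring
  have hsup : robustValue φ η ν f = popDual φ η ν f μ := by
    refine le_antisymm (csSup_le ⟨_, hmem f hf a b hab⟩ fun v hv =>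
      hφ.le_popDual hη hf hab hv μ) ?_
    rw [← hval]
    exact le_csSup (hφ.bddAbove_robustSet hη hf hab) (hmem f hf a b hab)
  exact ⟨hsup, γ, hprob, hac, _, hsup.trans hval.symm, fun f' hf' a' b' hab' =>
    le_csSup (hφ.bddAbove_robustSet hη hf' hab') (hmem f' hf' a' b' hab')⟩

/-- The expected optimal value of the discrete problem is at most the population value. -/
theorem integral_dualValue_le {μ : ℝ} (hμ : ∫ x, optDensity φ ((f x - μ) / η) ∂ν = 1)
    {m : ℕ} (hm : 0 < m) :
    Integrable (fun w : Fin m → E => dualValue φ η (fun i => f (w i)))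
      (Measure.pi fun _ : Fin m => ν) ∧
    ∫ w, dualValue φ η (fun i => f (w i)) ∂(Measure.pi fun _ : Fin m => ν)
      ≤ robustValue φ η ν f := by
  have hm' : (0 : ℝ) < m := by exact_mod_cast hm
  have hcc := hφ.continuous_conj
  have hfm : Measurable fun (w : Fin m → E) i => f (w i) := by fun_prop
  have hwae : ∀ᵐ w ∂(Measure.pi fun _ : Fin m => ν), ∀ i, f (w i) ∈ Set.Icc a b :=
    ae_all_iff.2 fun i => (Measure.quasiMeasurePreserving_eval (fun _ : Fin m => ν) i).ae hab
  have hval : Integrable (fun w : Fin m → E => dualValue φ η (fun i => f (w i)))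
      (Measure.pi fun _ : Fin m => ν) := by
    refine Integrable.of_bound
      ((hφ.continuous_dualValue hη hm).measurable.comp hfm).aestronglyMeasurable
      (max |a| |b|) ?_
    filter_upwards [hwae] with w hw
    exact abs_le_max_abs_abs (hφ.le_dualValue hη _ hm fun i => (hw i).1)
      (hφ.dualValue_le_of_le hη _ hm fun i => (hw i).2)
  refine ⟨hval, ?_⟩
  rw [(hφ.exists_robust_maximizer hη hf hab hμ).1]
  have ic : Integrable (fun x => conj φ ((f x - μ) / η)) ν :=
    integrable_comp_of_mem_Icc hf.aemeasurable hab (h := fun y => conj φ ((y - μ) / η))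
      (by fun_prop)
  have hi : ∀ i : Fin m, Integrable (fun w : Fin m → E => conj φ ((f (w i) - μ) / η))
      (Measure.pi fun _ : Fin m => ν) := fun i => integrable_comp_eval (X := fun _ : Fin m => E)
      (μ := fun _ => ν) (i := i) (f := fun x => conj φ ((f x - μ) / η)) ic
  have hd : Integrable (fun w : Fin m → E => dualObj φ η (fun i => f (w i)) μ)
      (Measure.pi fun _ : Fin m => ν) :=
    (integrable_const μ).add ((integrable_finsetSum _ fun i _ => hi i).const_mul _)
  refine (integral_mono hval hd fun w => hφ.dualValue_le hη _ hm μ).trans (le_of_eq ?_)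
  unfold dualObj popDual
  rw [integral_add (integrable_const μ) ((integrable_finsetSum _ fun i _ => hi i).const_mul _),
    integral_const_mul, integral_finsetSum _ fun i _ => hi i]
  have : ∀ i : Fin m, ∫ w : Fin m → E, conj φ ((f (w i) - μ) / η)
      ∂(Measure.pi fun _ : Fin m => ν) = ∫ x, conj φ ((f x - μ) / η) ∂ν := fun i =>
    integral_comp_eval (X := fun _ : Fin m => E) (μ := fun _ => ν) (i := i)
      (f := fun x => conj φ ((f x - μ) / η)) ic.aestronglyMeasurable
  simp only [this, integral_const, probReal_univ, Finset.sum_const, Finset.card_univ,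
    Fintype.card_fin, nsmul_eq_mul, one_smul]
  field_simp

-- Only the law of the loss matters, so the bound on the line transfers by pushing forward along
-- `f`.
omit hab in
theorem robustValue_sub_le {G : ℝ≥0} (hG : LipschitzOnWith G (invCdf (ν.map f)) (Set.Ioo 0 1))
    {m : ℕ} (hm : 0 < m) :
    robustValue φ η ν f - G / (m + 1)
      ≤ ∫ w, dualValue φ η (fun i => f (w i)) ∂(Measure.pi fun _ : Fin m => ν) := by
  have : IsProbabilityMeasure (ν.map f) := Measure.isProbabilityMeasure_map hf.aemeasurable
  obtain ⟨a, b, hle, -, hq⟩ := exists_quantile_bounds hG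
  have hab : ∀ᵐ x ∂ν, f x ∈ Set.Icc a b :=
    ae_of_ae_map hf.aemeasurable (ae_mem_Icc_of_invCdf hq)
  obtain ⟨μ, -, hμ⟩ := hφ.exists_popRoot hη hf hab hle
  rw [(hφ.exists_robust_maximizer hη hf hab hμ).1]
  have hco := hφ.continuous_optDensity
  have hcc := hφ.continuous_conj
  have h1 : Continuous fun y => optDensity φ ((y - μ) / η) := by fun_prop
  have h2 : Continuous fun y => conj φ ((y - μ) / η) := by fun_prop
  have hb := hφ.sub_le_integral_dualValue hη hG (μ := μ) (by
    rw [integral_map hf.aemeasurable h1.aestronglyMeasurable]; exact hμ) hm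
  have hfm : Measurable fun (w : Fin m → E) i => f (w i) := by fun_prop
  rw [integral_map hf.aemeasurable h2.aestronglyMeasurable,
    ← Measure.pi_map_pi (fun _ => hf.aemeasurable),
    integral_map hfm.aemeasurable (hφ.continuous_dualValue hη hm).aestronglyMeasurable] at hb
  exact hb

end IsDivergence

end Population

end AdvRobust

namespace AdvRobust

/-! ### Projections onto closed convex sets -/

section Projection

variable {n : ℕ} {Θ : Set (Param n)} (hc : IsClosed Θ) (hv : Convex ℝ Θ) (hne : Θ.Nonempty)
include hc hv hne

theorem projOnto_spec (x : Param n) :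
    projOnto Θ x ∈ Θ ∧ ∀ w ∈ Θ, inner ℝ (x - projOnto Θ x) (w - projOnto Θ x) ≤ 0 := by
  obtain ⟨y, hy, hmin⟩ := exists_norm_eq_iInf_of_complete_convex hne hc.isComplete hv x
  have hbdd : BddBelow (Set.range fun w : Θ => ‖x - w‖) :=
    ⟨0, by rintro _ ⟨w, rfl⟩; exact norm_nonneg _⟩
  have hex : ∃ y, y ∈ Θ ∧ ∀ w ∈ Θ, ‖x - y‖ ≤ ‖x - w‖ :=
    ⟨y, hy, fun w hw => hmin ▸ ciInf_le hbdd ⟨w, hw⟩⟩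
  have hp : projOnto Θ x ∈ Θ ∧ ∀ w ∈ Θ, ‖x - projOnto Θ x‖ ≤ ‖x - w‖ :=
    Classical.epsilon_spec hex
  refine ⟨hp.1, (norm_eq_iInf_iff_real_inner_le_zero hv hp.1).1 ?_⟩
  have : Nonempty Θ := ⟨⟨_, hp.1⟩⟩
  exact le_antisymm (le_ciInf fun w => hp.2 w w.2) (ciInf_le hbdd ⟨_, hp.1⟩)

/-- Add the variational inequalities of the two projections, each tested with the other, and apply
Cauchy–Schwarz. -/
theorem norm_projOnto_sub_le (x y : Param n) : ‖projOnto Θ x - projOnto Θ y‖ ≤ ‖x - y‖ := by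
  obtain ⟨hx, hx'⟩ := projOnto_spec hc hv hne x
  obtain ⟨hy, hy'⟩ := projOnto_spec hc hv hne y
  have h1 := hx' _ hy
  have h2 := hy' _ hx
  set p := projOnto Θ x
  set q := projOnto Θ y
  have h3 : inner ℝ (x - y) (p - q) = inner ℝ (p - q) (p - q) - inner ℝ (x - p) (q - p)
      - inner ℝ (y - q) (p - q) := by
    simp only [inner_sub_left, inner_sub_right]; ring
  have h4 : ‖p - q‖ * ‖p - q‖ ≤ ‖x - y‖ * ‖p - q‖ := by
    rw [← real_inner_self_eq_norm_mul_norm]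
    exact le_trans (by linarith) (real_inner_le_norm (x - y) (p - q))
  rcases (norm_nonneg (p - q)).eq_or_lt with h | h
  · rw [← h]; exact norm_nonneg _
  · exact le_of_mul_le_mul_right h4 h

theorem projOnto_of_mem {x : Param n} (hx : x ∈ Θ) : projOnto Θ x = x := by
  have h := (projOnto_spec hc hv hne x).2 x hx
  have h2 := real_inner_self_nonneg (F := Param n) (x := x - projOnto Θ x)
  exact (sub_eq_zero.1 (inner_self_eq_zero.1 (le_antisymm h h2))).symm

theorem continuous_projOnto : Continuous (projOnto Θ) :=
  (LipschitzWith.of_dist_le_mul (K := 1) fun x y => by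
    rw [dist_eq_norm, dist_eq_norm]
    simpa using norm_projOnto_sub_le hc hv hne x y).continuous

end Projection

/-! ### Projected stochastic gradient descent -/

section SGD

variable {n : ℕ} {Θ : Set (Param n)} (hc : IsClosed Θ) (hv : Convex ℝ Θ)
  {θ₁ θs : Param n} (hθ₁ : θ₁ ∈ Θ) (hθs : θs ∈ Θ) {τ : ℝ} (hτ : 0 < τ)

include hc hv hθ₁ in
theorem projSGD_mem (V : ℕ → Param n → Param n) (t : ℕ) : projSGD Θ τ θ₁ V t ∈ Θ := by
  cases t with
  | zero => exact hθ₁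
  | succ t => exact (projOnto_spec hc hv ⟨θ₁, hθ₁⟩ _).1

include hc hv hθs in
theorem norm_projSGD_succ_le (V : ℕ → Param n → Param n) (t : ℕ) :
    ‖projSGD Θ τ θ₁ V (t + 1) - θs‖
      ≤ ‖projSGD Θ τ θ₁ V t - τ • V t (projSGD Θ τ θ₁ V t) - θs‖ := by
  have h := norm_projOnto_sub_le hc hv ⟨θs, hθs⟩
    (projSGD Θ τ θ₁ V t - τ • V t (projSGD Θ τ θ₁ V t)) θs
  rw [projOnto_of_mem hc hv ⟨θs, hθs⟩ hθs] at h
  exact h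

-- Each step adds at most τB to the distance. As `Θ` may be unbounded, this is the only a priori
-- bound on the iterates.
include hc hv hθs hτ in
theorem norm_projSGD_le (V : ℕ → Param n → Param n) {B : ℝ}
    (hB : ∀ t, ‖V t (projSGD Θ τ θ₁ V t)‖ ≤ B) (t : ℕ) :
    ‖projSGD Θ τ θ₁ V t - θs‖ ≤ ‖θ₁ - θs‖ + t * (τ * B) := by
  induction t with
  | zero => simp [projSGD]
  | succ t ih =>
    refine (norm_projSGD_succ_le hc hv hθs V t).trans ?_
    have e : projSGD Θ τ θ₁ V t - τ • V t (projSGD Θ τ θ₁ V t) - θs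
        = (projSGD Θ τ θ₁ V t - θs) - τ • V t (projSGD Θ τ θ₁ V t) := by abel
    rw [e]
    refine (norm_sub_le _ _).trans ?_
    rw [norm_smul, Real.norm_of_nonneg hτ.le]
    have := mul_le_mul_of_nonneg_left (hB t) hτ.le
    push_cast
    linarith

include hc hv hθs in
theorem norm_sq_projSGD_succ_le (V : ℕ → Param n → Param n) (t : ℕ) :
    ‖projSGD Θ τ θ₁ V (t + 1) - θs‖ ^ 2 ≤ ‖projSGD Θ τ θ₁ V t - θs‖ ^ 2
      - 2 * τ * inner ℝ (V t (projSGD Θ τ θ₁ V t)) (projSGD Θ τ θ₁ V t - θs)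
      + τ ^ 2 * ‖V t (projSGD Θ τ θ₁ V t)‖ ^ 2 := by
  have h := pow_le_pow_left₀ (norm_nonneg _)
    (norm_projSGD_succ_le (τ := τ) (θ₁ := θ₁) hc hv hθs V t) 2
  refine h.trans (le_of_eq ?_)
  have e : projSGD Θ τ θ₁ V t - τ • V t (projSGD Θ τ θ₁ V t) - θs
      = (projSGD Θ τ θ₁ V t - θs) - τ • V t (projSGD Θ τ θ₁ V t) := by abel
  rw [e, norm_sub_sq_real, inner_smul_right, norm_smul, mul_pow, real_inner_comm, Real.norm_eq_abs,
    sq_abs]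
  ring

variable {Ω S : Type*} [MeasurableSpace Ω] [MeasurableSpace S] {P : Measure Ω}
  [IsProbabilityMeasure P] {law : Measure S} [IsProbabilityMeasure law] {X : ℕ → Ω → S}
  (hlaw : ∀ t, HasLaw (X t) law P) (hind : iIndepFun X P) {V : S → Param n → Param n}
  (hV : Measurable (Function.uncurry V))

-- The iterate is a measurable function of the samples used before step `t`; hence it is independent
-- of the sample of step `t`.
include hc hv hθ₁ hV in
theorem exists_measurable_projSGD (τ : ℝ) (t : ℕ) :
    ∃ Ψ : (↥(Finset.range t) → S) → Param n, Measurable Ψ ∧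
      ∀ x : ℕ → S, projSGD Θ τ θ₁ (fun t => V (x t)) t = Ψ fun i => x i := by
  induction t with
  | zero => exact ⟨fun _ => θ₁, measurable_const, fun x => rfl⟩
  | succ t ih =>
    obtain ⟨Ψ, hΨ, hx⟩ := ih
    have hsub : Finset.range t ⊆ Finset.range (t + 1) := Finset.range_mono (Nat.le_succ t)
    set res : (↥(Finset.range (t + 1)) → S) → (↥(Finset.range t) → S) :=
      fun y i => y ⟨i, hsub i.2⟩ with hres
    have hresm : Measurable res := measurable_pi_lambda _ fun i => measurable_pi_apply _
    set last : (↥(Finset.range (t + 1)) → S) → S :=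
      fun y => y ⟨t, Finset.self_mem_range_succ t⟩ with hlast
    have hlastm : Measurable last := measurable_pi_apply _
    refine ⟨fun y => projOnto Θ (Ψ (res y) - τ • V (last y) (Ψ (res y))), ?_, fun x => ?_⟩
    · refine (continuous_projOnto hc hv ⟨θ₁, hθ₁⟩).measurable.comp ?_
      have h1 : Measurable fun y => Ψ (res y) := hΨ.comp hresm
      exact h1.sub ((hV.comp (hlastm.prodMk h1)).const_smul τ)
    · have := hx x
      change projOnto Θ (projSGD Θ τ θ₁ (fun t => V (x t)) t
        - τ • V (x t) (projSGD Θ τ θ₁ (fun t => V (x t)) t)) = _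
      rw [this]

omit [IsProbabilityMeasure P] [IsProbabilityMeasure law] in
include hc hv hθ₁ hV hlaw in
theorem aemeasurable_projSGD (τ : ℝ) (t : ℕ) :
    AEMeasurable (fun ω => projSGD Θ τ θ₁ (fun t => V (X t ω)) t) P := by
  obtain ⟨Ψ, hΨ, h⟩ := exists_measurable_projSGD hc hv hθ₁ hV τ t
  have : (fun ω => projSGD Θ τ θ₁ (fun t => V (X t ω)) t)
      = fun ω => Ψ fun i : ↥(Finset.range t) => X i ω := funext fun ω => h fun t => X t ω
  rw [this]
  exact hΨ.comp_aemeasurable (aemeasurable_pi_lambda _ fun i => (hlaw i).aemeasurable)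

include hc hv hθ₁ hV hlaw hind in
omit [IsProbabilityMeasure law] in
theorem map_projSGD_prod (τ : ℝ) (t : ℕ) :
    P.map (fun ω => (projSGD Θ τ θ₁ (fun t => V (X t ω)) t, X t ω))
      = (P.map fun ω => projSGD Θ τ θ₁ (fun t => V (X t ω)) t).prod law := by
  obtain ⟨Ψ, hΨ, h⟩ := exists_measurable_projSGD hc hv hθ₁ hV τ t
  have hI := hind.indepFun_finset₀ (Finset.range t) {t} (by simp) fun i => (hlaw i).aemeasurable
  have hI2 := hI.comp hΨ (measurable_pi_apply (⟨t, Finset.mem_singleton_self t⟩ :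
    ({t} : Finset ℕ)))
  have e : (Ψ ∘ fun ω (i : ↥(Finset.range t)) => X i ω)
      = fun ω => projSGD Θ τ θ₁ (fun t => V (X t ω)) t :=
    funext fun ω => (h fun t => X t ω).symm
  rw [e] at hI2
  have := (indepFun_iff_map_prod_eq_prod_map_map
    (aemeasurable_projSGD hc hv hθ₁ hlaw hV τ t) (hlaw t).aemeasurable).1 hI2
  rw [(hlaw t).map_eq] at this
  exact this

-- An almost sure property at each fixed parameter does not by itself hold at a random one. The
-- product law of iterate and fresh sample permits the substitution by Fubini.
include hc hv hθ₁ hV hlaw hind in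
theorem ae_projSGD {p : Param n → S → Prop} (hp : MeasurableSet {q : Param n × S | p q.1 q.2})
    (h : ∀ θ ∈ Θ, ∀ᵐ s ∂law, p θ s) (τ : ℝ) (t : ℕ) :
    ∀ᵐ ω ∂P, p (projSGD Θ τ θ₁ (fun t => V (X t ω)) t) (X t ω) := by
  have hm := aemeasurable_projSGD hc hv hθ₁ hlaw hV τ t
  have hΘ : ∀ᵐ θ ∂(P.map fun ω => projSGD Θ τ θ₁ (fun t => V (X t ω)) t), θ ∈ Θ :=
    (ae_map_iff hm hc.measurableSet).2
      (Filter.Eventually.of_forall fun ω => projSGD_mem hc hv hθ₁ _ t)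
  have h2 : ∀ᵐ q ∂((P.map fun ω => projSGD Θ τ θ₁ (fun t => V (X t ω)) t).prod law),
      p q.1 q.2 := (Measure.ae_prod_iff_ae_ae hp).2 (hΘ.mono h)
  rw [← map_projSGD_prod hc hv hθ₁ hlaw hind hV τ t] at h2
  exact ae_of_ae_map (hm.prodMk (hlaw t).aemeasurable) h2

-- Conditioning on the past, in the form of Fubini for the product law.
include hc hv hθ₁ hV hlaw hind in
theorem integral_projSGD {h : Param n → S → ℝ} (hh : Measurable (Function.uncurry h)) (τ : ℝ)
    (t : ℕ)
    (hi : Integrable (fun ω => h (projSGD Θ τ θ₁ (fun t => V (X t ω)) t) (X t ω)) P) :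
    Integrable (fun ω => ∫ s, h (projSGD Θ τ θ₁ (fun t => V (X t ω)) t) s ∂law) P ∧
    ∫ ω, h (projSGD Θ τ θ₁ (fun t => V (X t ω)) t) (X t ω) ∂P
      = ∫ ω, ∫ s, h (projSGD Θ τ θ₁ (fun t => V (X t ω)) t) s ∂law ∂P := by
  have hm := aemeasurable_projSGD hc hv hθ₁ hlaw hV τ t
  have hm2 := hm.prodMk (hlaw t).aemeasurable
  have hprod := map_projSGD_prod hc hv hθ₁ hlaw hind hV τ t
  have hi2 : Integrable (Function.uncurry h)
      ((P.map fun ω => projSGD Θ τ θ₁ (fun t => V (X t ω)) t).prod law) := by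
    rw [← hprod]
    exact (integrable_map_measure hh.aestronglyMeasurable hm2).2 hi
  have hinner := hi2.integral_prod_left
  refine ⟨(integrable_map_measure hinner.aestronglyMeasurable hm).1 hinner, ?_⟩
  have e := integral_map hm2 (f := Function.uncurry h) hh.aestronglyMeasurable
  rw [hprod, integral_prod _ hi2] at e
  rw [integral_map hm hinner.aestronglyMeasurable] at e
  exact e.symm

include hc hv hθ₁ hθs hτ hV hlaw hind in
/-- Convergence of projected SGD with a biased oracle that is almost surely bounded. -/
theorem projSGD_converges {F : Param n → ℝ} (hF : ConvexOn ℝ Θ F) {Lf : ℝ} (hLf : 0 ≤ Lf)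
    (hFL : ∀ θ ∈ Θ, ∀ θ' ∈ Θ, |F θ - F θ'| ≤ Lf * ‖θ - θ'‖) {B M b D : ℝ}
    (hD : ‖θ₁ - θs‖ ≤ D) {T : ℕ} (hT : 1 ≤ T)
    (hB : ∀ θ ∈ Θ, ∀ᵐ s ∂law, ‖V s θ‖ ≤ B)
    (hM : ∀ θ ∈ Θ, ∫ s, ‖V s θ‖ ^ 2 ∂law ≤ M)
    (hb : ∀ θ ∈ Θ, ‖θ - θs‖ ≤ D + T * (τ * B) →
      F θ - F θs - b ≤ ∫ s, inner ℝ (V s θ) (θ - θs) ∂law) :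
    (∀ ω, sgdOutput Θ τ θ₁ (fun t => V (X t ω)) T ∈ Θ) ∧
    Integrable (fun ω => F (sgdOutput Θ τ θ₁ (fun t => V (X t ω)) T) - F θs) P ∧
    ∫ ω, (F (sgdOutput Θ τ θ₁ (fun t => V (X t ω)) T) - F θs) ∂P
      ≤ D ^ 2 / (2 * τ * T) + τ * M / 2 + b := by
  have hT' : (0 : ℝ) < T := by exact_mod_cast hT
  have hne : Θ.Nonempty := ⟨θ₁, hθ₁⟩
  set it : ℕ → Ω → Param n := fun t ω => projSGD Θ τ θ₁ (fun t => V (X t ω)) t with hit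
  have hitm : ∀ t, AEMeasurable (it t) P := fun t => aemeasurable_projSGD hc hv hθ₁ hlaw hV τ t
  have hmem : ∀ t ω, it t ω ∈ Θ := fun t ω => projSGD_mem hc hv hθ₁ _ t
  have hVm : Measurable fun q : Param n × S => V q.2 q.1 := hV.comp measurable_swap
  have hVω : ∀ t, AEMeasurable (fun ω => V (X t ω) (it t ω)) P := fun t =>
    hVm.comp_aemeasurable ((hitm t).prodMk (hlaw t).aemeasurable)
  have hBae : ∀ᵐ ω ∂P, ∀ t, ‖V (X t ω) (it t ω)‖ ≤ B := ae_all_iff.2 fun t =>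
    ae_projSGD hc hv hθ₁ hlaw hind hV (p := fun θ s => ‖V s θ‖ ≤ B)
      (measurableSet_le hVm.norm measurable_const) hB τ t
  have hB0 : 0 ≤ B := by
    obtain ⟨s, hs⟩ := (hB θ₁ hθ₁).exists
    exact (norm_nonneg _).trans hs
  set ρ := D + T * (τ * B) with hρ
  have hρae : ∀ t ≤ T, ∀ᵐ ω ∂P, ‖it t ω - θs‖ ≤ ρ := by
    intro t ht
    filter_upwards [hBae] with ω hω
    refine (norm_projSGD_le hc hv hθs hτ (fun t => V (X t ω)) hω t).trans ?_
    have : (t : ℝ) * (τ * B) ≤ T * (τ * B) :=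
      mul_le_mul_of_nonneg_right (by exact_mod_cast ht) (by positivity)
    linarith
  have hρ0 : 0 ≤ ρ := by
    obtain ⟨ω, hω⟩ := (hρae 0 (Nat.zero_le _)).exists
    exact (norm_nonneg _).trans hω
  -- continuity of the objective
  have hFc : Continuous fun x => F (projOnto Θ x) := by
    refine (LipschitzWith.of_dist_le_mul (K := Lf.toNNReal) fun x y => ?_).continuous
    rw [Real.dist_eq, dist_eq_norm, Real.coe_toNNReal _ hLf]
    refine (hFL _ (projOnto_spec hc hv hne x).1 _ (projOnto_spec hc hv hne y).1).trans ?_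
    exact mul_le_mul_of_nonneg_left (norm_projOnto_sub_le hc hv hne x y) hLf
  have hFint : ∀ Y : Ω → Param n, AEMeasurable Y P → (∀ ω, Y ω ∈ Θ) →
      (∀ᵐ ω ∂P, ‖Y ω - θs‖ ≤ ρ) → Integrable (fun ω => F (Y ω) - F θs) P := by
    intro Y hY hYm hYb
    refine Integrable.of_bound ?_ (Lf * ρ) ?_
    · have h1 : AEStronglyMeasurable (fun ω => F (projOnto Θ (Y ω)) - F θs) P :=
        ((hFc.measurable.comp_aemeasurable hY).sub_const _).aestronglyMeasurable
      refine h1.congr (Filter.Eventually.of_forall fun ω => ?_)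
      simp only [projOnto_of_mem hc hv hne (hYm ω)]
    · filter_upwards [hYb] with ω hω
      exact (hFL _ (hYm ω) _ hθs).trans (mul_le_mul_of_nonneg_left hω hLf)
  have hFit : ∀ t ≤ T, Integrable (fun ω => F (it t ω) - F θs) P := fun t ht =>
    hFint _ (hitm t) (hmem t) (hρae t ht)
  -- one step
  have hsq : ∀ t ≤ T, Integrable (fun ω => ‖it t ω - θs‖ ^ 2) P := by
    intro t ht
    refine Integrable.of_bound (((hitm t).sub_const θs).norm.pow_const 2).aestronglyMeasurable
      (ρ ^ 2) ?_
    filter_upwards [hρae t ht] with ω hω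
    rw [Real.norm_of_nonneg (by positivity)]
    exact pow_le_pow_left₀ (norm_nonneg _) hω 2
  have hstep : ∀ t < T, 2 * τ * ∫ ω, (F (it t ω) - F θs) ∂P
      ≤ ∫ ω, ‖it t ω - θs‖ ^ 2 ∂P - ∫ ω, ‖it (t + 1) ω - θs‖ ^ 2 ∂P + 2 * τ * b + τ ^ 2 * M := by
    intro t ht
    have i1 : Integrable (fun ω => inner ℝ (V (X t ω) (it t ω)) (it t ω - θs)) P := by
      refine Integrable.of_bound ((hVω t).inner ((hitm t).sub_const θs)).aestronglyMeasurable
        (B * ρ) ?_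
      filter_upwards [hBae, hρae t ht.le] with ω h1 h2
      exact (norm_inner_le_norm _ _).trans (mul_le_mul (h1 t) h2 (norm_nonneg _) hB0)
    have i2 : Integrable (fun ω => ‖V (X t ω) (it t ω)‖ ^ 2) P := by
      refine Integrable.of_bound ((hVω t).norm.pow_const 2).aestronglyMeasurable (B ^ 2) ?_
      filter_upwards [hBae] with ω h1
      rw [Real.norm_of_nonneg (by positivity)]
      exact pow_le_pow_left₀ (norm_nonneg _) (h1 t) 2
    obtain ⟨j1, e1⟩ := integral_projSGD hc hv hθ₁ hlaw hind hV
      (h := fun θ s => inner ℝ (V s θ) (θ - θs))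
      (hVm.inner (measurable_fst.sub_const θs)) τ t i1
    obtain ⟨j2, e2⟩ := integral_projSGD hc hv hθ₁ hlaw hind hV
      (h := fun θ s => ‖V s θ‖ ^ 2) (hVm.norm.pow_const 2) τ t i2
    have l1 : ∫ ω, (F (it t ω) - F θs) ∂P - b
        ≤ ∫ ω, inner ℝ (V (X t ω) (it t ω)) (it t ω - θs) ∂P := by
      rw [e1]
      have : ∫ ω, (F (it t ω) - F θs - b) ∂P = ∫ ω, (F (it t ω) - F θs) ∂P - b := by
        rw [integral_sub (hFit t ht.le) (integrable_const b)]; simp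
      rw [← this]
      refine integral_mono_ae ((hFit t ht.le).sub (integrable_const b)) j1 ?_
      filter_upwards [hρae t ht.le] with ω hω
      exact hb _ (hmem t ω) hω
    have l2 : ∫ ω, ‖V (X t ω) (it t ω)‖ ^ 2 ∂P ≤ M := by
      rw [e2]
      have : ∫ _ω, M ∂P = M := by simp
      rw [← this]
      exact integral_mono j2 (integrable_const M) fun ω => hM _ (hmem t ω)
    have i3 : Integrable (fun ω => ‖it t ω - θs‖ ^ 2
        - 2 * τ * inner ℝ (V (X t ω) (it t ω)) (it t ω - θs)) P :=
      (hsq t ht.le).sub (i1.const_mul _)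
    have l3 := integral_mono (hsq (t + 1) ht) (i3.add (i2.const_mul (τ ^ 2))) fun ω =>
      norm_sq_projSGD_succ_le hc hv hθs (fun t => V (X t ω)) t
    rw [integral_add' i3 (i2.const_mul _), integral_sub (hsq t ht.le) (i1.const_mul _),
      integral_const_mul, integral_const_mul] at l3
    have l4 := mul_le_mul_of_nonneg_left l1 (show 0 ≤ 2 * τ by positivity)
    have l5 := mul_le_mul_of_nonneg_left l2 (show 0 ≤ τ ^ 2 by positivity)
    linarith
  have hsum := Finset.sum_le_sum fun t (ht : t ∈ Finset.range T) => hstep t (Finset.mem_range.1 ht)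
  rw [← Finset.mul_sum, Finset.sum_add_distrib, Finset.sum_add_distrib,
    Finset.sum_range_sub' (fun t => ∫ ω, ‖it t ω - θs‖ ^ 2 ∂P)] at hsum
  simp only [Finset.sum_const, Finset.card_range, nsmul_eq_mul] at hsum
  have h0 : ∫ ω, ‖it 0 ω - θs‖ ^ 2 ∂P ≤ D ^ 2 := by
    simp only [hit, projSGD, integral_const, probReal_univ, one_smul]
    exact pow_le_pow_left₀ (norm_nonneg _) hD 2
  have hTsq : 0 ≤ ∫ ω, ‖it T ω - θs‖ ^ 2 ∂P := integral_nonneg fun ω => by positivity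
  -- averaging
  set out : Ω → Param n := fun ω => sgdOutput Θ τ θ₁ (fun t => V (X t ω)) T with hout
  have hw : ∑ _t ∈ Finset.range T, (1 / T : ℝ) = 1 := by
    rw [Finset.sum_const, Finset.card_range, nsmul_eq_mul]; field_simp
  have houte : ∀ ω, out ω = ∑ t ∈ Finset.range T, (1 / T : ℝ) • it t ω := fun ω => by
    rw [hout]; simp only [sgdOutput, Finset.smul_sum, hit]
  have houtm : ∀ ω, out ω ∈ Θ := fun ω => by
    rw [houte]
    exact hv.sum_mem (fun _ _ => by positivity) hw fun t _ => hmem t ω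
  have hjen : ∀ ω, F (out ω) - F θs ≤ ∑ t ∈ Finset.range T, (1 / T : ℝ) * (F (it t ω) - F θs) := by
    intro ω
    have := hF.map_sum_le (t := Finset.range T) (w := fun _ => (1 / T : ℝ)) (p := fun t => it t ω)
      (fun _ _ => by positivity) hw fun t _ => hmem t ω
    rw [← houte] at this
    simp only [smul_eq_mul] at this
    simp only [mul_sub, Finset.sum_sub_distrib, ← Finset.sum_mul, hw, one_mul]
    linarith
  have houtb : ∀ᵐ ω ∂P, ‖out ω - θs‖ ≤ ρ := by
    have hall : ∀ᵐ ω ∂P, ∀ t ∈ Finset.range T, ‖it t ω - θs‖ ≤ ρ :=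
      (Finset.eventually_all _).2 fun t ht => hρae t (Finset.mem_range.1 ht).le
    filter_upwards [hall] with ω hω
    have h1 := (convex_closedBall θs ρ).sum_mem (t := Finset.range T) (w := fun _ => (1 / T : ℝ))
      (z := fun t => it t ω) (fun _ _ => by positivity) hw fun t ht => by
        rw [mem_closedBall_iff_norm]; exact hω t ht
    rw [← houte, mem_closedBall_iff_norm] at h1
    exact h1
  have houtmeas : AEMeasurable out P := by
    have : out = fun ω => ∑ t ∈ Finset.range T, (1 / T : ℝ) • it t ω := funext houte
    rw [this]
    exact Finset.aemeasurable_fun_sum _ fun t _ => (hitm t).const_smul (1 / T : ℝ)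
  have hint := hFint out houtmeas houtm houtb
  refine ⟨houtm, hint, ?_⟩
  have hi : ∀ t ∈ Finset.range T, Integrable (fun ω => (1 / T : ℝ) * (F (it t ω) - F θs)) P :=
    fun t ht => (hFit t (Finset.mem_range.1 ht).le).const_mul _
  have hfinal := integral_mono hint (integrable_finsetSum _ hi) hjen
  rw [integral_finsetSum _ hi] at hfinal
  simp only [integral_const_mul, ← Finset.mul_sum] at hfinal
  refine hfinal.trans ?_
  set A := ∑ t ∈ Finset.range T, ∫ ω, (F (it t ω) - F θs) ∂P
  -- The squared distances have telescoped: the first is at most D², and the last is dropped as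
  -- nonnegative.
  have hA : 2 * τ * A ≤ D ^ 2 + T * (2 * τ * b) + T * (τ ^ 2 * M) := by linarith
  have : 1 / (T : ℝ) * A = (2 * τ * A) / (2 * τ * T) := by field_simp
  rw [this, div_le_iff₀ (by positivity)]
  refine hA.trans (le_of_eq ?_)
  field_simp
  ring

end SGD

end AdvRobust

namespace AdvRobust

/-! ### Product measures -/

section PiMeasure

theorem measurable_pi_measure {α β : Type*} [MeasurableSpace α] [MeasurableSpace β] {m : ℕ}
    {κ : α → Measure β} (hκ : Measurable κ) [∀ a, IsProbabilityMeasure (κ a)] :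
    Measurable fun a => Measure.pi fun _ : Fin m => κ a := by
  refine Measurable.measure_of_isPiSystem_of_isProbabilityMeasure
    (generateFrom_pi (ι := Fin m) (α := fun _ => β)).symm isPiSystem_pi ?_
  rintro _ ⟨t, ht, rfl⟩
  simp only [Measure.pi_pi]
  exact Finset.measurable_fun_prod _ fun i _ =>
    (Measure.measurable_coe (ht i (Set.mem_univ i))).comp hκ

/-- Selecting distinct coordinates of an i.i.d. sample gives an i.i.d. sample; applied to the two
halves of a level. -/
theorem measurePreserving_comp_injective {β ι ι' : Type*} [MeasurableSpace β] [Fintype ι]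
    [Fintype ι'] (ν : Measure β) [IsProbabilityMeasure ν] {e : ι → ι'}
    (he : Function.Injective e) :
    MeasurePreserving (fun (w : ι' → β) i => w (e i)) (Measure.pi fun _ => ν)
      (Measure.pi fun _ => ν) := by
  refine ⟨by fun_prop, ?_⟩
  have h1 : iIndepFun (fun (i : ι') (w : ι' → β) => w i) (Measure.pi fun _ => ν) :=
    iIndepFun_pi (X := fun _ => id) fun _ => aemeasurable_id
  have h2 := (iIndepFun_iff_map_fun_eq_pi_map
    (fun i => (measurable_pi_apply (e i)).aemeasurable)).1 (h1.precomp he)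
  rw [h2]
  congr 1
  ext1 i
  exact (measurePreserving_eval (fun _ : ι' => ν) (e i)).map_eq

theorem firstHalf_index_injective (ℓ : ℕ) : Function.Injective fun i : Fin (2 ^ ℓ) =>
    (⟨i, by have := i.isLt; rw [pow_succ]; omega⟩ : Fin (2 ^ (ℓ + 1))) := by
  intro i j h
  simpa [Fin.ext_iff] using h

theorem secondHalf_index_injective (ℓ : ℕ) : Function.Injective fun i : Fin (2 ^ ℓ) =>
    (⟨2 ^ ℓ + i, by have := i.isLt; rw [pow_succ]; omega⟩ : Fin (2 ^ (ℓ + 1))) := by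
  intro i j h
  simpa [Fin.ext_iff] using h

theorem measurePreserving_firstHalf {β : Type*} [MeasurableSpace β] (ν : Measure β)
    [IsProbabilityMeasure ν] (ℓ : ℕ) :
    MeasurePreserving (firstHalf : (Fin (2 ^ (ℓ + 1)) → β) → _) (Measure.pi fun _ => ν)
      (Measure.pi fun _ => ν) :=
  measurePreserving_comp_injective ν (firstHalf_index_injective ℓ)

theorem measurePreserving_secondHalf {β : Type*} [MeasurableSpace β] (ν : Measure β)
    [IsProbabilityMeasure ν] (ℓ : ℕ) :
    MeasurePreserving (secondHalf : (Fin (2 ^ (ℓ + 1)) → β) → _) (Measure.pi fun _ => ν)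
      (Measure.pi fun _ => ν) :=
  measurePreserving_comp_injective ν (secondHalf_index_injective ℓ)

theorem sum_halves {M : Type*} [AddCommMonoid M] {ℓ : ℕ} (F : Fin (2 ^ (ℓ + 1)) → M) :
    ∑ i, F i = ∑ i, firstHalf F i + ∑ i, secondHalf F i := by
  have e : 2 ^ ℓ + 2 ^ ℓ = 2 ^ (ℓ + 1) := by rw [pow_succ]; omega
  rw [← Equiv.sum_comp (finCongr e) F, Fin.sum_univ_add]
  rfl

end PiMeasure

set_option linter.unusedSectionVars false

namespace Problem

variable {E : Type*} [NormedAddCommGroup E] [NormedSpace ℝ E] [FiniteDimensional ℝ E]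
  [MeasureSpace E] [BorelSpace E] [(volume : Measure E).IsAddHaarMeasure] {n : ℕ}
  {p : Problem E n} {φ : ℝ → ℝ≥0∞} {η : ℝ}

/-! ### The sampling distributions -/

theorem WellPosed.volume_ne_top (z : E) : volume (Metric.closedBall z p.ρ ∩ p.Z) ≠ ⊤ := by
  have : ProperSpace E := FiniteDimensional.proper ℝ E
  exact ne_top_of_le_ne_top (isCompact_closedBall z p.ρ).measure_ne_top
    (measure_mono Set.inter_subset_left)

theorem WellPosed.isProbabilityMeasure_ν (hp : p.WellPosed φ η) {z : E} (hz : z ∈ p.P.support) :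
    IsProbabilityMeasure (p.ν z) :=
  cond_isProbabilityMeasure_of_finite (hp.volume_pos z hz) (WellPosed.volume_ne_top z)

theorem WellPosed.ae_mem_Z (hp : p.WellPosed φ η) (z : E) : ∀ᵐ x ∂p.ν z, x ∈ p.Z := by
  have hm : MeasurableSet (Metric.closedBall z p.ρ ∩ p.Z) :=
    Metric.isClosed_closedBall.measurableSet.inter hp.measurable_Z
  exact (ProbabilityTheory.ae_cond_mem hm).mono fun x hx => hx.2

/-- The uniform distribution is a quotient of volumes of sections of a measurable set in the product
space. -/
theorem WellPosed.measurable_ν (hp : p.WellPosed φ η) : Measurable p.ν := by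
  have : ProperSpace E := FiniteDimensional.proper ℝ E
  have hv : ∀ A : Set E, MeasurableSet A →
      Measurable fun z => volume (Metric.closedBall z p.ρ ∩ p.Z ∩ A) := by
    intro A hA
    have hs : MeasurableSet {q : E × E | dist q.2 q.1 ≤ p.ρ ∧ q.2 ∈ p.Z ∧ q.2 ∈ A} :=
      (measurableSet_le (measurable_snd.dist measurable_fst) measurable_const).inter
        ((measurable_snd hp.measurable_Z).inter (measurable_snd hA))
    convert measurable_measure_prodMk_left (ν := (volume : Measure E)) hs using 3 with z
    ext x
    simp [and_assoc]
  refine Measure.measurable_of_measurable_coe _ fun A hA => ?_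
  have hm : ∀ z, MeasurableSet (Metric.closedBall z p.ρ ∩ p.Z) := fun z =>
    Metric.isClosed_closedBall.measurableSet.inter hp.measurable_Z
  have e : ∀ z, p.ν z A = (volume (Metric.closedBall z p.ρ ∩ p.Z ∩ Set.univ))⁻¹
      * volume (Metric.closedBall z p.ρ ∩ p.Z ∩ A) := fun z => by
    rw [Set.inter_univ]; exact cond_apply (hm z) volume A
  simp only [e]
  exact (hv _ MeasurableSet.univ).inv.mul (hv A hA)

/-- The sampling distribution of `m` perturbed points, with an arbitrary value where `ν_z` is not
defined. -/
noncomputable def sampleKernelFun (p : Problem E n) (m : ℕ) (z : E) : Measure (Fin m → E) :=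
  open Classical in
  Measure.pi fun _ : Fin m => if IsProbabilityMeasure (p.ν z) then p.ν z else Measure.dirac 0

theorem sampleKernelFun_eq (hp : p.WellPosed φ η) (m : ℕ) {z : E} (hz : z ∈ p.P.support) :
    p.sampleKernelFun m z = Measure.pi fun _ : Fin m => p.ν z := by
  unfold sampleKernelFun
  rw [if_pos (hp.isProbabilityMeasure_ν hz)]

theorem isProbabilityMeasure_ite (z : E) : IsProbabilityMeasure
    (open Classical in if IsProbabilityMeasure (p.ν z) then p.ν z else Measure.dirac 0) := by
  split_ifs with h
  · exact h
  · infer_instance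

instance (m : ℕ) (z : E) : IsProbabilityMeasure (p.sampleKernelFun m z) := by
  unfold sampleKernelFun
  have := isProbabilityMeasure_ite (p := p)
  infer_instance

theorem measurable_sampleKernelFun (hp : p.WellPosed φ η) (m : ℕ) :
    Measurable (p.sampleKernelFun m) := by
  classical
  have := isProbabilityMeasure_ite (p := p)
  refine measurable_pi_measure
    (κ := fun z => if IsProbabilityMeasure (p.ν z) then p.ν z else Measure.dirac 0) ?_
  refine Measurable.ite ?_ hp.measurable_ν measurable_const
  have : {z | IsProbabilityMeasure (p.ν z)} = {z | p.ν z Set.univ = 1} := by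
    ext z; exact ⟨fun h => h.measure_univ, fun h => ⟨h⟩⟩
  rw [this]
  exact (Measure.measurable_coe MeasurableSet.univ).comp hp.measurable_ν
    (measurableSet_singleton 1)

/-- The sampling distributions as a Markov kernel. -/
noncomputable def sampleKernel (p : Problem E n) (hp : p.WellPosed φ η) (m : ℕ) :
    Kernel E (Fin m → E) :=
  ⟨p.sampleKernelFun m, measurable_sampleKernelFun hp m⟩

instance (hp : p.WellPosed φ η) (m : ℕ) : IsMarkovKernel (p.sampleKernel hp m) :=
  ⟨fun z => inferInstanceAs (IsProbabilityMeasure (p.sampleKernelFun m z))⟩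

theorem WellPosed.ae_mem_support (p : Problem E n) : ∀ᵐ z ∂p.P, z ∈ p.P.support := by
  have : ProperSpace E := FiniteDimensional.proper ℝ E
  exact Measure.support_mem_ae

/-- Rewrites the law through a Markov kernel so that Fubini is available. The default values of the
kernel occur only off the support of the data distribution, a null set. -/
theorem sampleLaw_eq (hp : p.WellPosed φ η) (ℓ : ℕ) :
    p.sampleLaw ℓ = p.P ⊗ₘ p.sampleKernel hp (2 ^ ℓ) := by
  have := hp.isProb
  have hm : Measurable fun z => (p.sampleKernelFun (2 ^ ℓ) z).map fun w => (z, w) := by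
    refine Measure.measurable_of_measurable_coe _ fun s hs => ?_
    simp_rw [Measure.map_apply measurable_prodMk_left hs]
    exact Kernel.measurable_kernel_prodMk_left (κ := p.sampleKernel hp (2 ^ ℓ)) hs
  have hae : (fun z => (p.sampleKernelFun (2 ^ ℓ) z).map fun w => (z, w))
      =ᵐ[p.P] fun z => (Measure.pi fun _ : Fin (2 ^ ℓ) => p.ν z).map fun w => (z, w) := by
    filter_upwards [WellPosed.ae_mem_support p] with z hz
    rw [sampleKernelFun_eq hp _ hz]
  ext s hs
  unfold sampleLaw
  rw [Measure.bind_apply hs (hm.aemeasurable.congr hae), Measure.compProd_apply hs]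
  refine lintegral_congr_ae ?_
  filter_upwards [WellPosed.ae_mem_support p] with z hz
  rw [Measure.map_apply measurable_prodMk_left hs, ← sampleKernelFun_eq hp _ hz]
  rfl

theorem isProbabilityMeasure_sampleLaw (hp : p.WellPosed φ η) (ℓ : ℕ) :
    IsProbabilityMeasure (p.sampleLaw ℓ) := by
  have := hp.isProb
  rw [sampleLaw_eq hp]
  infer_instance

theorem ae_sampleLaw (hp : p.WellPosed φ η) (ℓ : ℕ) {q : (Fin (2 ^ ℓ) → E) → Prop}
    (hq : MeasurableSet {w | q w})
    (h : ∀ z ∈ p.P.support, ∀ᵐ w ∂(Measure.pi fun _ : Fin (2 ^ ℓ) => p.ν z), q w) :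
    ∀ᵐ ζ ∂p.sampleLaw ℓ, q ζ.2 := by
  have := hp.isProb
  rw [sampleLaw_eq hp]
  refine Measure.ae_compProd_of_ae_ae (p := fun ζ => q ζ.2) (measurable_snd hq) ?_
  filter_upwards [WellPosed.ae_mem_support p] with z hz
  change ∀ᵐ w ∂(p.sampleKernelFun (2 ^ ℓ) z), q w
  rw [sampleKernelFun_eq hp _ hz]
  exact h z hz

/-- Integration against the sampling law of a function of the perturbed points. -/
theorem integral_sampleLaw (hp : p.WellPosed φ η) (ℓ : ℕ) {h : (Fin (2 ^ ℓ) → E) → ℝ}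
    (hm : Measurable h) {C : ℝ}
    (hC : ∀ z ∈ p.P.support, ∀ᵐ w ∂(Measure.pi fun _ : Fin (2 ^ ℓ) => p.ν z), |h w| ≤ C) :
    Integrable (fun ζ : Sample E ℓ => h ζ.2) (p.sampleLaw ℓ) ∧
    Integrable (fun z => ∫ w, h w ∂(Measure.pi fun _ : Fin (2 ^ ℓ) => p.ν z)) p.P ∧
    ∫ ζ, h ζ.2 ∂(p.sampleLaw ℓ)
      = ∫ z, ∫ w, h w ∂(Measure.pi fun _ : Fin (2 ^ ℓ) => p.ν z) ∂p.P := by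
  have := hp.isProb
  have := isProbabilityMeasure_sampleLaw hp ℓ
  have hi : Integrable (fun ζ : Sample E ℓ => h ζ.2) (p.sampleLaw ℓ) :=
    Integrable.of_bound (hm.comp measurable_snd).aestronglyMeasurable C
      (ae_sampleLaw hp ℓ (q := fun w => |h w| ≤ C) (measurableSet_le hm.abs measurable_const) hC)
  have hi' := hi
  rw [sampleLaw_eq hp] at hi'
  have hae : (fun z => ∫ w, h w ∂(p.sampleKernel hp (2 ^ ℓ) z))
      =ᵐ[p.P] fun z => ∫ w, h w ∂(Measure.pi fun _ : Fin (2 ^ ℓ) => p.ν z) := by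
    filter_upwards [WellPosed.ae_mem_support p] with z hz
    rw [← sampleKernelFun_eq hp _ hz]
    rfl
  have hi2 : Integrable (fun z => ∫ w, h w ∂(p.sampleKernel hp (2 ^ ℓ) z)) p.P := by
    simpa using Integrable.integral_compProd (κ := Kernel.const Unit p.P)
      (η := Kernel.prodMkLeft Unit (p.sampleKernel hp (2 ^ ℓ))) (a := ()) hi'
  refine ⟨hi, hi2.congr hae, ?_⟩
  rw [← integral_congr_ae hae, sampleLaw_eq hp, Measure.integral_compProd hi']

end Problem

end AdvRobust

namespace AdvRobust

/-! ### Weighted sums of vectors with the weights found by the search -/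

section SearchWeights

variable {φ : ℝ → ℝ≥0∞} {κ η : ℝ} {m : ℕ}

/-- A bound of the violation of the constraint `∑ γ_i = 1` after `N` iterations. -/
noncomputable def searchError (φ : ℝ → ℝ≥0∞) (κ η G : ℝ) (N : ℕ) : ℝ :=
  bisectWidth φ η G / 2 ^ N / (η * κ)

theorem bisectWeights_eq (N : ℕ) (f : Fin m → ℝ) (i : Fin m) :
    bisectWeights φ η N f i = 1 / m * optDensity φ ((f i - (bisect φ η N f).mu) / η) :=
  multiplierWeight_eq φ η m _ _

theorem norm_sum_smul_le {ι H : Type*} [Fintype ι] [NormedAddCommGroup H] [NormedSpace ℝ H]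
    (a : ι → ℝ) (d : ι → H) {B : ℝ} (hd : ∀ i, ‖d i‖ ≤ B) :
    ‖∑ i, a i • d i‖ ≤ (∑ i, |a i|) * B := by
  rw [Finset.sum_mul]
  refine norm_sum_le_of_le _ fun i _ => ?_
  rw [norm_smul, Real.norm_eq_abs]
  exact mul_le_mul_of_nonneg_left (hd i) (abs_nonneg _)

/-- At a common multiplier the full problem is the mean of its halves; this linearity is what the
factor 1/2 in the multilevel difference exploits. -/
theorem massGap_halves {ℓ : ℕ} (f : Fin (2 ^ (ℓ + 1)) → ℝ) (μ : ℝ) :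
    massGap φ η f μ
      = 1 / 2 * (massGap φ η (firstHalf f) μ + massGap φ η (secondHalf f) μ) := by
  have h : ((2 ^ (ℓ + 1) : ℕ) : ℝ) = 2 * ((2 ^ ℓ : ℕ) : ℝ) := by push_cast; ring
  have h0 : ((2 ^ ℓ : ℕ) : ℝ) ≠ 0 := by positivity
  unfold massGap
  rw [sum_halves, h]
  have e1 : ∀ i, firstHalf (fun i => optDensity φ ((f i - μ) / η)) i
    = optDensity φ ((firstHalf f i - μ) / η) := fun i => rfl
  have e2 : ∀ i, secondHalf (fun i => optDensity φ ((f i - μ) / η)) i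
    = optDensity φ ((secondHalf f i - μ) / η) := fun i => rfl
  simp only [e1, e2]
  field_simp
  ring

namespace IsDivergence

variable (hφ : IsDivergence φ κ) (hη : 0 < η)
include hφ hη

theorem searchError_nonneg {G : ℝ} (hG : 0 ≤ G) (N : ℕ) : 0 ≤ searchError φ κ η G N := by
  have := hφ.modulus_pos
  unfold searchError bisectWidth
  positivity

theorem exists_root_searchError (N : ℕ) (f : Fin m → ℝ) (hm : 0 < m) {G : ℝ}
    (hG : ∀ i j, f i - f j ≤ G) :
    ∃ μ, massGap φ η f μ = 0 ∧
      |(bisect φ η N f).mu - μ| / (η * κ) ≤ searchError φ κ η G N := by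
  have := hφ.modulus_pos
  obtain ⟨μ, h1, h2⟩ := hφ.exists_root_near_bisect hη N f hm hG
  exact ⟨μ, h1, div_le_div_of_nonneg_right h2 (by positivity)⟩

theorem abs_massGap_bisect_le (N : ℕ) (f : Fin m → ℝ) (hm : 0 < m) {G : ℝ}
    (hG : ∀ i j, f i - f j ≤ G) :
    |massGap φ η f (bisect φ η N f).mu| ≤ searchError φ κ η G N := by
  obtain ⟨μ, h1, h2⟩ := hφ.exists_root_searchError hη N f hm hG
  have := hφ.abs_massGap_sub_le hη f hm (bisect φ η N f).mu μ
  rw [h1, sub_zero] at this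
  exact this.trans h2

theorem norm_bisectWeights_sum_le {H : Type*} [NormedAddCommGroup H] [NormedSpace ℝ H] (N : ℕ)
    (f : Fin m → ℝ) (hm : 0 < m) {G : ℝ} (hG : ∀ i j, f i - f j ≤ G) {d : Fin m → H} {B : ℝ}
    (hB : 0 ≤ B) (hd : ∀ i, ‖d i‖ ≤ B) :
    ‖∑ i, bisectWeights φ η N f i • d i‖ ≤ B * (1 + searchError φ κ η G N) := by
  refine (norm_sum_smul_le _ d hd).trans ?_
  rw [mul_comm]
  refine mul_le_mul_of_nonneg_left ?_ hB
  have h0 : ∀ i, 0 ≤ bisectWeights φ η N f i := fun i => by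
    rw [bisectWeights_eq]
    exact mul_nonneg (by positivity) (hφ.optDensity_nonneg _)
  rw [Finset.sum_congr rfl fun i _ => abs_of_nonneg (h0 i)]
  have h1 := sum_multiplierWeight (φ := φ) (η := η) f (bisect φ η N f).mu
  have h2 := (le_abs_self _).trans (hφ.abs_massGap_bisect_le hη N f hm hG)
  rw [← h1] at h2
  unfold bisectWeights
  linarith

/-- If `d` is a subgradient of the loss, the weighted sum of subgradients is an approximate
subgradient of the optimal value. -/
theorem dualValue_sub_le_inner {H : Type*} [NormedAddCommGroup H] [InnerProductSpace ℝ H] (N : ℕ)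
    (f f' : Fin m → ℝ) (hm : 0 < m) {G : ℝ} (hG : ∀ i j, f i - f j ≤ G) {d : Fin m → H} {B : ℝ}
    (hd : ∀ i, ‖d i‖ ≤ B) (v : H) (hv : ∀ i, f i - f' i ≤ inner ℝ (d i) v) :
    dualValue φ η f - dualValue φ η f' - B * searchError φ κ η G N * ‖v‖
      ≤ inner ℝ (∑ i, bisectWeights φ η N f i • d i) v := by
  obtain ⟨μ, h1, h2⟩ := hφ.exists_root_searchError hη N f hm hG
  set μ' := (bisect φ η N f).mu
  have hm' : (0 : ℝ) < m := by exact_mod_cast hm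
  have hB : 0 ≤ B := (norm_nonneg _).trans (hd ⟨0, hm⟩)
  obtain ⟨μ'', h3⟩ := hφ.exists_massGap_eq_zero hη f' hm
  have h4 := hφ.dualObj_tangent hη f f' hm μ μ''
  rw [h1, zero_mul, sub_zero, ← hφ.dualValue_eq hη f hm h1, ← hφ.dualValue_eq hη f' hm h3] at h4
  -- The computed weights split into those at an exact root, for which the tangent inequality has no
  -- mass term, and an error that is small in ℓ¹.
  have e : ∑ i, bisectWeights φ η N f i • d i
      = ∑ i, (1 / m * optDensity φ ((f i - μ) / η)) • d i
        + ∑ i, (1 / m * (optDensity φ ((f i - μ') / η) - optDensity φ ((f i - μ) / η))) • d i := by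
    rw [← Finset.sum_add_distrib]
    refine Finset.sum_congr rfl fun i _ => ?_
    rw [bisectWeights_eq, ← add_smul]
    congr 1
    ring
  have h5 : 1 / m * ∑ i, optDensity φ ((f i - μ) / η) * (f i - f' i)
      ≤ inner ℝ (∑ i, (1 / m * optDensity φ ((f i - μ) / η)) • d i) v := by
    rw [sum_inner, Finset.mul_sum]
    refine Finset.sum_le_sum fun i _ => ?_
    rw [real_inner_smul_left, mul_assoc]
    exact mul_le_mul_of_nonneg_left (mul_le_mul_of_nonneg_left (hv i) (hφ.optDensity_nonneg _))
      (by positivity)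
  have h6 : ‖∑ i, (1 / m * (optDensity φ ((f i - μ') / η) - optDensity φ ((f i - μ) / η))) • d i‖
      ≤ B * searchError φ κ η G N := by
    refine (norm_sum_smul_le _ d hd).trans ?_
    rw [mul_comm]
    refine mul_le_mul_of_nonneg_left (le_trans ?_ h2) hB
    refine le_trans (le_of_eq ?_) (hφ.sum_abs_optDensity_shift_le hη f hm μ' μ)
    rw [Finset.mul_sum]
    refine Finset.sum_congr rfl fun i _ => ?_
    rw [abs_mul, abs_of_nonneg (by positivity)]
  have h7 := neg_le_of_abs_le ((abs_real_inner_le_norm _ v).trans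
    (mul_le_mul_of_nonneg_right h6 (norm_nonneg v)))
  rw [e, inner_add_left]
  have h8 : 1 / (m : ℝ) * ∑ i, optDensity φ ((f i - μ) / η) * (f' i - f i)
      = -(1 / m * ∑ i, optDensity φ ((f i - μ) / η) * (f i - f' i)) := by
    rw [← mul_neg, ← Finset.sum_neg_distrib]
    congr 1
    exact Finset.sum_congr rfl fun i _ => by ring
  linarith

/-- Since the weights are monotone in the multiplier, a change of the multiplier changes all of them
in the same direction. -/
theorem sum_abs_optDensity_sub_eq (f : Fin m → ℝ) (μ μ' : ℝ) :
    1 / m * ∑ i, |optDensity φ ((f i - μ) / η) - optDensity φ ((f i - μ') / η)|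
      = |massGap φ η f μ - massGap φ η f μ'| := by
  have key : ∀ a b : ℝ, a ≤ b →
      1 / m * ∑ i, |optDensity φ ((f i - a) / η) - optDensity φ ((f i - b) / η)|
        = |massGap φ η f a - massGap φ η f b| := by
    intro a b h
    rw [abs_of_nonneg (sub_nonneg.2 (hφ.massGap_antitone hη f h))]
    have : ∀ i, |optDensity φ ((f i - a) / η) - optDensity φ ((f i - b) / η)|
        = optDensity φ ((f i - a) / η) - optDensity φ ((f i - b) / η) := fun i =>
      abs_of_nonneg (sub_nonneg.2 (hφ.antitone_optDensity_sub hη (f i) h))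
    simp only [this, massGap, Finset.sum_sub_distrib]
    ring
  rcases le_total μ μ' with h | h
  · exact key μ μ' h
  · rw [abs_sub_comm, ← key μ' μ h]
    simp only [abs_sub_comm]

/-- At a root of the full problem the violations of the halves are opposite. Both are monotone in
the multiplier, so the first lies between its own value at `μ'` and minus the value of the second
there. The random root can thus be replaced by a deterministic multiplier. -/
theorem abs_massGap_half_le {ℓ : ℕ} (f : Fin (2 ^ (ℓ + 1)) → ℝ) {μ : ℝ}
    (hμ : massGap φ η f μ = 0) (μ' : ℝ) :
    |massGap φ η (firstHalf f) μ|
        ≤ |massGap φ η (firstHalf f) μ'| + |massGap φ η (secondHalf f) μ'| ∧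
      |massGap φ η (secondHalf f) μ|
        ≤ |massGap φ η (firstHalf f) μ'| + |massGap φ η (secondHalf f) μ'| := by
  rw [massGap_halves] at hμ
  have e : massGap φ η (secondHalf f) μ = -massGap φ η (firstHalf f) μ := by linarith
  rw [e, abs_neg, and_self]
  have a1 := abs_nonneg (massGap φ η (firstHalf f) μ')
  have a2 := abs_nonneg (massGap φ η (secondHalf f) μ')
  have b1 := le_abs_self (massGap φ η (firstHalf f) μ')
  have b2 := le_abs_self (massGap φ η (secondHalf f) μ')
  have b3 := neg_abs_le (massGap φ η (firstHalf f) μ')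
  have b4 := neg_abs_le (massGap φ η (secondHalf f) μ')
  rcases le_total μ μ' with h | h <;>
  · have h1 := hφ.massGap_antitone hη (firstHalf f) h
    have h2 := hφ.massGap_antitone hη (secondHalf f) h
    rw [abs_le]
    constructor <;> linarith

theorem norm_half_difference_le {H : Type*} [NormedAddCommGroup H] [NormedSpace ℝ H] (N : ℕ)
    (f : Fin m → ℝ) (hm : 0 < m) {G : ℝ} (hG : ∀ i j, f i - f j ≤ G) {d : Fin m → H} {B : ℝ}
    (hB : 0 ≤ B) (hd : ∀ i, ‖d i‖ ≤ B) (μ : ℝ) :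
    ‖∑ i, (1 / m * optDensity φ ((f i - μ) / η)) • d i - ∑ i, bisectWeights φ η N f i • d i‖
      ≤ (|massGap φ η f μ| + searchError φ κ η G N) * B := by
  have e : ∑ i, (1 / m * optDensity φ ((f i - μ) / η)) • d i - ∑ i, bisectWeights φ η N f i • d i
      = ∑ i, (1 / m * (optDensity φ ((f i - μ) / η)
          - optDensity φ ((f i - (bisect φ η N f).mu) / η))) • d i := by
    rw [← Finset.sum_sub_distrib]
    refine Finset.sum_congr rfl fun i _ => ?_
    rw [bisectWeights_eq, ← sub_smul, mul_sub]
  rw [e]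
  refine (norm_sum_smul_le _ d hd).trans (mul_le_mul_of_nonneg_right ?_ hB)
  have h1 : ∑ i, |1 / (m : ℝ) * (optDensity φ ((f i - μ) / η)
          - optDensity φ ((f i - (bisect φ η N f).mu) / η))|
      = |massGap φ η f μ - massGap φ η f (bisect φ η N f).mu| := by
    rw [← hφ.sum_abs_optDensity_sub_eq hη f, Finset.mul_sum]
    refine Finset.sum_congr rfl fun i _ => ?_
    rw [abs_mul, abs_of_nonneg (by positivity)]
  rw [h1]
  have := hφ.abs_massGap_bisect_le hη N f hm hG
  have := abs_sub (massGap φ η f μ) (massGap φ η f (bisect φ η N f).mu)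
  linarith

/-- The difference between a weighted sum and the mean of those of the two halves is small if the
constraint is nearly satisfied by both halves at a common multiplier. -/
theorem norm_levelDifference_le {H : Type*} [NormedAddCommGroup H] [NormedSpace ℝ H] (N : ℕ)
    {ℓ : ℕ} (f : Fin (2 ^ (ℓ + 1)) → ℝ) {G : ℝ} (hG : ∀ i j, f i - f j ≤ G)
    {d : Fin (2 ^ (ℓ + 1)) → H} {B : ℝ} (hB : 0 ≤ B) (hd : ∀ i, ‖d i‖ ≤ B) (μ : ℝ) :
    ‖∑ i, bisectWeights φ η N f i • d i
        - (1 / 2 : ℝ) • (∑ i, bisectWeights φ η N (firstHalf f) i • firstHalf d i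
          + ∑ i, bisectWeights φ η N (secondHalf f) i • secondHalf d i)‖
      ≤ B * (|massGap φ η (firstHalf f) μ| + |massGap φ η (secondHalf f) μ|
          + 2 * searchError φ κ η G N) := by
  have hm : 0 < 2 ^ (ℓ + 1) := by positivity
  have hm2 : 0 < 2 ^ ℓ := by positivity
  obtain ⟨μ₀, h1, h2⟩ := hφ.exists_root_searchError hη N f hm hG
  obtain ⟨h3, h4⟩ := hφ.abs_massGap_half_le hη f h1 μ
  set μ₁ := (bisect φ η N f).mu
  have h : ((2 ^ (ℓ + 1) : ℕ) : ℝ) = 2 * ((2 ^ ℓ : ℕ) : ℝ) := by push_cast; ring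
  -- The normalization of the full problem is half that of a half. The difference therefore
  -- compares, within each half, the weights at the multiplier found for the whole with those at the
  -- half's own multiplier.
  have e : ∑ i, bisectWeights φ η N f i • d i
      = (1 / 2 : ℝ) • (∑ i, (1 / ((2 ^ ℓ : ℕ) : ℝ) * optDensity φ ((firstHalf f i - μ₁) / η))
            • firstHalf d i
          + ∑ i, (1 / ((2 ^ ℓ : ℕ) : ℝ) * optDensity φ ((secondHalf f i - μ₁) / η))
            • secondHalf d i) := by
    rw [sum_halves, smul_add, Finset.smul_sum, Finset.smul_sum]
    congr 1 <;>
    · refine Finset.sum_congr rfl fun i _ => ?_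
      simp only [firstHalf, secondHalf, bisectWeights_eq]
      rw [h, smul_smul]
      congr 1
      ring
  have n1 := hφ.norm_half_difference_le hη N (firstHalf f) hm2 (fun i j => hG _ _) hB
    (d := firstHalf d) (fun i => hd _) μ₁
  have n2 := hφ.norm_half_difference_le hη N (secondHalf f) hm2 (fun i j => hG _ _) hB
    (d := secondHalf d) (fun i => hd _) μ₁
  have g1 := hφ.abs_massGap_sub_le hη (firstHalf f) hm2 μ₁ μ₀
  have g2 := hφ.abs_massGap_sub_le hη (secondHalf f) hm2 μ₁ μ₀
  have g3 := abs_sub_abs_le_abs_sub (massGap φ η (firstHalf f) μ₁) (massGap φ η (firstHalf f) μ₀)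
  have g4 := abs_sub_abs_le_abs_sub (massGap φ η (secondHalf f) μ₁)
    (massGap φ η (secondHalf f) μ₀)
  rw [e, ← smul_sub, add_sub_add_comm, norm_smul, Real.norm_eq_abs, abs_of_nonneg (by norm_num)]
  have n3 := (norm_add_le _ _).trans (add_le_add n1 n2)
  have : (|massGap φ η (firstHalf f) μ₁| + |massGap φ η (secondHalf f) μ₁|) * B
    ≤ (2 * (|massGap φ η (firstHalf f) μ| + |massGap φ η (secondHalf f) μ|)
      + 2 * searchError φ κ η G N) * B := mul_le_mul_of_nonneg_right (by linarith) hB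
  nlinarith

/-! ### Measurability of the search -/

omit hη in
theorem measurable_bisect (N : ℕ) :
    Measurable (fun f : Fin m → ℝ => (bisect φ η N f).lo) ∧
    Measurable (fun f : Fin m → ℝ => (bisect φ η N f).hi) ∧
    Measurable (fun f : Fin m → ℝ => (bisect φ η N f).mu) := by
  induction N with
  | zero =>
    have h1 : Measurable fun f : Fin m → ℝ => ⨅ i, f i := Measurable.iInf fun i => by fun_prop
    have h2 : Measurable fun f : Fin m → ℝ => ⨆ i, f i := Measurable.iSup fun i => by fun_prop
    refine ⟨h1, ?_, h1⟩
    simp only [bisect, Function.iterate_zero, id, bisectInit]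
    split_ifs <;> fun_prop
  | succ N ih =>
    obtain ⟨h1, h2, h3⟩ := ih
    have hg := hφ.continuous_optDensity.measurable
    have hmid : Measurable fun f : Fin m → ℝ => ((bisect φ η N f).lo + (bisect φ η N f).hi) / 2 :=
      (h1.add h2).div_const 2
    have hh : MeasurableSet {f : Fin m → ℝ | ∑ i, multiplierWeight φ η m
        (((bisect φ η N f).lo + (bisect φ η N f).hi) / 2) (f i) - 1 ≤ 0} := by
      refine measurableSet_le ?_ measurable_const
      simp only [multiplierWeight_eq]
      exact (Finset.measurable_fun_sum _ fun i _ => measurable_const.mul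
        (hg.comp (((measurable_pi_apply i).sub hmid).div_const η))).sub_const 1
    have e : ∀ f : Fin m → ℝ, bisect φ η (N + 1) f = bisectStep φ η f (bisect φ η N f) :=
      fun f => Function.iterate_succ_apply' _ _ _
    simp only [e, bisectStep]
    refine ⟨?_, ?_, ?_⟩
    · simp only [apply_ite BisectState.lo]
      exact Measurable.ite hh h1 hmid
    · simp only [apply_ite BisectState.hi]
      exact Measurable.ite hh hmid h2
    · simp only [apply_ite BisectState.mu, ite_self]
      exact hmid

omit hη in
theorem measurable_bisectWeights (N : ℕ) (i : Fin m) :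
    Measurable fun f : Fin m → ℝ => bisectWeights φ η N f i := by
  simp only [bisectWeights_eq]
  exact measurable_const.mul (hφ.continuous_optDensity.measurable.comp
    (((measurable_pi_apply i).sub (hφ.measurable_bisect N).2.2).div_const η))

end IsDivergence

end SearchWeights

/-! ### The variance of the constraint violation -/

section GapVariance

variable {φ : ℝ → ℝ≥0∞} {κ η : ℝ} {E : Type*} [MeasurableSpace E]

/-- At the population root the violation is a centred mean of `m` independent copies of a variable
whose range has length at most (b - a)/(ηκ), so its second moment is a variance divided by `m`. -/
theorem IsDivergence.integral_massGap_sq_le (hφ : IsDivergence φ κ) (hη : 0 < η) {ν : Measure E}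
    [IsProbabilityMeasure ν] {f : E → ℝ} (hf : Measurable f) {a b : ℝ} (hle : a ≤ b)
    (hab : ∀ᵐ x ∂ν, f x ∈ Set.Icc a b) {μ : ℝ}
    (hμ : ∫ x, optDensity φ ((f x - μ) / η) ∂ν = 1) {m : ℕ} (hm : 0 < m) :
    Integrable (fun w => massGap φ η (fun i => f (w i)) μ ^ 2) (Measure.pi fun _ : Fin m => ν) ∧
    ∫ w, massGap φ η (fun i => f (w i)) μ ^ 2 ∂(Measure.pi fun _ : Fin m => ν)
      ≤ ((b - a) / (η * κ)) ^ 2 / m := by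
  have hk := hφ.modulus_pos
  have hm' : (0 : ℝ) < m := by exact_mod_cast hm
  have hco := hφ.continuous_optDensity
  set X : E → ℝ := fun x => optDensity φ ((f x - μ) / η)
  have hXm : Measurable X := hco.measurable.comp ((hf.sub_const μ).div_const η)
  have hX : ∀ᵐ x ∂ν, X x ∈ Set.Icc (optDensity φ ((a - μ) / η)) (optDensity φ ((b - μ) / η)) := by
    filter_upwards [hab] with x hx
    exact ⟨hφ.optDensity_mono (by gcongr; exact hx.1), hφ.optDensity_mono (by gcongr; exact hx.2)⟩
  have hX2 : MemLp X 2 ν := memLp_of_bounded hX hXm.aestronglyMeasurable 2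
  have hv : variance X ν ≤ ((b - a) / (η * κ)) ^ 2 := by
    refine (variance_le_sq_of_bounded hX hXm.aemeasurable).trans ?_
    have h0 := hφ.optDensity_mono (show (a - μ) / η ≤ (b - μ) / η by gcongr)
    have h1 := (le_abs_self _).trans (hφ.abs_optDensity_sub_le ((b - μ) / η) ((a - μ) / η))
    have h2 : |(b - μ) / η - (a - μ) / η| / κ = (b - a) / (η * κ) := by
      have := sub_nonneg.2 hle
      rw [← sub_div, sub_sub_sub_cancel_right, abs_of_nonneg (by positivity)]
      field_simp
    rw [h2] at h1
    refine pow_le_pow_left₀ (by linarith) ?_ 2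
    linarith
  have hs := variance_sum_pi (ι := Fin m) (μ := fun _ => ν) (X := fun _ => X) fun _ => hX2
  have hint : ∀ i : Fin m, Integrable (fun w : Fin m → E => X (w i)) (Measure.pi fun _ => ν) :=
    fun i => ((measurePreserving_eval (fun _ : Fin m => ν) i).integrable_comp
      hXm.aestronglyMeasurable).2 (hX2.integrable (by norm_num))
  have hmean : ∫ w, (∑ i, fun w : Fin m → E => X (w i)) w ∂(Measure.pi fun _ : Fin m => ν) = m := by
    simp only [Finset.sum_apply]
    rw [integral_finsetSum _ fun i _ => hint i]
    have : ∀ i : Fin m, ∫ w : Fin m → E, X (w i) ∂(Measure.pi fun _ => ν) = 1 := fun i => by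
      have h := measurePreserving_eval (fun _ : Fin m => ν) i
      rw [← hμ]
      conv_rhs => rw [← h.map_eq]
      exact (integral_map h.aemeasurable hXm.aestronglyMeasurable).symm
    simp [this]
  rw [variance_eq_integral (by fun_prop), hmean] at hs
  have e : ∀ w : Fin m → E, massGap φ η (fun i => f (w i)) μ ^ 2
      = 1 / (m : ℝ) ^ 2 * ((∑ i, fun w : Fin m → E => X (w i)) w - m) ^ 2 := by
    intro w
    simp only [Finset.sum_apply, massGap, X]
    field_simp
  simp only [e]
  have hY : MemLp (∑ i, fun w : Fin m → E => X (w i)) 2 (Measure.pi fun _ : Fin m => ν) :=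
    memLp_finsetSum' _ fun i _ =>
      hX2.comp_measurePreserving (measurePreserving_eval (fun _ : Fin m => ν) i)
  refine ⟨((hY.sub (memLp_const (m : ℝ))).integrable_sq).const_mul _, ?_⟩
  rw [integral_const_mul, hs, Finset.sum_const, Finset.card_univ, Fintype.card_fin, nsmul_eq_mul]
  rw [show 1 / (m : ℝ) ^ 2 * (m * variance X ν) = variance X ν / m by field_simp]
  gcongr

end GapVariance

end AdvRobust

namespace AdvRobust

set_option linter.unusedSectionVars false

namespace Problem

variable {E : Type*} [NormedAddCommGroup E] [NormedSpace ℝ E] [FiniteDimensional ℝ E]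
  [MeasureSpace E] [BorelSpace E] [(volume : Measure E).IsAddHaarMeasure] {n : ℕ}
  {p : Problem E n} {φ : ℝ → ℝ≥0∞} {κ η Lf C : ℝ} {G : ℝ≥0}

/-! ### The gradient estimate of one level -/

theorem measurable_approxGrad (hφ : IsDivergence φ κ) (hp : p.WellPosed φ η) (N m : ℕ) :
    Measurable fun q : Param n × (Fin m → E) => p.approxGrad φ η N q.1 q.2 := by
  unfold approxGrad
  have h : ∀ i : Fin m, Measurable fun q : Param n × (Fin m → E) => (q.1, q.2 i) := fun i =>
    measurable_fst.prodMk ((measurable_pi_apply i).comp measurable_snd)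
  have hf : Measurable fun (q : Param n × (Fin m → E)) (j : Fin m) => p.f q.1 (q.2 j) :=
    measurable_pi_lambda _ fun j => hp.measurable_f.comp (h j)
  exact Finset.measurable_fun_sum _ fun i _ =>
    ((hφ.measurable_bisectWeights N i).comp hf).smul (hp.measurable_grad.comp (h i))

theorem measurable_f_apply (hp : p.WellPosed φ η) (θ : Param n) : Measurable (p.f θ) :=
  hp.measurable_f.comp measurable_prodMk_left

/-- The points at which the loss may be queried: they lie in `Z`, and the range of the values of the
loss is at most `G`. -/
def GoodSample (p : Problem E n) (G : ℝ) (θ : Param n) {m : ℕ} (w : Fin m → E) : Prop :=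
  (∀ i, w i ∈ p.Z) ∧ ∀ i j, p.f θ (w i) - p.f θ (w j) ≤ G

theorem measurableSet_goodSample (hp : p.WellPosed φ η) (G : ℝ) (θ : Param n) (m : ℕ) :
    MeasurableSet {w : Fin m → E | p.GoodSample G θ w} := by
  have hf := measurable_f_apply hp θ
  simp only [GoodSample, Set.ofPred_and, Set.ofPred_forall]
  exact (MeasurableSet.iInter fun i => measurable_pi_apply i hp.measurable_Z).inter
    (MeasurableSet.iInter fun i => MeasurableSet.iInter fun j =>
      measurableSet_le (by fun_prop) measurable_const)

theorem Assumptions.exists_bounds (hp : p.Assumptions φ η Lf C G) {θ : Param n} (hθ : θ ∈ p.Θ)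
    {z : E} (hz : z ∈ p.P.support) :
    ∃ a b : ℝ, a ≤ b ∧ b - a ≤ G ∧ ∀ᵐ x ∂p.ν z, p.f θ x ∈ Set.Icc a b := by
  have := hp.wellPosed.isProbabilityMeasure_ν hz
  have hf := measurable_f_apply hp.wellPosed θ
  have : IsProbabilityMeasure ((p.ν z).map (p.f θ)) :=
    Measure.isProbabilityMeasure_map hf.aemeasurable
  obtain ⟨a, b, hle, hG, hq⟩ := exists_quantile_bounds (hp.invCdf θ hθ z hz)
  exact ⟨a, b, hle, hG, ae_of_ae_map hf.aemeasurable (ae_mem_Icc_of_invCdf hq)⟩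

theorem Assumptions.ae_goodSample (hp : p.Assumptions φ η Lf C G) {θ : Param n} (hθ : θ ∈ p.Θ)
    {z : E} (hz : z ∈ p.P.support) (m : ℕ) :
    ∀ᵐ w ∂(Measure.pi fun _ : Fin m => p.ν z), p.GoodSample G θ w := by
  have := hp.wellPosed.isProbabilityMeasure_ν hz
  obtain ⟨a, b, -, hG, hab⟩ := hp.exists_bounds hθ hz
  have h : ∀ᵐ w ∂(Measure.pi fun _ : Fin m => p.ν z), ∀ i, w i ∈ p.Z ∧ p.f θ (w i) ∈ Set.Icc a b :=
    ae_all_iff.2 fun i => (Measure.quasiMeasurePreserving_eval (fun _ : Fin m => p.ν z) i).ae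
      ((hp.wellPosed.ae_mem_Z z).and hab)
  filter_upwards [h] with w hw
  exact ⟨fun i => (hw i).1, fun i j => by linarith [(hw i).2.2, (hw j).2.1]⟩

theorem Assumptions.searchGapLE (hφ : IsDivergence φ κ) (hη : 0 < η)
    (hp : p.Assumptions φ η Lf C G) {N : ℕ} (L : ℕ) {ε : ℝ}
    (hε : (bisectWidth φ η G / 2 ^ N) ^ 2 / (η * κ) ≤ ε) : p.SearchGapLE φ η N L ε := by
  intro θ hθ z hz ℓ _
  filter_upwards [hp.ae_goodSample hθ hz (2 ^ ℓ)] with w hw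
  exact hφ.bisect_gap hη N _ (by positivity) hw.2 hε

theorem Assumptions.norm_approxGrad_le (hφ : IsDivergence φ κ) (hη : 0 < η) (hLf : 0 ≤ Lf)
    (hp : p.Assumptions φ η Lf C G) {θ : Param n} (hθ : θ ∈ p.Θ) (N : ℕ) {m : ℕ} (hm : 0 < m)
    {w : Fin m → E} (hw : p.GoodSample G θ w) :
    ‖p.approxGrad φ η N θ w‖ ≤ Lf * (1 + searchError φ κ η G N) :=
  hφ.norm_bisectWeights_sum_le hη N _ hm hw.2 hLf fun i => hp.oracle.norm_le _ (hw.1 i) θ hθ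

theorem Assumptions.dualValue_sub_le (hφ : IsDivergence φ κ) (hη : 0 < η)
    (hp : p.Assumptions φ η Lf C G) {θ θs : Param n} (hθ : θ ∈ p.Θ) (hθs : θs ∈ p.Θ) (N : ℕ)
    {m : ℕ} (hm : 0 < m) {w : Fin m → E} (hw : p.GoodSample G θ w) :
    dualValue φ η (fun i => p.f θ (w i)) - dualValue φ η (fun i => p.f θs (w i))
        - Lf * searchError φ κ η G N * ‖θ - θs‖
      ≤ inner ℝ (p.approxGrad φ η N θ w) (θ - θs) := by
  refine hφ.dualValue_sub_le_inner hη N _ _ hm hw.2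
    (fun i => hp.oracle.norm_le _ (hw.1 i) θ hθ) _ fun i => ?_
  have := hp.oracle.subgradient _ (hw.1 i) θ hθ θs hθs
  rw [← neg_sub θ θs, inner_neg_right] at this
  linarith

/-- The mean of the gradient estimate is an approximate subgradient of the objective. -/
theorem Assumptions.le_integral_inner_approxGrad (hφ : IsDivergence φ κ) (hη : 0 < η)
    (hLf : 0 ≤ Lf) (hp : p.Assumptions φ η Lf C G) {θ θs : Param n} (hθ : θ ∈ p.Θ)
    (hθs : θs ∈ p.Θ) (N ℓ : ℕ) :
    Integrable (fun ζ : Sample E ℓ => inner ℝ (p.approxGrad φ η N θ ζ.2) (θ - θs))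
      (p.sampleLaw ℓ) ∧
    p.F φ η θ - p.F φ η θs - (G / 2 ^ ℓ + Lf * searchError φ κ η G N * ‖θ - θs‖)
      ≤ ∫ ζ, inner ℝ (p.approxGrad φ η N θ ζ.2) (θ - θs) ∂(p.sampleLaw ℓ) := by
  have := hp.wellPosed.isProb
  have hm : 0 < 2 ^ ℓ := by positivity
  have hmeas : Measurable fun w : Fin (2 ^ ℓ) → E =>
      (inner ℝ (p.approxGrad φ η N θ w) (θ - θs) : ℝ) :=
    ((measurable_approxGrad hφ hp.wellPosed N _).comp measurable_prodMk_left).inner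
      measurable_const
  have hbd : ∀ w : Fin (2 ^ ℓ) → E, p.GoodSample G θ w →
      |inner ℝ (p.approxGrad φ η N θ w) (θ - θs)|
        ≤ Lf * (1 + searchError φ κ η G N) * ‖θ - θs‖ := fun w hw =>
    (abs_real_inner_le_norm _ _).trans
      (mul_le_mul_of_nonneg_right (hp.norm_approxGrad_le hφ hη hLf hθ N hm hw) (norm_nonneg _))
  obtain ⟨h1, h2, h3⟩ := integral_sampleLaw hp.wellPosed ℓ hmeas fun z hz =>
    (hp.ae_goodSample hθ hz (2 ^ ℓ)).mono hbd
  refine ⟨h1, ?_⟩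
  have hR := hp.wellPosed.integrable_R θ hθ
  have hRs := hp.wellPosed.integrable_R θs hθs
  have hRR : Integrable (fun z => p.R φ η θ z - p.R φ η θs z) p.P := hR.sub hRs
  set e := (G : ℝ) / 2 ^ ℓ + Lf * searchError φ κ η G N * ‖θ - θs‖ with he
  have hF : p.F φ η θ - p.F φ η θs - e = ∫ z, (p.R φ η θ z - p.R φ η θs z - e) ∂p.P := by
    rw [integral_sub hRR (integrable_const _), integral_sub hR hRs]
    simp [F]
  rw [h3, hF]
  refine integral_mono_ae ((hR.sub hRs).sub (integrable_const _)) h2 ?_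
  filter_upwards [WellPosed.ae_mem_support p] with z hz
  have := hp.wellPosed.isProbabilityMeasure_ν hz
  have hf := measurable_f_apply hp.wellPosed θ
  have hfs := measurable_f_apply hp.wellPosed θs
  obtain ⟨a, b, hle, -, hab⟩ := hp.exists_bounds hθ hz
  obtain ⟨as, bs, hles, -, habs⟩ := hp.exists_bounds hθs hz
  obtain ⟨μ, -, hμ⟩ := hφ.exists_popRoot hη hf hab hle
  obtain ⟨μs, -, hμs⟩ := hφ.exists_popRoot hη hfs habs hles
  obtain ⟨i1, -⟩ := hφ.integral_dualValue_le hη hf hab hμ hm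
  obtain ⟨i2, u2⟩ := hφ.integral_dualValue_le hη hfs habs hμs hm
  -- The sampled value underestimates the population value, so the bias costs only at `θ`; at `θs`
  -- it has the favourable sign.
  have u1 := hφ.robustValue_sub_le hη hf (hp.invCdf θ hθ z hz) hm
  have hb : (G : ℝ) / ((2 ^ ℓ : ℕ) + 1) ≤ G / 2 ^ ℓ := by
    push_cast
    exact div_le_div_of_nonneg_left G.2 (by positivity) (by linarith)
  have hint : Integrable (fun w : Fin (2 ^ ℓ) → E =>
      (inner ℝ (p.approxGrad φ η N θ w) (θ - θs) : ℝ)) (Measure.pi fun _ => p.ν z) :=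
    Integrable.of_bound hmeas.aestronglyMeasurable _
      ((hp.ae_goodSample hθ hz (2 ^ ℓ)).mono hbd)
  have i12 : Integrable (fun w : Fin (2 ^ ℓ) → E => dualValue φ η (fun i => p.f θ (w i))
      - dualValue φ η (fun i => p.f θs (w i))) (Measure.pi fun _ => p.ν z) := i1.sub i2
  have key := integral_mono_ae (i12.sub (integrable_const _)) hint
    ((hp.ae_goodSample hθ hz (2 ^ ℓ)).mono fun w hw =>
      hp.dualValue_sub_le hφ hη hθ hθs N hm hw)
  simp only [Pi.sub_apply] at key
  rw [integral_sub i12 (integrable_const _), integral_sub i1 i2] at key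
  simp only [integral_const, probReal_univ, one_smul] at key
  change robustValue φ η (p.ν z) (p.f θ) - robustValue φ η (p.ν z) (p.f θs) - e ≤ _
  linarith

/-! ### Convexity and Lipschitz continuity of the objective -/

/-- The maximizing measure at `θ` gives an average of the loss, minus a constant, that touches the
robust loss at `θ` and lies below it on `Θ`. Convexity and the Lipschitz constant `Lf` are inherited
from it. -/
theorem Assumptions.exists_linear_minorant (hφ : IsDivergence φ κ) (hη : 0 < η)
    (hp : p.Assumptions φ η Lf C G) {θ : Param n} (hθ : θ ∈ p.Θ) {z : E}
    (hz : z ∈ p.P.support) :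
    ∃ γ : Measure E, IsProbabilityMeasure γ ∧ (∀ᵐ x ∂γ, x ∈ p.Z) ∧
      (∀ θ' ∈ p.Θ, Integrable (p.f θ') γ) ∧ ∃ c : ℝ,
      p.R φ η θ z = ∫ x, p.f θ x ∂γ - c ∧ ∀ θ' ∈ p.Θ, ∫ x, p.f θ' x ∂γ - c ≤ p.R φ η θ' z := by
  have := hp.wellPosed.isProbabilityMeasure_ν hz
  have hf := measurable_f_apply hp.wellPosed θ
  obtain ⟨a, b, hle, -, hab⟩ := hp.exists_bounds hθ hz
  obtain ⟨μ, -, hμ⟩ := hφ.exists_popRoot hη hf hab hle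
  obtain ⟨-, γ, h1, h2, c, h3, h4⟩ := hφ.exists_robust_maximizer hη hf hab hμ
  refine ⟨γ, h1, h2.ae_le (hp.wellPosed.ae_mem_Z z), fun θ' hθ' => ?_, c, h3, fun θ' hθ' => ?_⟩
  · obtain ⟨a', b', -, -, hab'⟩ := hp.exists_bounds hθ' hz
    exact integrable_comp_of_mem_Icc (measurable_f_apply hp.wellPosed θ').aemeasurable
      (h2.ae_le hab') continuous_id
  · obtain ⟨a', b', -, -, hab'⟩ := hp.exists_bounds hθ' hz
    exact h4 _ (measurable_f_apply hp.wellPosed θ') a' b' hab'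

theorem Assumptions.convexOn_R (hφ : IsDivergence φ κ) (hη : 0 < η)
    (hp : p.Assumptions φ η Lf C G) {z : E} (hz : z ∈ p.P.support) :
    ConvexOn ℝ p.Θ fun θ => p.R φ η θ z := by
  refine ⟨hp.wellPosed.convex_Θ, fun θ₁ h₁ θ₂ h₂ a b ha hb hab => ?_⟩
  have hθ := hp.wellPosed.convex_Θ h₁ h₂ ha hb hab
  obtain ⟨γ, hγ, hZ, hi, c, e, hle⟩ := hp.exists_linear_minorant hφ hη hθ hz
  have key : ∫ x, p.f (a • θ₁ + b • θ₂) x ∂γ ≤ a * ∫ x, p.f θ₁ x ∂γ + b * ∫ x, p.f θ₂ x ∂γ := by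
    rw [← integral_const_mul, ← integral_const_mul,
      ← integral_add ((hi θ₁ h₁).const_mul a) ((hi θ₂ h₂).const_mul b)]
    refine integral_mono_ae (hi _ hθ) (((hi θ₁ h₁).const_mul a).add ((hi θ₂ h₂).const_mul b)) ?_
    filter_upwards [hZ] with x hx
    exact (hp.loss.convex x hx).2 h₁ h₂ ha hb hab
  have k1 := mul_le_mul_of_nonneg_left (hle θ₁ h₁) ha
  have k2 := mul_le_mul_of_nonneg_left (hle θ₂ h₂) hb
  simp only [smul_eq_mul]
  rw [e]
  have : c = a * c + b * c := by rw [← add_mul, hab, one_mul]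
  linarith

theorem Assumptions.R_sub_le (hφ : IsDivergence φ κ) (hη : 0 < η)
    (hp : p.Assumptions φ η Lf C G) {θ θ' : Param n} (hθ : θ ∈ p.Θ) (hθ' : θ' ∈ p.Θ) {z : E}
    (hz : z ∈ p.P.support) : p.R φ η θ z - p.R φ η θ' z ≤ Lf * ‖θ - θ'‖ := by
  obtain ⟨γ, hγ, hZ, hi, c, e, hle⟩ := hp.exists_linear_minorant hφ hη hθ hz
  have key : ∫ x, p.f θ x ∂γ ≤ ∫ x, (p.f θ' x + Lf * ‖θ - θ'‖) ∂γ := by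
    refine integral_mono_ae (hi θ hθ) ((hi θ' hθ').add (integrable_const _)) ?_
    filter_upwards [hZ] with x hx
    linarith [(le_abs_self _).trans (hp.loss.lipschitz x hx θ hθ θ' hθ')]
  rw [integral_add (hi θ' hθ') (integrable_const _)] at key
  simp only [integral_const, probReal_univ, one_smul] at key
  linarith [hle θ' hθ']

theorem Assumptions.convexOn_F (hφ : IsDivergence φ κ) (hη : 0 < η)
    (hp : p.Assumptions φ η Lf C G) : ConvexOn ℝ p.Θ (p.F φ η) := by
  refine ⟨hp.wellPosed.convex_Θ, fun θ₁ h₁ θ₂ h₂ a b ha hb hab => ?_⟩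
  have i1 := (hp.wellPosed.integrable_R θ₁ h₁).const_mul a
  have i2 := (hp.wellPosed.integrable_R θ₂ h₂).const_mul b
  simp only [F, smul_eq_mul]
  rw [← integral_const_mul, ← integral_const_mul, ← integral_add i1 i2]
  refine integral_mono_ae
    (hp.wellPosed.integrable_R _ (hp.wellPosed.convex_Θ h₁ h₂ ha hb hab)) (i1.add i2) ?_
  filter_upwards [WellPosed.ae_mem_support p] with z hz
  exact (hp.convexOn_R hφ hη hz).2 h₁ h₂ ha hb hab

theorem Assumptions.abs_F_sub_le (hφ : IsDivergence φ κ) (hη : 0 < η)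
    (hp : p.Assumptions φ η Lf C G) {θ θ' : Param n} (hθ : θ ∈ p.Θ) (hθ' : θ' ∈ p.Θ) :
    |p.F φ η θ - p.F φ η θ'| ≤ Lf * ‖θ - θ'‖ := by
  have := hp.wellPosed.isProb
  have key : ∀ θ ∈ p.Θ, ∀ θ' ∈ p.Θ, p.F φ η θ - p.F φ η θ' ≤ Lf * ‖θ - θ'‖ := by
    intro θ hθ θ' hθ'
    have i1 := hp.wellPosed.integrable_R θ hθ
    have i2 := hp.wellPosed.integrable_R θ' hθ'
    simp only [F]
    rw [← integral_sub i1 i2]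
    have h := integral_mono_ae (i1.sub i2) (integrable_const (Lf * ‖θ - θ'‖)) (by
      filter_upwards [WellPosed.ae_mem_support p] with z hz
      exact hp.R_sub_le hφ hη hθ hθ' hz)
    simpa using h
  exact abs_sub_le_iff.2 ⟨key θ hθ θ' hθ', norm_sub_rev θ θ' ▸ key θ' hθ' θ hθ⟩

end Problem

end AdvRobust

namespace AdvRobust

set_option linter.unusedSectionVars false

/-! ### Truncated geometric levels -/

section LevelProb

theorem levelProb_denom (L : ℕ) : 1 ≤ 2 - (2 : ℝ)⁻¹ ^ L ∧ 2 - (2 : ℝ)⁻¹ ^ L ≤ 2 := by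
  have h1 : (2 : ℝ)⁻¹ ^ L ≤ 1 := pow_le_one₀ (by norm_num) (by norm_num)
  have h2 : 0 ≤ (2 : ℝ)⁻¹ ^ L := by positivity
  constructor <;> linarith

theorem levelProb_pos (L ℓ : ℕ) : 0 < levelProb L ℓ :=
  div_pos (by positivity) (by linarith [(levelProb_denom L).1])

/-- A level with 2^ℓ samples is drawn so rarely that it adds at most a constant to the expected
cost. -/
theorem levelProb_mul_le (L ℓ : ℕ) : levelProb L ℓ * 2 ^ ℓ ≤ 1 := by
  have h := levelProb_denom L
  unfold levelProb
  rw [div_mul_eq_mul_div, ← mul_pow, inv_mul_cancel₀ (by norm_num), one_pow]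
  exact (div_le_one (by linarith)).2 h.1

theorem inv_levelProb_le (L ℓ : ℕ) : (levelProb L ℓ)⁻¹ ≤ 2 * 2 ^ ℓ := by
  have h := levelProb_denom L
  unfold levelProb
  rw [inv_div, inv_pow 2 ℓ, div_inv_eq_mul]
  exact mul_le_mul_of_nonneg_right h.2 (by positivity)

theorem sum_levelProb (L : ℕ) : ∑ ℓ : Fin (L + 1), levelProb L ℓ = 1 := by
  have h := levelProb_denom L
  rw [Fin.sum_univ_eq_sum_range (fun ℓ => levelProb L ℓ)]
  unfold levelProb
  rw [← Finset.sum_div, geom_sum_eq (by norm_num), pow_succ]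
  rw [div_eq_one_iff_eq (by linarith)]
  ring

end LevelProb

/-! ### Measurability on disjoint unions -/

section SigmaMeasurable

variable {ι : Type*} {β : ι → Type*} [∀ i, MeasurableSpace (β i)]

theorem measurable_sigma_mk (i : ι) : Measurable (Sigma.mk i : β i → Sigma β) :=
  measurable_iff_comap_le.2 (MeasurableSpace.comap_le_iff_le_map.2 (iInf_le _ i))

theorem measurable_of_sigma {γ : Type*} [MeasurableSpace γ] {g : Sigma β → γ}
    (hg : ∀ i, Measurable fun b : β i => g ⟨i, b⟩) : Measurable g := by
  intro s hs
  exact MeasurableSpace.measurableSet_iInf.2 fun i => hg i hs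

/-- The component of index `i` of a point of a disjoint union, with a default value. -/
noncomputable def sigmaComponent (i : ι) [Inhabited (β i)] (s : Sigma β) : β i :=
  open Classical in if h : s.1 = i then h ▸ s.2 else default

theorem sigmaComponent_mk (i : ι) [Inhabited (β i)] (b : β i) : sigmaComponent i ⟨i, b⟩ = b := by
  simp [sigmaComponent]

theorem measurable_sigmaComponent (i : ι) [Inhabited (β i)] :
    Measurable (sigmaComponent i : Sigma β → β i) := by
  refine measurable_of_sigma fun j => ?_
  by_cases h : j = i
  · subst h
    simp only [sigmaComponent_mk]
    exact measurable_id
  · simp only [sigmaComponent, h, dite_false]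
    exact measurable_const

/-- Joint measurability of a function of a point of a finite disjoint union and a parameter. -/
theorem measurable_sigma_prod [Fintype ι] {α H : Type*} [MeasurableSpace α] [MeasurableSpace H]
    [AddCommMonoid H] [MeasurableAdd₂ H] [∀ i, Inhabited (β i)] {g : (i : ι) → β i → α → H}
    (hg : ∀ i, Measurable fun q : β i × α => g i q.1 q.2) :
    Measurable fun q : Sigma β × α => g q.1.1 q.1.2 q.2 := by
  classical
  have e : ∀ q : Sigma β × α, g q.1.1 q.1.2 q.2
      = ∑ i, if q.1.1 = i then g i (sigmaComponent i q.1) q.2 else 0 := by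
    rintro ⟨⟨i, b⟩, a⟩
    simp [sigmaComponent_mk]
  simp only [e]
  refine Finset.measurable_fun_sum _ fun i _ => Measurable.ite ?_ ?_ measurable_const
  · have : MeasurableSet {s : Sigma β | s.1 = i} := by
      refine MeasurableSpace.measurableSet_iInf.2 fun j => ?_
      change MeasurableSet (Sigma.mk j ⁻¹' {s : Sigma β | s.1 = i})
      by_cases h : j = i <;> simp [h]
    exact measurable_fst this
  · exact (hg i).comp (((measurable_sigmaComponent i).comp measurable_fst).prodMk measurable_snd)

end SigmaMeasurable

namespace Problem

variable {E : Type*} [NormedAddCommGroup E] [NormedSpace ℝ E] [FiniteDimensional ℝ E]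
  [MeasureSpace E] [BorelSpace E] [(volume : Measure E).IsAddHaarMeasure] {n : ℕ}
  {p : Problem E n} {φ : ℝ → ℝ≥0∞} {κ η Lf C : ℝ} {G : ℝ≥0}

/-! ### The law of a level and a sample of that level -/

theorem isProbabilityMeasure_levelSampleLaw (hp : p.WellPosed φ η) (L : ℕ) :
    IsProbabilityMeasure (p.levelSampleLaw L) := by
  constructor
  have h : ∀ ℓ : Fin (L + 1), ((p.sampleLaw ℓ).map
      (fun ζ => (⟨ℓ, ζ⟩ : LevelSample E L))) Set.univ = 1 := fun ℓ => by
    have := isProbabilityMeasure_sampleLaw hp ℓ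
    rw [Measure.map_apply (measurable_sigma_mk (β := fun ℓ : Fin (L + 1) => Sample E ℓ) ℓ)
      MeasurableSet.univ, Set.preimage_univ, measure_univ]
  simp only [levelSampleLaw, Measure.finsetSum_apply, Measure.smul_apply, h, smul_eq_mul, mul_one]
  rw [← ENNReal.ofReal_sum_of_nonneg fun (ℓ : Fin (L + 1)) _ => (levelProb_pos L ℓ).le, sum_levelProb,
    ENNReal.ofReal_one]

theorem ae_levelSampleLaw (L : ℕ) {q : LevelSample E L → Prop} (hq : MeasurableSet {s | q s})
    (h : ∀ ℓ : Fin (L + 1), ∀ᵐ ζ ∂p.sampleLaw ℓ, q ⟨ℓ, ζ⟩) : ∀ᵐ s ∂p.levelSampleLaw L, q s := by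
  rw [levelSampleLaw, ae_finsetSum_measure_iff]
  intro ℓ _
  refine Measure.ae_smul_measure ?_ _
  exact (ae_map_iff (measurable_sigma_mk
    (β := fun ℓ : Fin (L + 1) => Sample E ℓ) ℓ).aemeasurable hq).2 (h ℓ)

theorem integral_levelSampleLaw (L : ℕ) {h : LevelSample E L → ℝ} (hm : Measurable h)
    (hi : ∀ ℓ : Fin (L + 1), Integrable (fun ζ => h ⟨ℓ, ζ⟩) (p.sampleLaw ℓ)) :
    ∫ s, h s ∂p.levelSampleLaw L
      = ∑ ℓ : Fin (L + 1), levelProb L ℓ * ∫ ζ, h ⟨ℓ, ζ⟩ ∂p.sampleLaw ℓ := by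
  have hmk := measurable_sigma_mk (β := fun ℓ : Fin (L + 1) => Sample E ℓ)
  rw [levelSampleLaw, integral_finsetSum_measure]
  · refine Finset.sum_congr rfl fun ℓ _ => ?_
    rw [integral_smul_measure, integral_map (hmk ℓ).aemeasurable hm.aestronglyMeasurable,
      ENNReal.toReal_ofReal (levelProb_pos L ℓ).le, smul_eq_mul]
  · intro ℓ _
    exact Integrable.smul_measure ((integrable_map_measure hm.aestronglyMeasurable
      (hmk ℓ).aemeasurable).2 (hi ℓ)) ENNReal.ofReal_ne_top

/-! ### The multilevel differences -/

theorem measurable_approxGrad_comp (hφ : IsDivergence φ κ) (hp : p.WellPosed φ η) (N m : ℕ)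
    {α : Type*} [MeasurableSpace α] {t : α → Param n} {e : α → Fin m → E}
    (ht : Measurable t) (he : Measurable e) :
    Measurable fun q => p.approxGrad φ η N (t q) (e q) := by
  have h1 : Measurable fun q => (t q, e q) := ht.prodMk he
  have h2 := (measurable_approxGrad hφ hp N m).comp h1
  exact h2

theorem measurable_levelDiff (hφ : IsDivergence φ κ) (hp : p.WellPosed φ η) (N ℓ : ℕ) :
    Measurable fun q : Sample E ℓ × Param n => p.levelDiff φ η N q.2 ℓ q.1 := by
  have hs : ∀ ℓ, Measurable fun q : Sample E ℓ × Param n => q.1.2 := fun ℓ =>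
    measurable_snd.comp measurable_fst
  cases ℓ with
  | zero => 
    have h := measurable_approxGrad_comp hφ hp N (2 ^ 0) (t := fun q : Sample E 0 × Param n => q.2) measurable_snd (hs 0)
    exact h
  | succ ℓ =>
    have h1 := measurable_approxGrad_comp hφ hp N (2 ^ (ℓ + 1)) (t := fun q : Sample E (ℓ + 1) × Param n => q.2) measurable_snd (hs (ℓ + 1))
    have h2 := measurable_approxGrad_comp hφ hp N (2 ^ ℓ) 
      (t := fun q : Sample E (ℓ + 1) × Param n => q.2) (e := fun q => firstHalf q.1.2) measurable_snd
      (measurable_pi_lambda _ fun i => (measurable_pi_apply _).comp (hs (ℓ + 1)))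
    have h3 := measurable_approxGrad_comp hφ hp N (2 ^ ℓ) 
      (t := fun q : Sample E (ℓ + 1) × Param n => q.2) (e := fun q => secondHalf q.1.2) measurable_snd
      (measurable_pi_lambda _ fun i => (measurable_pi_apply _).comp (hs (ℓ + 1)))
    exact h1.sub ((h2.add h3).const_smul (1 / 2 : ℝ))
theorem GoodSample.halves {ℓ : ℕ} {θ : Param n} {g : ℝ} {w : Fin (2 ^ (ℓ + 1)) → E}
    (hw : p.GoodSample g θ w) :
    p.GoodSample g θ (firstHalf w) ∧ p.GoodSample g θ (secondHalf w) :=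
  ⟨⟨fun _ => hw.1 _, fun _ _ => hw.2 _ _⟩, ⟨fun _ => hw.1 _, fun _ _ => hw.2 _ _⟩⟩

theorem Assumptions.norm_levelDiff_le (hφ : IsDivergence φ κ) (hη : 0 < η) (hLf : 0 ≤ Lf)
    (hp : p.Assumptions φ η Lf C G) {θ : Param n} (hθ : θ ∈ p.Θ) (N : ℕ) {ℓ : ℕ}
    {ζ : Sample E ℓ} (hw : p.GoodSample G θ ζ.2) :
    ‖p.levelDiff φ η N θ ℓ ζ‖ ≤ 2 * (Lf * (1 + searchError φ κ η G N)) := by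
  have h1 := hp.norm_approxGrad_le hφ hη hLf hθ N (by positivity) hw
  have h0 : 0 ≤ Lf * (1 + searchError φ κ η G N) := (norm_nonneg _).trans h1
  cases ℓ with
  | zero =>
    change ‖p.approxGrad φ η N θ ζ.2‖ ≤ _
    linarith
  | succ ℓ =>
    have h2 := hp.norm_approxGrad_le hφ hη hLf hθ N (by positivity) hw.halves.1
    have h3 := hp.norm_approxGrad_le hφ hη hLf hθ N (by positivity) hw.halves.2
    refine (norm_sub_le _ _).trans ?_
    rw [norm_smul, Real.norm_eq_abs, abs_of_nonneg (by norm_num)]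
    have := norm_add_le (p.approxGrad φ η N θ (firstHalf ζ.2))
      (p.approxGrad φ η N θ (secondHalf ζ.2))
    linarith

theorem Assumptions.ae_norm_levelDiff_le (hφ : IsDivergence φ κ) (hη : 0 < η) (hLf : 0 ≤ Lf)
    (hp : p.Assumptions φ η Lf C G) {θ : Param n} (hθ : θ ∈ p.Θ) (N ℓ : ℕ) :
    ∀ᵐ ζ ∂p.sampleLaw ℓ,
      ‖p.levelDiff φ η N θ ℓ ζ‖ ≤ 2 * (Lf * (1 + searchError φ κ η G N)) := by
  have h := ae_sampleLaw hp.wellPosed ℓ (measurableSet_goodSample hp.wellPosed G θ (2 ^ ℓ))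
    fun z hz => hp.ae_goodSample hθ hz (2 ^ ℓ)
  filter_upwards [h] with ζ hζ using hp.norm_levelDiff_le hφ hη hLf hθ N hζ

/-- Conditionally on `z`, the difference is controlled by the violations of the two halves at the
population root, whose second moments decay like 2^(-ℓ); the search error adds a term independent of
`ℓ`. -/
theorem Assumptions.integral_levelDiff_sq_le (hφ : IsDivergence φ κ) (hη : 0 < η) (hLf : 0 ≤ Lf)
    (hp : p.Assumptions φ η Lf C G) {θ : Param n} (hθ : θ ∈ p.Θ) (N ℓ : ℕ) :
    ∫ ζ, ‖p.levelDiff φ η N θ (ℓ + 1) ζ‖ ^ 2 ∂p.sampleLaw (ℓ + 1)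
      ≤ Lf ^ 2 * (6 * ((G / (η * κ)) ^ 2 / 2 ^ ℓ) + 12 * searchError φ κ η G N ^ 2) := by
  have := hp.wellPosed.isProb
  have hk := hφ.modulus_pos
  set e := searchError φ κ η G N
  set h : (Fin (2 ^ (ℓ + 1)) → E) → ℝ := fun w => ‖p.levelDiff φ η N θ (ℓ + 1) (0, w)‖ ^ 2
  have hm : Measurable h := by
    have h1 : Measurable fun w : Fin (2 ^ (ℓ + 1)) → E =>
        (((0, w) : Sample E (ℓ + 1)), θ) := by fun_prop
    exact (((measurable_levelDiff hφ hp.wellPosed N (ℓ + 1)).comp h1).norm).pow_const 2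
  have hbd : ∀ z ∈ p.P.support, ∀ᵐ w ∂(Measure.pi fun _ : Fin (2 ^ (ℓ + 1)) => p.ν z),
      |h w| ≤ (2 * (Lf * (1 + e))) ^ 2 := fun z hz => by
    filter_upwards [hp.ae_goodSample hθ hz (2 ^ (ℓ + 1))] with w hw
    rw [abs_of_nonneg (by positivity)]
    exact pow_le_pow_left₀ (norm_nonneg _)
      (hp.norm_levelDiff_le hφ hη hLf hθ N (ζ := ((0, w) : Sample E (ℓ + 1))) hw) 2
  obtain ⟨-, h2, h3⟩ := integral_sampleLaw hp.wellPosed (ℓ + 1) hm hbd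
  change ∫ ζ : Sample E (ℓ + 1), h ζ.2 ∂_ ≤ _
  rw [h3]
  have hconst : ∀ c : ℝ, ∫ _z, c ∂p.P = c := fun c => by simp
  rw [← hconst (Lf ^ 2 * (6 * ((G / (η * κ)) ^ 2 / 2 ^ ℓ) + 12 * e ^ 2))]
  refine integral_mono_ae h2 (integrable_const _) ?_
  filter_upwards [WellPosed.ae_mem_support p] with z hz
  have := hp.wellPosed.isProbabilityMeasure_ν hz
  have hf := measurable_f_apply hp.wellPosed θ
  obtain ⟨a, b, hle, hG, hab⟩ := hp.exists_bounds hθ hz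
  obtain ⟨μ, -, hμ⟩ := hφ.exists_popRoot hη hf hab hle
  obtain ⟨i0, u0⟩ := hφ.integral_massGap_sq_le hη hf hle hab hμ (m := 2 ^ ℓ) (by positivity)
  set A : (Fin (2 ^ ℓ) → E) → ℝ := fun w => massGap φ η (fun i => p.f θ (w i)) μ ^ 2
  have u1 : ∫ w, A w ∂(Measure.pi fun _ : Fin (2 ^ ℓ) => p.ν z) ≤ (G / (η * κ)) ^ 2 / 2 ^ ℓ := by
    refine u0.trans ?_
    push_cast
    have := sub_nonneg.2 hle
    gcongr
  have half : ∀ g : (Fin (2 ^ (ℓ + 1)) → E) → Fin (2 ^ ℓ) → E,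
      MeasurePreserving g (Measure.pi fun _ => p.ν z) (Measure.pi fun _ => p.ν z) →
      Integrable (fun w => A (g w)) (Measure.pi fun _ => p.ν z) ∧
      ∫ w, A (g w) ∂(Measure.pi fun _ => p.ν z) ≤ (G / (η * κ)) ^ 2 / 2 ^ ℓ := by
    intro g hg
    refine ⟨(hg.integrable_comp i0.aestronglyMeasurable).2 i0, le_trans (le_of_eq ?_) u1⟩
    conv_rhs => rw [← hg.map_eq]
    refine (integral_map hg.aemeasurable ?_).symm
    rw [hg.map_eq]
    exact i0.aestronglyMeasurable
  obtain ⟨i1, v1⟩ := half firstHalf (measurePreserving_firstHalf _ ℓ)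
  obtain ⟨i2, v2⟩ := half secondHalf (measurePreserving_secondHalf _ ℓ)
  have ih : Integrable h (Measure.pi fun _ => p.ν z) :=
    Integrable.of_bound hm.aestronglyMeasurable _ (hbd z hz)
  have i12 : Integrable (fun w : Fin (2 ^ (ℓ + 1)) → E => A (firstHalf w) + A (secondHalf w))
      (Measure.pi fun _ => p.ν z) := i1.add i2
  have ir : Integrable (fun w : Fin (2 ^ (ℓ + 1)) → E =>
      Lf ^ 2 * (3 * (A (firstHalf w) + A (secondHalf w)) + 12 * e ^ 2))
      (Measure.pi fun _ => p.ν z) :=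
    ((i12.const_mul 3).add (integrable_const _)).const_mul _
  have key := integral_mono_ae ih ir (by
    filter_upwards [hp.ae_goodSample hθ hz (2 ^ (ℓ + 1))] with w hw
    have h4 : ‖p.levelDiff φ η N θ (ℓ + 1) (0, w)‖
        ≤ Lf * (|massGap φ η (fun i => p.f θ (firstHalf w i)) μ|
          + |massGap φ η (fun i => p.f θ (secondHalf w i)) μ| + 2 * e) :=
      hφ.norm_levelDifference_le hη N (fun i => p.f θ (w i)) hw.2
        (d := fun i => p.grad θ (w i)) hLf (fun i => hp.oracle.norm_le _ (hw.1 i) θ hθ) μ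
    have h5 := pow_le_pow_left₀ (norm_nonneg _) h4 2
    refine h5.trans ?_
    rw [mul_pow]
    refine mul_le_mul_of_nonneg_left ?_ (sq_nonneg _)
    simp only [A]
    set x := massGap φ η (fun i => p.f θ (firstHalf w i)) μ
    set y := massGap φ η (fun i => p.f θ (secondHalf w i)) μ
    -- The constants come from (|x| + |y| + 2e)² ≤ 3(x² + y² + 4e²).
    nlinarith [sq_abs x, sq_abs y, sq_nonneg (|x| - |y|), sq_nonneg (|x| - 2 * e),
      sq_nonneg (|y| - 2 * e)])
  refine key.trans ?_
  rw [integral_const_mul, integral_add (i12.const_mul 3) (integrable_const _),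
    integral_const_mul, integral_add i1 i2]
  simp only [integral_const, probReal_univ, one_smul]
  refine mul_le_mul_of_nonneg_left ?_ (sq_nonneg _)
  linarith

end Problem

end AdvRobust

namespace AdvRobust

set_option linter.unusedSectionVars false

namespace Problem

variable {E : Type*} [NormedAddCommGroup E] [NormedSpace ℝ E] [FiniteDimensional ℝ E]
  [MeasureSpace E] [BorelSpace E] [(volume : Measure E).IsAddHaarMeasure] {n : ℕ}
  {p : Problem E n} {φ : ℝ → ℝ≥0∞} {κ η Lf C : ℝ} {G : ℝ≥0}

/-! ### The randomized multilevel estimator with batch size one -/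

/-- The importance-weighted multilevel difference of a random level. -/
noncomputable def mlmcTerm (p : Problem E n) (φ : ℝ → ℝ≥0∞) (η : ℝ) (N : ℕ) {L : ℕ}
    (s : LevelSample E L) (θ : Param n) : Param n :=
  (levelProb L s.1)⁻¹ • p.levelDiff φ η N θ s.1 s.2

theorem mlmcEstimator_one (N : ℕ) {L : ℕ} (ζ : Fin 1 → LevelSample E L) :
    p.mlmcEstimator φ η N ζ = p.mlmcTerm φ η N (ζ 0) := by
  ext1 θ
  simp [mlmcEstimator, mlmcTerm]

theorem sgEstimator_one (N : ℕ) {L : ℕ} (ζ : Fin 1 → Sample E L) :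
    p.sgEstimator φ η N ζ = fun θ => p.approxGrad φ η N θ (ζ 0).2 := by
  ext1 θ
  simp [sgEstimator]

theorem measurable_mlmcTerm (hφ : IsDivergence φ κ) (hp : p.WellPosed φ η) (N L : ℕ) :
    Measurable (Function.uncurry (p.mlmcTerm φ η N (L := L))) := by
  have : Inhabited E := ⟨0⟩
  exact measurable_sigma_prod (β := fun ℓ : Fin (L + 1) => Sample E ℓ)
    (g := fun ℓ ζ θ => (levelProb L ℓ)⁻¹ • p.levelDiff φ η N θ ℓ ζ) fun ℓ => by
      have h := (measurable_levelDiff hφ hp N ℓ).const_smul (levelProb L ℓ)⁻¹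
      exact h

theorem Assumptions.ae_norm_mlmcTerm_le (hφ : IsDivergence φ κ) (hη : 0 < η) (hLf : 0 ≤ Lf)
    (hp : p.Assumptions φ η Lf C G) {θ : Param n} (hθ : θ ∈ p.Θ) (N L : ℕ) :
    ∀ᵐ s ∂p.levelSampleLaw L,
      ‖p.mlmcTerm φ η N s θ‖ ≤ 2 * 2 ^ L * (2 * (Lf * (1 + searchError φ κ η G N))) := by
  have hm : Measurable fun s : LevelSample E L => ‖p.mlmcTerm φ η N s θ‖ :=
    ((measurable_mlmcTerm hφ hp.wellPosed N L).comp measurable_prodMk_right).norm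
  refine ae_levelSampleLaw L (measurableSet_le hm measurable_const) fun ℓ => ?_
  filter_upwards [hp.ae_norm_levelDiff_le hφ hη hLf hθ N ℓ] with ζ hζ
  change ‖(levelProb L ℓ)⁻¹ • p.levelDiff φ η N θ ℓ ζ‖ ≤ _
  have h0 := inv_pos.2 (levelProb_pos L ℓ)
  rw [norm_smul, Real.norm_eq_abs, abs_of_pos h0]
  refine mul_le_mul ((inv_levelProb_le L ℓ).trans ?_) hζ (norm_nonneg _) (by positivity)
  have : (2 : ℝ) ^ (ℓ : ℕ) ≤ 2 ^ L := pow_le_pow_right₀ (by norm_num) (Nat.lt_succ_iff.1 ℓ.2)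
  linarith

theorem Assumptions.integrable_levelDiff_sq (hφ : IsDivergence φ κ) (hη : 0 < η) (hLf : 0 ≤ Lf)
    (hp : p.Assumptions φ η Lf C G) {θ : Param n} (hθ : θ ∈ p.Θ) (N ℓ : ℕ) :
    Integrable (fun ζ => ‖p.levelDiff φ η N θ ℓ ζ‖ ^ 2) (p.sampleLaw ℓ) := by
  have := isProbabilityMeasure_sampleLaw hp.wellPosed ℓ
  have hm : Measurable fun ζ : Sample E ℓ => p.levelDiff φ η N θ ℓ ζ :=
    (measurable_levelDiff hφ hp.wellPosed N ℓ).comp measurable_prodMk_right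
  refine Integrable.of_bound (hm.norm.pow_const 2).aestronglyMeasurable
    ((2 * (Lf * (1 + searchError φ κ η G N))) ^ 2) ?_
  filter_upwards [hp.ae_norm_levelDiff_le hφ hη hLf hθ N ℓ] with ζ hζ
  rw [Real.norm_eq_abs, abs_of_nonneg (by positivity)]
  exact pow_le_pow_left₀ (norm_nonneg _) hζ 2

/-- Level `ℓ` enters with weight p_ℓ · p_ℓ⁻² ≤ 2 · 2^ℓ, which cancels the decay of its second
moment, so each of the `L` positive levels contributes a constant. The search error is not damped
and appears multiplied by 2^L. -/
theorem Assumptions.integral_mlmcTerm_sq_le (hφ : IsDivergence φ κ) (hη : 0 < η) (hLf : 0 ≤ Lf)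
    (hp : p.Assumptions φ η Lf C G) {θ : Param n} (hθ : θ ∈ p.Θ) (N L : ℕ) :
    ∫ s, ‖p.mlmcTerm φ η N s θ‖ ^ 2 ∂p.levelSampleLaw L
      ≤ Lf ^ 2 * (8 * (1 + searchError φ κ η G N) ^ 2
        + L * (24 * (G / (η * κ)) ^ 2 + 48 * (2 ^ L * searchError φ κ η G N ^ 2))) := by
  set e := searchError φ κ η G N
  have hm : Measurable fun s : LevelSample E L => ‖p.mlmcTerm φ η N s θ‖ ^ 2 :=
    ((measurable_mlmcTerm hφ hp.wellPosed N L).comp measurable_prodMk_right).norm.pow_const 2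
  have e1 : ∀ (ℓ : Fin (L + 1)) (ζ : Sample E ℓ), ‖p.mlmcTerm φ η N (⟨ℓ, ζ⟩ : LevelSample E L) θ‖ ^ 2
      = ((levelProb L ℓ)⁻¹) ^ 2 * ‖p.levelDiff φ η N θ ℓ ζ‖ ^ 2 := fun ℓ ζ => by
    rw [mlmcTerm, norm_smul, mul_pow, Real.norm_eq_abs, sq_abs]
  rw [integral_levelSampleLaw L hm fun ℓ => by
    simp only [e1]
    exact (hp.integrable_levelDiff_sq hφ hη hLf hθ N ℓ).const_mul _]
  simp only [e1, integral_const_mul]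
  have e2 : ∀ (ℓ : ℕ) (x : ℝ), levelProb L ℓ * (((levelProb L ℓ)⁻¹) ^ 2 * x)
      = (levelProb L ℓ)⁻¹ * x := fun ℓ x => by
    have := (levelProb_pos L ℓ).ne'
    field_simp
  simp only [e2]
  rw [Fin.sum_univ_succ, mul_add]
  refine add_le_add ?_ ?_
  · have := isProbabilityMeasure_sampleLaw hp.wellPosed (E := E) 0
    have h1 : ∫ ζ, ‖p.levelDiff φ η N θ 0 ζ‖ ^ 2 ∂p.sampleLaw 0 ≤ (2 * (Lf * (1 + e))) ^ 2 := by
      have h := integral_mono_ae (hp.integrable_levelDiff_sq hφ hη hLf hθ N 0)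
        (integrable_const ((2 * (Lf * (1 + e))) ^ 2)) (by
          filter_upwards [hp.ae_norm_levelDiff_le hφ hη hLf hθ N 0] with ζ hζ
          exact pow_le_pow_left₀ (norm_nonneg _) hζ 2)
      simpa using h
    have h2 := inv_levelProb_le L 0
    rw [pow_zero, mul_one] at h2
    have h3 := mul_le_mul h2 h1 (integral_nonneg fun ζ => by positivity) (by norm_num)
    refine h3.trans (le_of_eq ?_)
    ring
  · have h : ∀ ℓ : Fin L, (levelProb L (ℓ.succ : Fin (L + 1)))⁻¹
        * ∫ ζ, ‖p.levelDiff φ η N θ (ℓ.succ : Fin (L + 1)) ζ‖ ^ 2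
            ∂p.sampleLaw (ℓ.succ : Fin (L + 1))
        ≤ Lf ^ 2 * (24 * (G / (η * κ)) ^ 2 + 48 * (2 ^ L * e ^ 2)) := by
      intro ℓ
      simp only [Fin.val_succ]
      have h1 := hp.integral_levelDiff_sq_le hφ hη hLf hθ N ℓ
      have h2 := inv_levelProb_le L (ℓ + 1)
      have h3 := mul_le_mul h2 h1 (integral_nonneg fun ζ => by positivity) (by positivity)
      refine h3.trans ?_
      have h4 : (2 : ℝ) * 2 ^ ((ℓ : ℕ) + 1) * (Lf ^ 2 * (6 * ((G / (η * κ)) ^ 2 / 2 ^ (ℓ : ℕ))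
          + 12 * e ^ 2)) = Lf ^ 2 * (24 * (G / (η * κ)) ^ 2 + 48 * (2 ^ (ℓ : ℕ) * e ^ 2)) := by
        field_simp
        ring
      rw [h4]
      have h5 : (2 : ℝ) ^ (ℓ : ℕ) ≤ 2 ^ L := pow_le_pow_right₀ (by norm_num) ℓ.2.le
      gcongr
    refine (Finset.sum_le_sum fun ℓ _ => h ℓ).trans (le_of_eq ?_)
    rw [Finset.sum_const, Finset.card_univ, Fintype.card_fin, nsmul_eq_mul]
    ring

/-- A function of half of the points of a level has the law of the same function at the level
below. -/
theorem integral_sampleLaw_half (hp : p.WellPosed φ η) (ℓ : ℕ) {h : (Fin (2 ^ ℓ) → E) → ℝ}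
    (hm : Measurable h) {c : ℝ}
    (hc : ∀ z ∈ p.P.support, ∀ᵐ w ∂(Measure.pi fun _ : Fin (2 ^ ℓ) => p.ν z), |h w| ≤ c)
    {g : (Fin (2 ^ (ℓ + 1)) → E) → Fin (2 ^ ℓ) → E}
    (hg : ∀ ν : Measure E, IsProbabilityMeasure ν →
      MeasurePreserving g (Measure.pi fun _ => ν) (Measure.pi fun _ => ν)) :
    Integrable (fun ζ : Sample E (ℓ + 1) => h (g ζ.2)) (p.sampleLaw (ℓ + 1)) ∧
    ∫ ζ, h (g ζ.2) ∂p.sampleLaw (ℓ + 1) = ∫ ζ, h ζ.2 ∂p.sampleLaw ℓ := by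
  have hgm : Measurable g := (hg (Measure.dirac 0) inferInstance).measurable
  obtain ⟨i1, -, e1⟩ := integral_sampleLaw hp (ℓ + 1) (hm.comp hgm) (C := c) fun z hz => by
    have := hp.isProbabilityMeasure_ν hz
    exact (hg (p.ν z) inferInstance).quasiMeasurePreserving.ae (hc z hz)
  obtain ⟨-, -, e2⟩ := integral_sampleLaw hp ℓ hm hc
  refine ⟨i1, ?_⟩
  rw [e2]
  refine e1.trans (integral_congr_ae ?_)
  filter_upwards [WellPosed.ae_mem_support p] with z hz
  have := hp.isProbabilityMeasure_ν hz
  have hz := hg (p.ν z) inferInstance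
  conv_rhs => rw [← hz.map_eq]
  exact (integral_map hz.aemeasurable hm.aestronglyMeasurable).symm

/-- The expected multilevel differences telescope. -/
theorem Assumptions.integral_inner_mlmcTerm (hφ : IsDivergence φ κ) (hη : 0 < η) (hLf : 0 ≤ Lf)
    (hp : p.Assumptions φ η Lf C G) {θ : Param n} (hθ : θ ∈ p.Θ) (N L : ℕ) (v : Param n) :
    ∫ s, inner ℝ (p.mlmcTerm φ η N s θ) v ∂p.levelSampleLaw L
      = ∫ ζ, inner ℝ (p.approxGrad φ η N θ ζ.2) v ∂p.sampleLaw L := by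
  have hm : Measurable fun s : LevelSample E L => (inner ℝ (p.mlmcTerm φ η N s θ) v : ℝ) :=
    ((measurable_mlmcTerm hφ hp.wellPosed N L).comp measurable_prodMk_right).inner
      measurable_const
  have hA : ∀ ℓ, Measurable fun w : Fin (2 ^ ℓ) → E =>
      (inner ℝ (p.approxGrad φ η N θ w) v : ℝ) := fun ℓ =>
    ((measurable_approxGrad hφ hp.wellPosed N _).comp measurable_prodMk_left).inner
      measurable_const
  have hbd : ∀ ℓ, ∀ z ∈ p.P.support, ∀ᵐ w ∂(Measure.pi fun _ : Fin (2 ^ ℓ) => p.ν z),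
      |(inner ℝ (p.approxGrad φ η N θ w) v : ℝ)| ≤ Lf * (1 + searchError φ κ η G N) * ‖v‖ :=
    fun ℓ z hz => by
      filter_upwards [hp.ae_goodSample hθ hz (2 ^ ℓ)] with w hw
      exact (abs_real_inner_le_norm _ _).trans (mul_le_mul_of_nonneg_right
        (hp.norm_approxGrad_le hφ hη hLf hθ N (by positivity) hw) (norm_nonneg _))
  have hi : ∀ ℓ, Integrable (fun ζ : Sample E ℓ => (inner ℝ (p.levelDiff φ η N θ ℓ ζ) v : ℝ))
      (p.sampleLaw ℓ) := fun ℓ => by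
    have := isProbabilityMeasure_sampleLaw hp.wellPosed ℓ
    have hm : Measurable fun ζ : Sample E ℓ => p.levelDiff φ η N θ ℓ ζ :=
      (measurable_levelDiff hφ hp.wellPosed N ℓ).comp measurable_prodMk_right
    refine Integrable.of_bound (hm.inner measurable_const).aestronglyMeasurable
      (2 * (Lf * (1 + searchError φ κ η G N)) * ‖v‖) ?_
    filter_upwards [hp.ae_norm_levelDiff_le hφ hη hLf hθ N ℓ] with ζ hζ
    exact (norm_inner_le_norm _ _).trans (mul_le_mul_of_nonneg_right hζ (norm_nonneg _))
  have e1 : ∀ (ℓ : Fin (L + 1)) (ζ : Sample E ℓ),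
      (inner ℝ (p.mlmcTerm φ η N (⟨ℓ, ζ⟩ : LevelSample E L) θ) v : ℝ)
      = (levelProb L ℓ)⁻¹ * inner ℝ (p.levelDiff φ η N θ ℓ ζ) v := fun ℓ ζ => by
    rw [mlmcTerm, real_inner_smul_left]
  rw [integral_levelSampleLaw L hm fun ℓ => by
    simp only [e1]
    exact (hi ℓ).const_mul _]
  simp only [e1, integral_const_mul]
  have e2 : ∀ (ℓ : ℕ) (x : ℝ), levelProb L ℓ * ((levelProb L ℓ)⁻¹ * x) = x := fun ℓ x => by
    rw [← mul_assoc, mul_inv_cancel₀ (levelProb_pos L ℓ).ne', one_mul]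
  simp only [e2]
  rw [Fin.sum_univ_eq_sum_range
    (fun ℓ => ∫ ζ, (inner ℝ (p.levelDiff φ η N θ ℓ ζ) v : ℝ) ∂p.sampleLaw ℓ), Finset.sum_range_succ']
  have hs : ∀ ℓ, ∫ ζ, (inner ℝ (p.levelDiff φ η N θ (ℓ + 1) ζ) v : ℝ) ∂p.sampleLaw (ℓ + 1)
      = ∫ ζ, (inner ℝ (p.approxGrad φ η N θ ζ.2) v : ℝ) ∂p.sampleLaw (ℓ + 1)
        - ∫ ζ, (inner ℝ (p.approxGrad φ η N θ ζ.2) v : ℝ) ∂p.sampleLaw ℓ := by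
    intro ℓ
    obtain ⟨i0, -, -⟩ := integral_sampleLaw hp.wellPosed (ℓ + 1) (hA (ℓ + 1)) (hbd (ℓ + 1))
    obtain ⟨i1, h1⟩ := integral_sampleLaw_half hp.wellPosed ℓ (hA ℓ) (hbd ℓ) (g := firstHalf)
      fun ν _ => measurePreserving_firstHalf ν ℓ
    obtain ⟨i2, h2⟩ := integral_sampleLaw_half hp.wellPosed ℓ (hA ℓ) (hbd ℓ) (g := secondHalf)
      fun ν _ => measurePreserving_secondHalf ν ℓ
    have e3 : ∀ ζ : Sample E (ℓ + 1), (inner ℝ (p.levelDiff φ η N θ (ℓ + 1) ζ) v : ℝ)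
        = inner ℝ (p.approxGrad φ η N θ ζ.2) v
          - 1 / 2 * (inner ℝ (p.approxGrad φ η N θ (firstHalf ζ.2)) v
            + inner ℝ (p.approxGrad φ η N θ (secondHalf ζ.2)) v) := fun ζ => by
      rw [levelDiff, inner_sub_left, real_inner_smul_left, inner_add_left]
    have i12 : Integrable (fun ζ : Sample E (ℓ + 1) =>
        (inner ℝ (p.approxGrad φ η N θ (firstHalf ζ.2)) v : ℝ)
          + inner ℝ (p.approxGrad φ η N θ (secondHalf ζ.2)) v) (p.sampleLaw (ℓ + 1)) := i1.add i2
    simp only [e3]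
    rw [integral_sub i0 (i12.const_mul _), integral_const_mul, integral_add i1 i2, h1, h2]
    ring
  simp only [hs]
  rw [Finset.sum_range_sub
    (fun ℓ => ∫ ζ, (inner ℝ (p.approxGrad φ η N θ ζ.2) v : ℝ) ∂p.sampleLaw ℓ)]
  exact sub_add_cancel _ _

/-! ### Convergence of the two methods -/

section Convergence

variable {Ω : Type*} [MeasurableSpace Ω] {μ : Measure Ω} [IsProbabilityMeasure μ]
  {θ₁ θs : Param n} {D τ : ℝ} {T : ℕ}

theorem _root_.AdvRobust.IsIIDBatches.single {S : Type*} [MeasurableSpace S] {law : Measure S}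
    {ζ : ℕ → Ω → Fin 1 → S} (h : IsIIDBatches μ law ζ) :
    (∀ t, HasLaw (fun ω => ζ t ω 0) law μ) ∧ iIndepFun (fun t ω => ζ t ω 0) μ :=
  ⟨fun t => h.hasLaw t 0, h.indep.precomp (g := fun t : ℕ => (t, (0 : Fin 1)))
    fun _ _ h => congrArg Prod.fst h⟩

theorem Assumptions.sg_converges (hφ : IsDivergence φ κ) (hη : 0 < η) (hLf : 0 ≤ Lf)
    (hp : p.Assumptions φ η Lf C G) (hθ₁ : θ₁ ∈ p.Θ) (hθs : p.IsMinimizer φ η θs)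
    (hD : ‖θ₁ - θs‖ ≤ D) (hτ : 0 < τ) (hT : 1 ≤ T) (N L : ℕ) {ζ : ℕ → Ω → Fin 1 → Sample E L}
    (hζ : IsIIDBatches μ (p.sampleLaw L) ζ) {B δ : ℝ}
    (hB : Lf * (1 + searchError φ κ η G N) ≤ B)
    (hδ : D ^ 2 / (2 * τ * T) + τ * B ^ 2 / 2
      + (G / 2 ^ L + Lf * searchError φ κ η G N * (D + T * (τ * B))) ≤ δ) :
    p.IsDeltaOptimal φ η μ
      (fun ω => sgdOutput p.Θ τ θ₁ (fun t => p.sgEstimator φ η N (ζ t ω)) T) δ := by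
  have := isProbabilityMeasure_sampleLaw hp.wellPosed L
  have he := hφ.searchError_nonneg hη G.2 N
  obtain ⟨hl, hi⟩ := hζ.single
  have hae : ∀ θ ∈ p.Θ, ∀ᵐ s ∂p.sampleLaw L, ‖p.approxGrad φ η N θ s.2‖ ≤ B := fun θ hθ => by
    have h := ae_sampleLaw hp.wellPosed L (measurableSet_goodSample hp.wellPosed G θ (2 ^ L))
      fun z hz => hp.ae_goodSample hθ hz (2 ^ L)
    filter_upwards [h] with s hs
    exact (hp.norm_approxGrad_le hφ hη hLf hθ N (by positivity) hs).trans hB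
  have hV : Measurable (Function.uncurry fun (s : Sample E L) (θ : Param n) =>
      p.approxGrad φ η N θ s.2) := by
    have h := measurable_approxGrad_comp hφ hp.wellPosed N (2 ^ L)
      (t := fun q : Sample E L × Param n => q.2) (e := fun q => q.1.2) measurable_snd
      (measurable_snd.comp measurable_fst)
    exact h
  obtain ⟨h1, h2, h3⟩ := projSGD_converges hp.wellPosed.closed_Θ hp.wellPosed.convex_Θ hθ₁ hθs.1 hτ
    hl hi hV (hp.convexOn_F hφ hη) hLf (fun θ hθ θ' hθ' => hp.abs_F_sub_le hφ hη hθ hθ') hD hT hae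
    (M := B ^ 2) (fun θ hθ => by
      have hm : Measurable fun s : Sample E L => p.approxGrad φ η N θ s.2 :=
        measurable_approxGrad_comp hφ hp.wellPosed N _ measurable_const measurable_snd
      have hsq : ∀ᵐ s ∂p.sampleLaw L, ‖p.approxGrad φ η N θ s.2‖ ^ 2 ≤ B ^ 2 := by
        filter_upwards [hae θ hθ] with s hs using pow_le_pow_left₀ (norm_nonneg _) hs 2
      have hint : Integrable (fun s : Sample E L => ‖p.approxGrad φ η N θ s.2‖ ^ 2)
          (p.sampleLaw L) := by
        refine Integrable.of_bound (hm.norm.pow_const 2).aestronglyMeasurable (B ^ 2) ?_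
        filter_upwards [hsq] with s hs
        rwa [Real.norm_eq_abs, abs_of_nonneg (by positivity)]
      simpa using integral_mono_ae hint (integrable_const (B ^ 2)) hsq)
    (b := G / 2 ^ L + Lf * searchError φ κ η G N * (D + T * (τ * B))) (fun θ hθ hn => by
      refine le_trans ?_ (hp.le_integral_inner_approxGrad hφ hη hLf hθ hθs.1 N L).2
      have := mul_nonneg hLf he
      gcongr)
  simp only [sgEstimator_one]
  exact ⟨Filter.Eventually.of_forall h1, θs, hθs, h2, h3.trans hδ⟩

/-- The almost sure bound `B` is of order 2^L and would be too large as a moment bound. It serves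
only for the distance travelled, multiplied by the tiny search error, while the rate is governed by
the second moment `M`. -/
theorem Assumptions.mlmc_converges (hφ : IsDivergence φ κ) (hη : 0 < η) (hLf : 0 ≤ Lf)
    (hp : p.Assumptions φ η Lf C G) (hθ₁ : θ₁ ∈ p.Θ) (hθs : p.IsMinimizer φ η θs)
    (hD : ‖θ₁ - θs‖ ≤ D) (hτ : 0 < τ) (hT : 1 ≤ T) (N L : ℕ)
    {ζ : ℕ → Ω → Fin 1 → LevelSample E L} (hζ : IsIIDBatches μ (p.levelSampleLaw L) ζ) {B M δ : ℝ}
    (hB : 2 * 2 ^ L * (2 * (Lf * (1 + searchError φ κ η G N))) ≤ B)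
    (hM : Lf ^ 2 * (8 * (1 + searchError φ κ η G N) ^ 2
        + L * (24 * (G / (η * κ)) ^ 2 + 48 * (2 ^ L * searchError φ κ η G N ^ 2))) ≤ M)
    (hδ : D ^ 2 / (2 * τ * T) + τ * M / 2
      + (G / 2 ^ L + Lf * searchError φ κ η G N * (D + T * (τ * B))) ≤ δ) :
    p.IsDeltaOptimal φ η μ
      (fun ω => sgdOutput p.Θ τ θ₁ (fun t => p.mlmcEstimator φ η N (ζ t ω)) T) δ := by
  have := isProbabilityMeasure_levelSampleLaw hp.wellPosed L
  have he := hφ.searchError_nonneg hη G.2 N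
  obtain ⟨hl, hi⟩ := hζ.single
  obtain ⟨h1, h2, h3⟩ := projSGD_converges hp.wellPosed.closed_Θ hp.wellPosed.convex_Θ hθ₁ hθs.1 hτ
    hl hi (measurable_mlmcTerm hφ hp.wellPosed N L) (hp.convexOn_F hφ hη) hLf
    (fun θ hθ θ' hθ' => hp.abs_F_sub_le hφ hη hθ hθ') hD hT
    (fun θ hθ => (hp.ae_norm_mlmcTerm_le hφ hη hLf hθ N L).mono fun s hs => hs.trans hB)
    (fun θ hθ => (hp.integral_mlmcTerm_sq_le hφ hη hLf hθ N L).trans hM)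
    (b := G / 2 ^ L + Lf * searchError φ κ η G N * (D + T * (τ * B))) (fun θ hθ hn => by
      rw [hp.integral_inner_mlmcTerm hφ hη hLf hθ]
      refine le_trans ?_ (hp.le_integral_inner_approxGrad hφ hη hLf hθ hθs.1 N L).2
      have := mul_nonneg hLf he
      gcongr)
  simp only [mlmcEstimator_one]
  exact ⟨Filter.Eventually.of_forall h1, θs, hθs, h2, h3.trans hδ⟩

/-! ### Cost -/

theorem sgdCost_sg (N L : ℕ) (ζ : ℕ → Fin 1 → Sample E L) :
    sgdCost p.Θ τ θ₁ (fun t => p.sgEstimator φ η N (ζ t)) (fun t => p.sgCost φ η N (ζ t)) T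
      = (T - 1) * (1 + 2 ^ L + (N + 2) * 2 ^ L) := by
  simp [sgdCost, sgCost, approxGradQueries, bisectQueries_eq]

/-- At a positive level all points are searched twice, once together and once in halves, each pass
count being N + 2; generating the samples adds at most two more units per point. -/
theorem mlmcCost_one_le (N L : ℕ) (ζ : Fin 1 → LevelSample E L) (θ : Param n) :
    p.mlmcCost φ η N ζ θ ≤ (2 * N + 6) * 2 ^ ((ζ 0).1 : ℕ) := by
  have key : ∀ (ℓ : ℕ) (s : Sample E ℓ),
      1 + 2 ^ ℓ + p.levelDiffQueries φ η N θ ℓ s ≤ (2 * N + 6) * 2 ^ ℓ := by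
    intro ℓ s
    have h1 := Nat.one_le_two_pow (n := ℓ)
    cases ℓ with
    | zero =>
      simp only [levelDiffQueries, approxGradQueries, bisectQueries_eq]
      nlinarith
    | succ ℓ =>
      simp only [levelDiffQueries, approxGradQueries, bisectQueries_eq]
      rw [pow_succ] at h1 ⊢
      nlinarith
  simpa [mlmcCost] using key (ζ 0).1 (ζ 0).2

theorem lintegral_two_pow_level (hp : p.WellPosed φ η) (L : ℕ) :
    ∫⁻ s, (2 : ℝ≥0∞) ^ (s.1 : ℕ) ∂p.levelSampleLaw L ≤ L + 1 := by
  have hmk := measurable_sigma_mk (β := fun ℓ : Fin (L + 1) => Sample E ℓ)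
  have hm : Measurable fun s : LevelSample E L => (2 : ℝ≥0∞) ^ (s.1 : ℕ) :=
    measurable_of_sigma fun ℓ => measurable_const (a := (2 : ℝ≥0∞) ^ (ℓ : ℕ))
  rw [levelSampleLaw, lintegral_finsetSum_measure]
  have h : ∀ ℓ : Fin (L + 1), ∫⁻ s, (2 : ℝ≥0∞) ^ (s.1 : ℕ) ∂(ENNReal.ofReal (levelProb L ℓ) •
      (p.sampleLaw ℓ).map (fun ζ => (⟨ℓ, ζ⟩ : LevelSample E L))) ≤ 1 := by
    intro ℓ
    have := isProbabilityMeasure_sampleLaw hp ℓ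
    rw [lintegral_smul_measure, lintegral_map hm (hmk ℓ)]
    simp only [lintegral_const, measure_univ, mul_one, smul_eq_mul]
    have : (2 : ℝ≥0∞) ^ (ℓ : ℕ) = ENNReal.ofReal (2 ^ (ℓ : ℕ)) := by
      rw [ENNReal.ofReal_pow (by norm_num)]; norm_num
    rw [this, ← ENNReal.ofReal_mul (levelProb_pos L ℓ).le]
    exact ENNReal.ofReal_le_one.2 (levelProb_mul_le L ℓ)
  refine (Finset.sum_le_sum fun ℓ _ => h ℓ).trans (le_of_eq ?_)
  simp

theorem lintegral_sgdCost_mlmc_le (hp : p.WellPosed φ η) (N L : ℕ)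
    {ζ : ℕ → Ω → Fin 1 → LevelSample E L} (hζ : IsIIDBatches μ (p.levelSampleLaw L) ζ) :
    ∫⁻ ω, (sgdCost p.Θ τ θ₁ (fun t => p.mlmcEstimator φ η N (ζ t ω))
        (fun t => p.mlmcCost φ η N (ζ t ω)) T : ℝ≥0∞) ∂μ
      ≤ T * ((2 * N + 6) * (L + 1)) := by
  obtain ⟨hl, -⟩ := hζ.single
  have hm : Measurable fun s : LevelSample E L => (2 : ℝ≥0∞) ^ (s.1 : ℕ) :=
    measurable_of_sigma fun ℓ => measurable_const (a := (2 : ℝ≥0∞) ^ (ℓ : ℕ))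
  have hm' : ∀ t, AEMeasurable (fun ω => (2 : ℝ≥0∞) ^ ((ζ t ω 0).1 : ℕ)) μ := fun t =>
    hm.comp_aemeasurable (hl t).aemeasurable
  calc ∫⁻ ω, (sgdCost p.Θ τ θ₁ (fun t => p.mlmcEstimator φ η N (ζ t ω))
        (fun t => p.mlmcCost φ η N (ζ t ω)) T : ℝ≥0∞) ∂μ
      ≤ ∫⁻ ω, ∑ t ∈ Finset.range (T - 1), (2 * N + 6) * (2 : ℝ≥0∞) ^ ((ζ t ω 0).1 : ℕ) ∂μ := by
        refine lintegral_mono fun ω => ?_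
        rw [sgdCost, Nat.cast_sum]
        refine Finset.sum_le_sum fun t _ => ?_
        exact_mod_cast mlmcCost_one_le N L (ζ t ω) _
    _ = ∑ t ∈ Finset.range (T - 1), (2 * N + 6) * ∫⁻ ω, (2 : ℝ≥0∞) ^ ((ζ t ω 0).1 : ℕ) ∂μ := by
        rw [lintegral_finsetSum' _ fun t _ => (hm' t).const_mul _]
        exact Finset.sum_congr rfl fun t _ => lintegral_const_mul'' _ (hm' t)
    _ ≤ ∑ _t ∈ Finset.range (T - 1), (2 * N + 6) * ((L : ℝ≥0∞) + 1) := by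
        refine Finset.sum_le_sum fun t _ => mul_le_mul_right ?_ _
        refine le_trans (le_of_eq ?_) (lintegral_two_pow_level hp L)
        rw [← (hl t).map_eq, lintegral_map' hm.aemeasurable (hl t).aemeasurable]
    _ ≤ T * ((2 * N + 6) * (L + 1)) := by
        rw [Finset.sum_const, Finset.card_range, nsmul_eq_mul]
        gcongr
        exact Nat.sub_le T 1

end Convergence

end Problem

end AdvRobust

namespace AdvRobust

/-! ### Choice of the parameters -/

section Parameters

/-- The threshold 1/3 exceeds no value of 1/e, so additive constants can be absorbed into the
logarithm. -/
theorem one_le_log_inv {δ : ℝ} (h0 : 0 < δ) (h1 : δ < 1 / 3) : 1 ≤ Real.log (1 / δ) := by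
  rw [Real.le_log_iff_exp_le (by positivity), le_div_iff₀ h0]
  nlinarith [Real.exp_one_lt_d9]

theorem div_two_pow_maxLevel_le (G : ℝ≥0) {δ : ℝ} (h0 : 0 < δ) :
    (G : ℝ) / 2 ^ maxLevel G δ ≤ δ / 8 := by
  rcases eq_or_lt_of_le G.2 with hG | hG
  · rw [show (G : ℝ) = 0 from hG.symm, zero_div]
    positivity
  · have hG : (0 : ℝ) < G := hG
    have h := Nat.le_ceil (Real.logb 2 (8 * G / δ))
    rw [Real.logb_le_iff_le_rpow (by norm_num) (by positivity), Real.rpow_natCast,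
      div_le_iff₀ h0] at h
    rw [div_le_iff₀ (by positivity)]
    unfold maxLevel
    linarith

theorem two_pow_maxLevel_le (G : ℝ≥0) {δ : ℝ} (h0 : 0 < δ) (h1 : δ < 1 / 3) :
    (2 : ℝ) ^ maxLevel G δ ≤ (16 * G + 1) / δ := by
  rw [le_div_iff₀ h0]
  have hG0 : (0 : ℝ) ≤ G := G.2
  rcases Nat.eq_zero_or_pos (maxLevel G δ) with h | h
  · rw [h, pow_zero]
    linarith
  · have hlog : 0 < Real.logb 2 (8 * G / δ) := Nat.ceil_pos.1 h
    have hG : 0 < 8 * G / δ := by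
      refine lt_of_le_of_ne (by positivity) fun h => ?_
      rw [← h, Real.logb_zero] at hlog
      exact lt_irrefl _ hlog
    have h2 := (Nat.ceil_lt_add_one hlog.le).le
    have h3 : (2 : ℝ) ^ maxLevel G δ ≤ 2 ^ (Real.logb 2 (8 * G / δ) + 1) := by
      rw [← Real.rpow_natCast]
      exact Real.rpow_le_rpow_of_exponent_le (by norm_num) h2
    rw [Real.rpow_add (by norm_num), Real.rpow_logb (by norm_num) (by norm_num) hG,
      Real.rpow_one] at h3
    have h4 := mul_le_mul_of_nonneg_right h3 h0.le
    rw [show 8 * (G : ℝ) / δ * 2 * δ = 16 * G by field_simp; ring] at h4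
    linarith

theorem maxLevel_add_one_le (G : ℝ≥0) {δ : ℝ} (h0 : 0 < δ) (h1 : δ < 1 / 3) :
    (maxLevel G δ : ℝ) + 1
      ≤ ((Real.log (16 * G + 1) + 1) / Real.log 2 + 1) * Real.log (1 / δ) := by
  have hl := one_le_log_inv h0 h1
  have h2 : 0 < Real.log 2 := Real.log_pos (by norm_num)
  have hK : (1 : ℝ) ≤ 16 * G + 1 := by linarith [G.2, show (0 : ℝ) ≤ G from G.2]
  have h3 := Real.log_le_log (by positivity) (two_pow_maxLevel_le G h0 h1)
  rw [Real.log_pow, div_eq_mul_one_div, Real.log_mul (by linarith) (by positivity)] at h3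
  have h4 := Real.log_nonneg hK
  have h5 : (maxLevel G δ : ℝ) ≤ (Real.log (16 * G + 1) + 1) / Real.log 2 * Real.log (1 / δ) := by
    rw [div_mul_eq_mul_div, le_div_iff₀ h2]
    nlinarith
  linarith

/-- The cubic accuracy is needed because the error is later multiplied by a distance of order δ⁻²
and must still be of order `δ`; it costs only a constant factor in `N`. -/
theorem exists_iterations {E₀ Q : ℝ} (hE : 0 ≤ E₀) (hQ : 0 ≤ Q) :
    ∃ A : ℝ, 0 < A ∧ ∀ δ : ℝ, 0 < δ → δ < 1 / 3 →
      ∃ N : ℕ, (N : ℝ) ≤ A * Real.log (1 / δ) ∧ E₀ / 2 ^ N * Q ≤ δ ^ 3 := by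
  have h2 : 0 < Real.log 2 := Real.log_pos (by norm_num)
  set H := 1 + E₀ * Q with hH
  have hH1 : 1 ≤ H := by
    have := mul_nonneg hE hQ
    linarith
  have hlH := Real.log_nonneg hH1
  refine ⟨(3 + Real.log H) / Real.log 2 + 1, by positivity, fun δ h0 h1 => ?_⟩
  have hl := one_le_log_inv h0 h1
  refine ⟨⌈(3 + Real.log H) / Real.log 2 * Real.log (1 / δ)⌉₊, ?_, ?_⟩
  · have := Nat.ceil_lt_add_one
      (show 0 ≤ (3 + Real.log H) / Real.log 2 * Real.log (1 / δ) by positivity)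
    linarith
  · set N := ⌈(3 + Real.log H) / Real.log 2 * Real.log (1 / δ)⌉₊
    have hN : (3 + Real.log H) / Real.log 2 * Real.log (1 / δ) ≤ N := Nat.le_ceil _
    rw [div_mul_eq_mul_div, div_le_iff₀ h2] at hN
    have h3 : 3 * Real.log (1 / δ) + Real.log H ≤ N * Real.log 2 := by nlinarith
    have h4 : (1 / δ) ^ 3 * H ≤ 2 ^ N := by
      rw [← Real.log_le_log_iff (by positivity) (by positivity),
        Real.log_mul (by positivity) (by positivity), Real.log_pow, Real.log_pow]
      exact_mod_cast h3
    rw [div_mul_eq_mul_div, div_le_iff₀ (by positivity)]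
    have h5 := mul_le_mul_of_nonneg_left h4 (show 0 ≤ δ ^ 3 by positivity)
    rw [← mul_assoc, ← mul_pow, mul_one_div_cancel h0.ne', one_pow, one_mul] at h5
    linarith

/-- Step size and number of steps for a stochastic gradient with second moment at most `M`. -/
theorem exists_steps {M D δ : ℝ} (hM : 1 ≤ M) (h0 : 0 < δ) (h1 : δ < 1 / 3) :
    ∃ T : ℕ, 1 ≤ T ∧ (T : ℝ) ≤ (4 * D ^ 2 + 5) * M / δ ^ 2 ∧
      T * (δ / (2 * M)) ≤ (2 * D ^ 2 + 3) / δ ∧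
      D ^ 2 / (2 * (δ / (2 * M)) * T) + δ / (2 * M) * M / 2 ≤ δ / 2 := by
  have hM0 : 0 < M := by linarith
  -- Chosen so that the distance term and the noise term are each at most δ/4. The summand 1 keeps
  -- `T` positive when D = 0, and M ≥ 1 absorbs the rounding.
  have hx : 0 < 4 * (D ^ 2 + 1) * M / δ ^ 2 := by positivity
  have hT := Nat.le_ceil (4 * (D ^ 2 + 1) * M / δ ^ 2)
  have hT2 := (Nat.ceil_lt_add_one hx.le).le
  have hT1 : 1 ≤ ⌈4 * (D ^ 2 + 1) * M / δ ^ 2⌉₊ := Nat.ceil_pos.2 hx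
  set T := ⌈4 * (D ^ 2 + 1) * M / δ ^ 2⌉₊
  have hδ2 : δ ^ 2 ≤ 1 := by nlinarith
  have hone : 1 ≤ M / δ ^ 2 := by
    rw [le_div_iff₀ (by positivity)]
    linarith
  have hT3 : (T : ℝ) ≤ (4 * D ^ 2 + 5) * M / δ ^ 2 := by
    refine hT2.trans ?_
    have : (4 * D ^ 2 + 5) * M / δ ^ 2 = 4 * (D ^ 2 + 1) * M / δ ^ 2 + M / δ ^ 2 := by ring
    linarith
  refine ⟨T, hT1, hT3, ?_, ?_⟩
  · have h := mul_le_mul_of_nonneg_right hT3 (show 0 ≤ δ / (2 * M) by positivity)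
    refine h.trans ?_
    rw [show (4 * D ^ 2 + 5) * M / δ ^ 2 * (δ / (2 * M)) = (2 * D ^ 2 + 5 / 2) / δ by
      field_simp; ring]
    gcongr
    norm_num
  · have hTpos : (0 : ℝ) < T := by exact_mod_cast hT1
    have h3 : D ^ 2 / (2 * (δ / (2 * M)) * T) ≤ δ / 4 := by
      rw [div_le_iff₀ (by positivity)]
      rw [div_le_iff₀ (by positivity)] at hT
      have : δ / 4 * (2 * (δ / (2 * M)) * T) = T * δ ^ 2 / (4 * M) := by field_simp
      rw [this, le_div_iff₀ (by positivity)]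
      nlinarith
    have h4 : δ / (2 * M) * M / 2 = δ / 4 := by field_simp; ring
    linarith

/-- The number of iterations of the bisection search. -/
theorem exists_search {φ : ℝ → ℝ≥0∞} {κ η : ℝ} (hφ : IsDivergence φ κ) (hη : 0 < η) {Lf S : ℝ}
    (hLf : 0 ≤ Lf) (hS : 0 ≤ S) (G : ℝ≥0) :
    ∃ A : ℝ, 0 < A ∧ ∀ δ : ℝ, 0 < δ → δ < 1 / 3 → ∃ N : ℕ, (N : ℝ) ≤ A * Real.log (1 / δ) ∧
      searchError φ κ η G N ≤ 1 ∧ 2 ^ maxLevel G δ * searchError φ κ η G N ^ 2 ≤ 1 ∧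
      (bisectWidth φ η G / 2 ^ N) ^ 2 / (η * κ) ≤ δ / 8 ∧
      Lf * searchError φ κ η G N * (S / δ ^ 2) ≤ δ / 8 := by
  have hk := hφ.modulus_pos
  have hG : (0 : ℝ) ≤ G := G.2
  have hW : 0 ≤ bisectWidth φ η G := by
    unfold bisectWidth
    positivity
  -- Each summand of `Q` secures one requirement: a bounded search error, the value gap, the factor
  -- 2^L in the second moment, and the bias along the iterates.
  obtain ⟨A, hA, h⟩ := exists_iterations (E₀ := bisectWidth φ η G / (η * κ))
    (Q := 1 + 8 * (η * κ) + (16 * G + 1) + 8 * Lf * S) (by positivity) (by positivity)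
  refine ⟨A, hA, fun δ h0 h1 => ?_⟩
  obtain ⟨N, hN, hQ⟩ := h δ h0 h1
  have he := hφ.searchError_nonneg hη hG N
  have e1 : bisectWidth φ η G / (η * κ) / 2 ^ N = searchError φ κ η G N := by
    unfold searchError
    rw [div_right_comm]
  have e2 : (bisectWidth φ η G / 2 ^ N) ^ 2 / (η * κ)
      = searchError φ κ η G N * (searchError φ κ η G N * (η * κ)) := by
    unfold searchError
    field_simp
  rw [e1] at hQ
  set e := searchError φ κ η G N
  have p1 : 0 ≤ e * (8 * (η * κ)) := by positivity
  have p2 : 0 ≤ e * (16 * G + 1) := by positivity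
  have p3 : 0 ≤ e * (8 * Lf * S) := by positivity
  have d2 : δ ^ 2 ≤ 1 := by nlinarith
  have d3 : δ ^ 3 ≤ δ := by nlinarith
  have q1 : e ≤ 1 := by linarith
  have q2 : e * (16 * G + 1) ≤ δ := by linarith
  have q3 : e * (8 * (η * κ)) ≤ δ := by linarith
  have q4 : e * (8 * Lf * S) ≤ δ ^ 3 := by linarith
  refine ⟨N, hN, q1, ?_, ?_, ?_⟩
  · calc (2 : ℝ) ^ maxLevel G δ * e ^ 2 ≤ (16 * G + 1) / δ * e ^ 2 := by
          gcongr
          exact two_pow_maxLevel_le G h0 h1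
      _ = e * (16 * G + 1) / δ * e := by ring
      _ ≤ 1 * 1 := by
          refine mul_le_mul ?_ q1 he zero_le_one
          rwa [div_le_one h0]
      _ = 1 := one_mul 1
  · rw [e2]
    have : e * (e * (η * κ)) ≤ 1 * (e * (η * κ)) := by gcongr
    linarith
  · rw [mul_div_assoc', div_le_iff₀ (by positivity)]
    nlinarith

/-- A bound of the distance travelled by the iterates. -/
theorem add_mul_step_le {D R B B' S T τ δ : ℝ} (hD : 0 ≤ D) (hR : 0 ≤ R) (hB0 : 0 ≤ B)
    (h0 : 0 < δ) (h1 : δ ≤ 1) (hT : T * τ ≤ R / δ) (hB : B ≤ B' / δ) (hS : D + R * B' ≤ S) :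
    D + T * (τ * B) ≤ S / δ ^ 2 := by
  have h2 : T * (τ * B) ≤ R / δ * (B' / δ) := by
    rw [← mul_assoc]
    exact mul_le_mul hT hB hB0 (by positivity)
  have h3 : D ≤ D / δ ^ 2 := le_div_self hD (by positivity) (pow_le_one₀ h0.le h1)
  have h4 : (D + R * B') / δ ^ 2 ≤ S / δ ^ 2 := by gcongr
  have h5 : (D + R * B') / δ ^ 2 = D / δ ^ 2 + R / δ * (B' / δ) := by field_simp
  linarith

theorem sg_step_cost_le (T N L : ℕ) :
    (T - 1) * (1 + 2 ^ L + (N + 2) * 2 ^ L) ≤ T * ((N + 4) * 2 ^ L) := by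
  refine Nat.mul_le_mul (Nat.sub_le T 1) ?_
  have := Nat.one_le_two_pow (n := L)
  nlinarith

/-- The moment is in fact linear in `ℓ`; it is relaxed to `ℓ ^ 2` to match the intended step size.
The constant 80 is 8 · 2² + 48. -/
theorem mlmc_moment_le {Lf e v y l c ℓ : ℝ} (he0 : 0 ≤ e) (he : e ≤ 1) (hv : 0 ≤ v) (hy : y ≤ 1)
    (hl : 0 ≤ l) (hc : 1 ≤ c) (hℓ : 1 ≤ ℓ) (hlc : l ≤ c * ℓ) :
    Lf ^ 2 * (8 * (1 + e) ^ 2 + l * (24 * v + 48 * y))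
      ≤ (1 + Lf ^ 2 * (80 + 24 * v) * c) * ℓ ^ 2 := by
  have hcl : 1 ≤ c * ℓ := one_le_mul_of_one_le_of_one_le hc hℓ
  have h1 : 8 * (1 + e) ^ 2 ≤ 32 * (c * ℓ) := by nlinarith
  have h2 : l * (24 * v + 48 * y) ≤ c * ℓ * (24 * v + 48) :=
    (mul_le_mul_of_nonneg_left (by linarith) hl).trans
      (mul_le_mul_of_nonneg_right hlc (by positivity))
  have hℓ2 : ℓ ≤ ℓ ^ 2 := le_self_pow₀ hℓ two_ne_zero
  calc Lf ^ 2 * (8 * (1 + e) ^ 2 + l * (24 * v + 48 * y))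
      ≤ Lf ^ 2 * (32 * (c * ℓ) + c * ℓ * (24 * v + 48)) := by gcongr
    _ = Lf ^ 2 * (80 + 24 * v) * c * ℓ := by ring
    _ ≤ Lf ^ 2 * (80 + 24 * v) * c * ℓ ^ 2 := by gcongr
    _ ≤ (1 + Lf ^ 2 * (80 + 24 * v) * c) * ℓ ^ 2 := by
        gcongr
        linarith

/-- A bound of the step size. -/
theorem step_le {c M x δ : ℝ} (hc : 1 ≤ c) (hM : 1 ≤ M) (hx : 0 ≤ x) (h0 : 0 ≤ δ) :
    δ / (2 * (M * x)) ≤ c * x⁻¹ * δ := by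
  rw [show δ / (2 * (M * x)) = 1 / (2 * M) * x⁻¹ * δ by ring]
  gcongr
  refine le_trans ?_ hc
  rw [div_le_one (by positivity)]
  linarith

end Parameters

end AdvRobust

/-! ### The main theorem -/

theorem mainTheorem4 (φ : ℝ → ℝ≥0∞) (κ η Lf C D : ℝ) (G : ℝ≥0)
    (hφ : AdvRobust.IsDivergence φ κ) (hη : 0 < η) (hLf : 0 ≤ Lf) (hD : 0 ≤ D) :
    ∃ c δ₀ : ℝ, 0 < c ∧ 0 < δ₀ ∧ ∀ δ : ℝ, 0 < δ → δ < δ₀ →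
      -- SG estimator
      (∃ (T N : ℕ) (τ : ℝ), 1 ≤ T ∧ (T : ℝ) ≤ c / δ ^ 2 ∧ 0 < τ ∧ τ ≤ c * δ ∧
        (N : ℝ) ≤ c * Real.log (1 / δ) ∧
        ∀ (E : Type*) [NormedAddCommGroup E] [NormedSpace ℝ E] [FiniteDimensional ℝ E]
          [MeasureSpace E] [BorelSpace E] [(volume : Measure E).IsAddHaarMeasure]
          (n : ℕ) (p : AdvRobust.Problem E n) (θ₁ : AdvRobust.Param n),
          p.Assumptions φ η Lf C G → θ₁ ∈ p.Θ →
          (∃ θs, p.IsMinimizer φ η θs ∧ ‖θ₁ - θs‖ ≤ D) →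
          p.SearchGapLE φ η N (AdvRobust.maxLevel G δ) (δ / 8) ∧
          ∀ (Ω : Type*) [MeasurableSpace Ω] (μ : Measure Ω) [IsProbabilityMeasure μ]
            (ζ : ℕ → Ω → Fin 1 → AdvRobust.Sample E (AdvRobust.maxLevel G δ)),
            AdvRobust.IsIIDBatches μ (p.sampleLaw (AdvRobust.maxLevel G δ)) ζ →
            p.IsDeltaOptimal φ η μ
              (fun ω => AdvRobust.sgdOutput p.Θ τ θ₁
                (fun t => p.sgEstimator φ η N (ζ t ω)) T) δ ∧
            ∀ ω, (AdvRobust.sgdCost p.Θ τ θ₁ (fun t => p.sgEstimator φ η N (ζ t ω))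
                (fun t => p.sgCost φ η N (ζ t ω)) T : ℝ)
              ≤ c * (δ ^ 3)⁻¹ * Real.log (1 / δ)) ∧
      -- RT-MLMC estimator
      (∃ (T N : ℕ) (τ : ℝ), 1 ≤ T ∧ (T : ℝ) ≤ c * Real.log (1 / δ) ^ 2 / δ ^ 2 ∧
        0 < τ ∧ τ ≤ c * (Real.log (1 / δ) ^ 2)⁻¹ * δ ∧
        (N : ℝ) ≤ c * Real.log (1 / δ) ∧
        ∀ (E : Type*) [NormedAddCommGroup E] [NormedSpace ℝ E] [FiniteDimensional ℝ E]
          [MeasureSpace E] [BorelSpace E] [(volume : Measure E).IsAddHaarMeasure]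
          (n : ℕ) (p : AdvRobust.Problem E n) (θ₁ : AdvRobust.Param n),
          p.Assumptions φ η Lf C G → θ₁ ∈ p.Θ →
          (∃ θs, p.IsMinimizer φ η θs ∧ ‖θ₁ - θs‖ ≤ D) →
          p.SearchGapLE φ η N (AdvRobust.maxLevel G δ) (δ / 8) ∧
          ∀ (Ω : Type*) [MeasurableSpace Ω] (μ : Measure Ω) [IsProbabilityMeasure μ]
            (ζ : ℕ → Ω → Fin 1 → AdvRobust.LevelSample E (AdvRobust.maxLevel G δ)),
            AdvRobust.IsIIDBatches μ (p.levelSampleLaw (AdvRobust.maxLevel G δ)) ζ →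
            p.IsDeltaOptimal φ η μ
              (fun ω => AdvRobust.sgdOutput p.Θ τ θ₁
                (fun t => p.mlmcEstimator φ η N (ζ t ω)) T) δ ∧
            ∫⁻ ω, (AdvRobust.sgdCost p.Θ τ θ₁ (fun t => p.mlmcEstimator φ η N (ζ t ω))
                (fun t => p.mlmcCost φ η N (ζ t ω)) T : ℝ≥0∞) ∂μ
              ≤ ENNReal.ofReal (c * (δ ^ 2)⁻¹ * Real.log (1 / δ) ^ 4)) := by
  have hk := hφ.modulus_pos
  have hG : (0 : ℝ) ≤ G := G.2
  set K : ℝ := 16 * G + 1 with hK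
  set R : ℝ := 2 * D ^ 2 + 3 with hR
  -- Covers the distances travelled by both methods, so that one `N` serves both.
  set S : ℝ := D + R * (2 * Lf + 1) + R * (8 * Lf * K) with hS
  obtain ⟨A, hA, hN⟩ := AdvRobust.exists_search hφ hη hLf (S := S) (by positivity) G
  set cL : ℝ := (Real.log K + 1) / Real.log 2 + 1 with hcL
  have hlK : 0 ≤ Real.log K := Real.log_nonneg (by linarith)
  have hl2 : 0 < Real.log 2 := Real.log_pos (by norm_num)
  have hcL1 : 1 ≤ cL := by
    have : 0 ≤ (Real.log K + 1) / Real.log 2 := by positivity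
    linarith
  set B₁ : ℝ := 2 * Lf + 1 with hB₁
  set M₁ : ℝ := B₁ ^ 2 with hM₁
  set M₂ : ℝ := 1 + Lf ^ 2 * (80 + 24 * (G / (η * κ)) ^ 2) * cL with hM₂
  set c₀ : ℝ := 4 * D ^ 2 + 5 with hc₀
  have hB₁0 : 0 ≤ B₁ := by positivity
  have hR0 : 0 ≤ R := by positivity
  have hS₁ : D + R * B₁ ≤ S := by
    have : 0 ≤ R * (8 * Lf * K) := by positivity
    linarith
  have hS₂ : D + R * (8 * Lf * K) ≤ S := by
    have : 0 ≤ R * B₁ := by positivity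
    linarith
  have hM₁1 : 1 ≤ M₁ := one_le_pow₀ (by linarith)
  have hM₂1 : 1 ≤ M₂ := by
    have : 0 ≤ Lf ^ 2 * (80 + 24 * (G / (η * κ)) ^ 2) * cL := by positivity
    linarith
  have a1 : 0 ≤ c₀ * M₁ := by positivity
  have a2 : 0 ≤ c₀ * M₁ * (K * (A + 4)) := by positivity
  have a3 : 0 ≤ c₀ * M₂ := by positivity
  have a4 : 0 ≤ c₀ * M₂ * ((2 * A + 6) * cL) := by positivity
  set c : ℝ := 1 + A + c₀ * M₁ + c₀ * M₁ * (K * (A + 4)) + c₀ * M₂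
    + c₀ * M₂ * ((2 * A + 6) * cL) with hc
  refine ⟨c, 1 / 3, by positivity, by norm_num, fun δ h0 h1 => ?_⟩
  have hl := AdvRobust.one_le_log_inv h0 h1
  obtain ⟨N, hNA, he1, heL, hgap, hbias⟩ := hN δ h0 h1
  have hL1 := AdvRobust.maxLevel_add_one_le G h0 h1
  have hL2 := AdvRobust.two_pow_maxLevel_le G h0 h1
  have hL3 := AdvRobust.div_two_pow_maxLevel_le G h0
  have he0 := hφ.searchError_nonneg hη hG N
  set ℓ := Real.log (1 / δ)
  set L := AdvRobust.maxLevel G δ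
  set e := AdvRobust.searchError φ κ η G N
  have hNc : (N : ℝ) ≤ c * ℓ := by
    refine hNA.trans (mul_le_mul_of_nonneg_right ?_ (by linarith))
    linarith
  have hδ1 : δ ≤ 1 := by linarith
  refine ⟨?_, ?_⟩
  · obtain ⟨T, hT1, hT2, hT3, hT4⟩ := AdvRobust.exists_steps (D := D) hM₁1 h0 h1
    have hM0 : 0 < M₁ := by linarith
    have hτ : 0 < δ / (2 * M₁) := by positivity
    refine ⟨T, N, δ / (2 * M₁), hT1, ?_, hτ, ?_, hNc, ?_⟩
    · refine hT2.trans ?_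
      gcongr
      linarith
    · simpa using AdvRobust.step_le (x := 1) (by linarith) hM₁1 zero_le_one h0.le
    · intro E _ _ _ _ _ _ n p θ₁ hp hθ₁ hθs
      obtain ⟨θs, hθs, hD1⟩ := hθs
      refine ⟨hp.searchGapLE hφ hη L hgap, fun Ω _ μ _ ζ hζ => ⟨?_, fun ω => ?_⟩⟩
      · refine hp.sg_converges hφ hη hLf hθ₁ hθs hD1 hτ hT1 N L hζ (B := B₁) ?_ ?_
        · rw [hB₁]
          linarith [mul_le_mul_of_nonneg_left he1 hLf]
        -- Error budget: δ/2 from the optimization, δ/8 from sampling at level `L`, and δ/8 from the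
        -- search.
        · have hs := AdvRobust.add_mul_step_le hD hR0 hB₁0 h0 hδ1 hT3
            (le_div_self hB₁0 h0 hδ1) hS₁
          have h6 := (mul_le_mul_of_nonneg_left hs (mul_nonneg hLf he0)).trans hbias
          linarith
      · rw [AdvRobust.Problem.sgdCost_sg]
        have hle' : (((T - 1) * (1 + 2 ^ L + (N + 2) * 2 ^ L) : ℕ) : ℝ)
            ≤ T * ((N + 4) * 2 ^ L) := by exact_mod_cast AdvRobust.sg_step_cost_le T N L
        refine hle'.trans ?_
        have hN4 : (N : ℝ) + 4 ≤ (A + 4) * ℓ := by linarith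
        calc (T : ℝ) * ((N + 4) * 2 ^ L) ≤ c₀ * M₁ / δ ^ 2 * ((A + 4) * ℓ * (K / δ)) := by gcongr
          _ = c₀ * M₁ * (K * (A + 4)) * (δ ^ 3)⁻¹ * ℓ := by field_simp
          _ ≤ c * (δ ^ 3)⁻¹ * ℓ := by
            gcongr
            linarith
  -- The squared logarithm in this moment bound enters `T`; the remaining two logarithms of the cost
  -- come from `N` and from the `L + 1` levels.
  · have hM2 : 1 ≤ M₂ * ℓ ^ 2 := one_le_mul_of_one_le_of_one_le hM₂1 (one_le_pow₀ hl)
    obtain ⟨T, hT1, hT2, hT3, hT4⟩ := AdvRobust.exists_steps (D := D) hM2 h0 h1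
    have hM0 : 0 < M₂ * ℓ ^ 2 := by linarith
    have hτ : 0 < δ / (2 * (M₂ * ℓ ^ 2)) := by positivity
    refine ⟨T, N, δ / (2 * (M₂ * ℓ ^ 2)), hT1, ?_, hτ, ?_, hNc, ?_⟩
    · refine hT2.trans ?_
      rw [← mul_assoc]
      gcongr
      linarith
    · exact AdvRobust.step_le (by linarith) hM₂1 (sq_nonneg ℓ) h0.le
    · intro E _ _ _ _ _ _ n p θ₁ hp hθ₁ hθs
      obtain ⟨θs, hθs, hD1⟩ := hθs
      refine ⟨hp.searchGapLE hφ hη L hgap, fun Ω _ μ _ ζ hζ => ⟨?_, ?_⟩⟩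
      · refine hp.mlmc_converges hφ hη hLf hθ₁ hθs hD1 hτ hT1 N L hζ (B := 8 * Lf * K / δ)
          (M := M₂ * ℓ ^ 2) ?_ ?_ ?_
        · calc 2 * 2 ^ L * (2 * (Lf * (1 + e))) ≤ 2 * (K / δ) * (2 * (Lf * (1 + 1))) := by gcongr
            _ = 8 * Lf * K / δ := by ring
        · exact AdvRobust.mlmc_moment_le he0 he1 (sq_nonneg _) heL (Nat.cast_nonneg L) hcL1 hl
            (by linarith)
        · have hs := AdvRobust.add_mul_step_le hD hR0 (B := 8 * Lf * K / δ) (by positivity) h0 hδ1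
            hT3 le_rfl hS₂
          have h6 := (mul_le_mul_of_nonneg_left hs (mul_nonneg hLf he0)).trans hbias
          linarith
      · refine (AdvRobust.Problem.lintegral_sgdCost_mlmc_le hp.wellPosed N L hζ).trans ?_
        rw [show (T : ℝ≥0∞) * ((2 * N + 6) * (L + 1))
          = ENNReal.ofReal ((T * ((2 * N + 6) * (L + 1)) : ℕ) : ℝ) by
            rw [ENNReal.ofReal_natCast]
            push_cast
            rfl]
        refine ENNReal.ofReal_le_ofReal ?_
        push_cast
        have hN6 : 2 * (N : ℝ) + 6 ≤ (2 * A + 6) * ℓ := by linarith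
        calc (T : ℝ) * ((2 * N + 6) * (L + 1))
            ≤ c₀ * (M₂ * ℓ ^ 2) / δ ^ 2 * ((2 * A + 6) * ℓ * (cL * ℓ)) := by gcongr
          _ = c₀ * M₂ * ((2 * A + 6) * cL) * (δ ^ 2)⁻¹ * ℓ ^ 4 := by field_simp
          _ ≤ c * (δ ^ 2)⁻¹ * ℓ ^ 4 := by
            gcongr
            linarith
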